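/- Setting. Let $V\in C^2(\mathbb R^2)$ and $\eta,\rho_0,u_0,z_0:\mathbb R\to\mathbb R$, where $\mathbb R_-=\,]-\infty,0]$, and put $R=[0,1]\times[\inf u_0,\sup u_0]$. Assume that (i) on $R$ one has $V\ge 0$, $\partial_1V\le 0$, $\partial_2V\ge 0$, and $V(1,w)=0$ for every $w\in[\inf u_0,\sup u_0]$; (ii) $\eta\in L^1\cap L^\infty(\mathbb R)$, $\eta\ge 0$, $\int_{\mathbb R}\eta\,dx=1$, $\eta=0$ on $]0,+\infty[$, and $\eta$ is non-decreasing on $\mathbb R_-$; (iii) $\rho_0\in L^1(\mathbb R)$, $0\le\rho_0\le 1$ a.e.; $u_0\ge 0$ is bounded and Lipschitz continuous; $z_0\in L^\infty(\mathbb R)$; and $u_0'=z_0\rho_0$ a.e. For $0<T\le+\infty$, a solution on $[0,T[$ is a pair $(\rho,u)\in L^\infty_{\rm loc}([0,T[;L^\infty(\mathbb R))\times L^\infty_{\rm loc}([0,T[;W^{1,\infty}(\mathbb R))$ of $$\partial_t\rho+\partial_x[V(\xi,u)\rho]=0,\qquad \partial_tu+V(\xi,u)\,\partial_xu=0,\qquad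 \xi(t,x)=\int_x^{+\infty}\rho(t,y)\,\eta(x-y)\,dy,$$ with $\rho(0,\cdot)=\rho_0$, $u(0,\cdot)=u_0$. The first equation, with its initial datum, is understood in the sense of distributions. The second one is understood as the statement that the weak derivative $\partial_tu$ is the locally bounded function $-V(\xi,u)\,\partial_xu$, with initial datum $u_0$. Lemma. Assume furthermore that $\eta$ is Lipschitz continuous on $\mathbb R_-$ and that $$\partial_1V\,\eta(0)+\|z_0\|_{L^\infty}\,\partial_2V\le 0\qquad\text{on }R.$$ Then there is a solution $(\rho,u)$ on $[0,+\infty[$, with $t\mapsto\rho(t,\cdot)$ weakly$^*$ continuous from $[0,+\infty[$ to $L^\infty(\mathbb R)$, $\rho(0,\cdot)=\rho_0$ a.e., $u$ continuous on $[0,+\infty[\,\times\mathbb R$ and $u(0,\cdot)=u_0$, such that for every $t\ge 0$ $$\rho(t,\cdot)\ge 0\ \text{ a.e.},\qquad \|\rho(t,\cdot)\|_{L^\infty(\mathbb R)}\le e^{\hat c t},\qquad \hat c=\Big(\max_{R}|\partial_1V|\Big)\,\|\eta'\|_{L^\infty(\mathbb R_-)}\,\|\rho_0\|_{L^1(\mathbb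 R)},$$ and $0\le\xi(t,x)\le 1$, $\inf u_0\le u(t,x)\le\sup u_0$ for every $t\ge 0$, $x\in\mathbb R$. Also, $\partial_xu=\rho z$ a.e. on $]0,+\infty[\,\times\mathbb R$ for some $z$ with $\|z\|_{L^\infty}\le\|z_0\|_{L^\infty}$. Moreover, $(\rho,u)$ extends every local solution: for every $0<T\le+\infty$, every solution on $[0,T[$ coincides with $(\rho,u)$ a.e. on $]0,T[\,\times\mathbb R$. -/

import Mathlib

open Set MeasureTheory Filter Topology
open scoped ContDiff

noncomputable section

namespace GARZ

/-- Partial derivative of the velocity in its first argument (the averaged density). -/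
def d1 (V : ℝ → ℝ → ℝ) (r w : ℝ) : ℝ := deriv (fun s => V s w) r

/-- Partial derivative of the velocity in its second argument (the empty road velocity). -/
def d2 (V : ℝ → ℝ → ℝ) (r w : ℝ) : ℝ := deriv (fun s => V r s) w

/-- The rectangle `[0, 1] × [inf u₀, sup u₀]`. -/
def rect (u₀ : ℝ → ℝ) : Set (ℝ × ℝ) := Icc 0 1 ×ˢ Icc (⨅ x, u₀ x) (⨆ x, u₀ x)

/-- The `L^∞` norm on the real line, as a real number. -/
def normInf (f : ℝ → ℝ) : ℝ := (eLpNorm f ⊤ volume).toReal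

/-- Assumptions on the velocity: `V` is of class `C²`, and on the rectangle `[0,1] × [inf u₀, sup u₀]`
it is nonnegative, nonincreasing in the density, nondecreasing in the empty road velocity, and it
vanishes when the density is `1`. -/
structure IsVelocity (V : ℝ → ℝ → ℝ) (u₀ : ℝ → ℝ) : Prop where
  contDiff : ContDiff ℝ 2 (Function.uncurry V)
  nonneg : ∀ p ∈ rect u₀, 0 ≤ V p.1 p.2
  d1_nonpos : ∀ p ∈ rect u₀, d1 V p.1 p.2 ≤ 0
  d2_nonneg : ∀ p ∈ rect u₀, 0 ≤ d2 V p.1 p.2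
  one_eq_zero : ∀ w ∈ Icc (⨅ x, u₀ x) (⨆ x, u₀ x), V 1 w = 0

/-- Look-ahead convolution kernels. Here `ℝ₋ = ]-∞, 0]`. -/
structure IsKernel (η : ℝ → ℝ) : Prop where
  integrable : Integrable η
  memLp_top : MemLp η ⊤ volume
  nonneg : ∀ x, 0 ≤ η x
  integral_eq_one : ∫ x, η x = 1
  supp : ∀ x, 0 < x → η x = 0
  mono : MonotoneOn η (Iic 0)

/-- Assumptions on the initial data `ρ₀`, `u₀`, with `u₀' = z₀ ρ₀`. -/
structure IsInitialData (ρ₀ u₀ z₀ : ℝ → ℝ) : Prop where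
  integrable : Integrable ρ₀
  density_mem : ∀ᵐ x, ρ₀ x ∈ Icc (0 : ℝ) 1
  nonneg : ∀ x, 0 ≤ u₀ x
  bounded : ∃ C : ℝ, ∀ x, |u₀ x| ≤ C
  lipschitz : ∃ K : NNReal, LipschitzWith K u₀
  memLp_z : MemLp z₀ ⊤ volume
  deriv_eq : ∀ᵐ x, HasDerivAt u₀ (z₀ x * ρ₀ x) x

/-- The open strip `]0, T[ × ℝ`, for `T` possibly infinite. Points are pairs `(t, x)`. -/
def strip (T : EReal) : Set (ℝ × ℝ) := {p | 0 < p.1 ∧ (p.1 : EReal) < T}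

/-- The averaged density `ξ(t, x) = ∫_x^∞ ρ(t, y) η(x - y) dy`. -/
def conv (η : ℝ → ℝ) (ρ : ℝ → ℝ → ℝ) (t x : ℝ) : ℝ := ∫ y in Ioi x, ρ t y * η (x - y)

/-- The space-time field `V(ξ, u)` with `ξ` the averaged density of `ρ`. -/
def speed (V : ℝ → ℝ → ℝ) (η : ℝ → ℝ) (ρ u : ℝ → ℝ → ℝ) (t x : ℝ) : ℝ :=
  V (conv η ρ t x) (u t x)

/-- Test functions: smooth functions of `(t, x)` with compact support contained in `t < T`. They need
not vanish at `t = 0`, so that the weak formulations below contain the initial conditions. -/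
structure IsTest (T : EReal) (φ : ℝ × ℝ → ℝ) : Prop where
  smooth : ContDiff ℝ ∞ φ
  compact : HasCompactSupport φ
  supp : ∀ p ∈ tsupport φ, (p.1 : EReal) < T

/-- `ρ ∈ L^∞_loc([0, T[; L^∞(ℝ))`. -/
def InDensityClass (T : EReal) (ρ : ℝ → ℝ → ℝ) : Prop :=
  ∀ τ : ℝ, (τ : EReal) < T → MemLp (Function.uncurry ρ) ⊤ (volume.restrict (strip τ))

/-- `u ∈ L^∞_loc([0, T[; W^{1,∞}(ℝ))`, where `W^{1,∞}(ℝ)` is the space of bounded Lipschitz functions. -/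
def InMarkerClass (T : EReal) (u : ℝ → ℝ → ℝ) : Prop :=
  ∀ τ : ℝ, (τ : EReal) < T →
    AEStronglyMeasurable (Function.uncurry u) (volume.restrict (strip τ)) ∧
    ∃ C : NNReal, ∀ᵐ t ∂(volume.restrict (Ioo 0 τ)),
      (∀ x, |u t x| ≤ C) ∧ LipschitzWith C (u t)

/-- `(ρ, u)` solves, on `[0, T[ × ℝ`, the Cauchy problem for
`∂ₜρ + ∂ₓ[V(ξ,u)ρ] = 0`, `∂ₜu + V(ξ,u)∂ₓu = 0` with data `ρ₀`, `u₀`, in the class above.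
The first equation is meant in the sense of distributions. The second one is an identity between
`L^∞` functions: the weak time derivative of `u` is the bounded function `-V(ξ,u)∂ₓu`, where `∂ₓu`
is the a.e. derivative of the Lipschitz function `u(t, ·)`. -/
structure IsSolution (V : ℝ → ℝ → ℝ) (η ρ₀ u₀ : ℝ → ℝ) (T : EReal) (ρ u : ℝ → ℝ → ℝ) : Prop where
  density_class : InDensityClass T ρ
  marker_class : InMarkerClass T u
  density_eq : ∀ φ : ℝ × ℝ → ℝ, IsTest T φ →
    (∫ p in strip T, (ρ p.1 p.2 * fderiv ℝ φ p (1, 0)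
        + speed V η ρ u p.1 p.2 * ρ p.1 p.2 * fderiv ℝ φ p (0, 1)))
      + ∫ x, ρ₀ x * φ (0, x) = 0
  marker_eq : ∀ φ : ℝ × ℝ → ℝ, IsTest T φ →
    (∫ p in strip T, (u p.1 p.2 * fderiv ℝ φ p (1, 0)
        - speed V η ρ u p.1 p.2 * deriv (u p.1) p.2 * φ p))
      + ∫ x, u₀ x * φ (0, x) = 0

/-- `t ↦ ρ(t, ·)` is continuous on `[0, ∞[` with values in `L^∞(ℝ)` with the weak-star topology. -/
def WeakStarContinuous (ρ : ℝ → ℝ → ℝ) : Prop :=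
  (∀ t, 0 ≤ t → MemLp (ρ t) ⊤ volume) ∧
  ∀ g : ℝ → ℝ, Integrable g → ContinuousOn (fun t => ∫ x, ρ t x * g x) (Ici 0)

/-- The growth rate `‖∂₁V‖_∞ ‖η'‖_{L^∞(ℝ₋)} ‖ρ₀‖_{L¹}`, where the first norm is over
`[0, 1] × [inf u₀, sup u₀]`. -/
def growthRate (V : ℝ → ℝ → ℝ) (η ρ₀ u₀ : ℝ → ℝ) : ℝ :=
  sSup ((fun p : ℝ × ℝ => |d1 V p.1 p.2|) '' rect u₀)
    * (eLpNorm (deriv η) ⊤ (volume.restrict (Iio 0))).toReal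
    * ∫ x, |ρ₀ x|

end GARZ

end

noncomputable section

namespace GARZ

/-! ### Global flows of bounded Lipschitz vector fields -/

/-! The solution is built in Lagrangian coordinates. A particle is labelled by its initial position
`a`, keeps the marker `u₀ a`, and moves with velocity `V(ξ, u₀ a)`, where `ξ` averages the kernel
against the initial density over the labels `b > a`. Because "ahead" refers to labels and not to
positions, and because the kernel is continued by its value at `0` to the right half line, the
right-hand side is a bounded Lipschitz function of the displacement in the sup norm. Picard–Lindelöf
then gives a global flow `X` (`LagSetup.exists_lagFlow`), with no prior knowledge that particles
stay ordered.

Two facts turn this flow into a solution. First, `ξ ≤ 1` (`LagSetup.lagMean_le_one`): a particle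
that sees `ξ ≥ 1` stands still while nobody moves backwards, so its `ξ` cannot grow. Secondly, `X t
b - X t a ≥ e^{-ct} (b - a)` for `a ≤ b`, where `c` is the announced growth rate
(`LagSetup.flow_sub_ge`). Indeed, if `m` is the mass between two neighbouring labels, then passing
from `a` to `b` removes about `η(0) m` from `ξ` and changes the marker by at most `‖z₀‖ m`; the sign
condition says that the resulting first-order term in the velocity difference is nonnegative. What
is left is `-c` times the gap, and an error quadratic in `b - a` which disappears on subdividing the
interval.

Hence the inverse map, from positions to labels, is Lipschitz with constant `e^{ct}`. The density
`r(label) ∂ₓ label` and the marker `u₀(label)` inherit all the bounds, and the two weak equations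
follow by a change of variables and by differentiation along trajectories.

For uniqueness, the space primitive of the density and the marker are both transported by the
velocity of the solution at hand. If this velocity is within `B e^{lt}` of that of the flow,
mollification along the trajectories of the flow shows that both quantities are within a multiple of
`(B/l) e^{lt}` of the transported data (`LagSetup.transport_stability`). Integrating by parts
against the monotone kernel bounds the difference of the averages by that of the primitives
(`kernel_stability`), so the velocity estimate returns with `B` replaced by a multiple of `B/l`. For
`l` large the constant is halved; iteration gives equality (`StripPair.ae_eq`). The other solution
needs no regularity beyond its class. -/

theorem exists_global_integralCurve {E : Type*} [NormedAddCommGroup E] [NormedSpace ℝ E]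
    [CompleteSpace E] (f : E → E) (K M : NNReal) (hK : LipschitzWith K f) (hM : ∀ x, ‖f x‖ ≤ M)
    (x₀ : E) : ∃ α : ℝ → E, α 0 = x₀ ∧ ∀ t, HasDerivAt α (f (α t)) t := by
  have loc : ∀ n : ℕ, ∃ α : ℝ → E, α 0 = x₀ ∧
      ∀ t ∈ Ioo (-(n + 1 : ℝ)) (n + 1), HasDerivAt α (f (α t)) t := by
    intro n
    have h0 : (0 : ℝ) ∈ Icc (-(n + 1 : ℝ)) (n + 1) := by
      constructor <;> linarith [(Nat.cast_nonneg n : (0 : ℝ) ≤ n)]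
    -- A curve of speed at most `M` stays in the ball of radius `M * (n + 1)` during the whole
    -- interval, so the local theorem covers all of it.
    have hpl : IsPicardLindelof (fun _ => f) (⟨0, h0⟩ : Icc (-(n + 1 : ℝ)) (n + 1)) x₀
        (M * (n + 1)) 0 M K := by
      refine ⟨fun t _ => hK.lipschitzOnWith, fun x _ => continuousOn_const, fun t _ x _ => hM x, ?_⟩
      simp
    obtain ⟨α, h1, h2⟩ := hpl.exists_eq_forall_mem_Icc_hasDerivWithinAt₀
    exact ⟨α, h1, fun t ht => (h2 t (Ioo_subset_Icc_self ht)).hasDerivAt (Icc_mem_nhds ht.1 ht.2)⟩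
  choose α hα0 hα using loc
  have agree : ∀ m n : ℕ, m ≤ n → EqOn (α m) (α n) (Ioo (-(m + 1 : ℝ)) (m + 1)) := by
    intro m n hmn
    have hmn' : (m : ℝ) ≤ n := by exact_mod_cast hmn
    refine ODE_solution_unique_of_mem_Ioo (K := K) (v := fun _ => f) (s := fun _ => univ) (t₀ := 0)
      (fun t _ => hK.lipschitzOnWith) ?_ (fun t ht => ⟨hα m t ht, mem_univ _⟩)
      (fun t ht => ⟨hα n t ⟨by linarith [ht.1], by linarith [ht.2]⟩, mem_univ _⟩) ?_
    · constructor <;> linarith [(Nat.cast_nonneg m : (0 : ℝ) ≤ m)]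
    · rw [hα0, hα0]
  -- The solution of index `⌈|t|⌉₊` lives on an open interval that contains `t`, because of the
  -- extra `1` in its length.
  refine ⟨fun t => α ⌈|t|⌉₊ t, by simpa using hα0 0, fun t => ?_⟩
  set N := ⌈|t|⌉₊ with hN
  have htN : t ∈ Ioo (-(N + 1 : ℝ)) (N + 1) := by
    have : |t| ≤ N := Nat.le_ceil _
    have := abs_le.1 this
    constructor <;> linarith
  refine (hα N t htN).congr_of_eventuallyEq ?_
  filter_upwards [Ioo_mem_nhds htN.1 htN.2] with s hs
  have hs' : s ∈ Ioo (-((⌈|s|⌉₊ : ℕ) + 1 : ℝ)) ((⌈|s|⌉₊ : ℕ) + 1) := by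
    have : |s| ≤ (⌈|s|⌉₊ : ℕ) := Nat.le_ceil _
    have := abs_le.1 this
    constructor <;> linarith
  rcases le_total ⌈|s|⌉₊ N with h | h
  · exact agree _ _ h hs'
  · exact (agree _ _ h hs).symm

/-! ### The Lagrangian vector field -/

/-- The velocity with its first argument projected onto `[0, 1]`. -/
def clampVel (V : ℝ → ℝ → ℝ) (ξ w : ℝ) : ℝ := V (max 0 (min ξ 1)) w

/-- The averaged density seen by the particle with label `a`, for the configuration `X`. -/
def lagMean (κ r X : ℝ → ℝ) (a : ℝ) : ℝ := ∫ b in Ioi a, κ (X a - X b) * r b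

/-- The standing assumptions, after replacing the kernel by its constant extension `κ` to the right
half line, and the initial density by a Borel representative `r` with values in `[0, 1]`. -/
structure LagSetup (V : ℝ → ℝ → ℝ) (κ r u : ℝ → ℝ) (lo hi : ℝ) (L K₀ : NNReal) (Z C₁ C₂ : ℝ) :
    Prop where
  contDiff : ContDiff ℝ 2 (Function.uncurry V)
  nonneg : ∀ ξ ∈ Icc (0 : ℝ) 1, ∀ w ∈ Icc lo hi, 0 ≤ V ξ w
  d1_nonpos : ∀ ξ ∈ Icc (0 : ℝ) 1, ∀ w ∈ Icc lo hi, d1 V ξ w ≤ 0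
  d2_nonneg : ∀ ξ ∈ Icc (0 : ℝ) 1, ∀ w ∈ Icc lo hi, 0 ≤ d2 V ξ w
  d1_le : ∀ ξ ∈ Icc (0 : ℝ) 1, ∀ w ∈ Icc lo hi, |d1 V ξ w| ≤ C₁
  d2_le : ∀ ξ ∈ Icc (0 : ℝ) 1, ∀ w ∈ Icc lo hi, |d2 V ξ w| ≤ C₂
  one_eq_zero : ∀ w ∈ Icc lo hi, V 1 w = 0
  κ_mono : Monotone κ
  κ_nonneg : ∀ x, 0 ≤ κ x
  κ_lip : LipschitzWith L κ
  κ_const : ∀ x, 0 ≤ x → κ x = κ 0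
  r_meas : Measurable r
  r_mem : ∀ x, r x ∈ Icc (0 : ℝ) 1
  r_int : Integrable r
  u_mem : ∀ x, u x ∈ Icc lo hi
  u_lip : LipschitzWith K₀ u
  u_incr : ∀ a b, a ≤ b → |u b - u a| ≤ Z * ∫ c in a..b, r c
  slope : ∀ ξ ∈ Icc (0 : ℝ) 1, ∀ w ∈ Icc lo hi, d1 V ξ w * κ 0 + Z * d2 V ξ w ≤ 0
  mass : ∀ a, lagMean κ r id a ≤ 1

namespace LagSetup

variable {V : ℝ → ℝ → ℝ} {κ r u : ℝ → ℝ} {lo hi : ℝ} {L K₀ : NNReal} {Z C₁ C₂ : ℝ}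

theorem C₁_nonneg (S : LagSetup V κ r u lo hi L K₀ Z C₁ C₂) : 0 ≤ C₁ :=
  (abs_nonneg _).trans (S.d1_le 0 ⟨le_rfl, zero_le_one⟩ (u 0) (S.u_mem 0))

theorem C₂_nonneg (S : LagSetup V κ r u lo hi L K₀ Z C₁ C₂) : 0 ≤ C₂ :=
  (abs_nonneg _).trans (S.d2_le 0 ⟨le_rfl, zero_le_one⟩ (u 0) (S.u_mem 0))

theorem mass_nonneg (S : LagSetup V κ r u lo hi L K₀ Z C₁ C₂) : 0 ≤ ∫ x, r x :=
  integral_nonneg fun x => (S.r_mem x).1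

theorem κ_le (S : LagSetup V κ r u lo hi L K₀ Z C₁ C₂) (x : ℝ) : κ x ≤ κ 0 := by
  rcases le_total x 0 with h | h
  · exact S.κ_mono h
  · exact (S.κ_const x h).le

theorem abs_κ_sub (S : LagSetup V κ r u lo hi L K₀ Z C₁ C₂) (x y : ℝ) :
    |κ x - κ y| ≤ L * |x - y| := by
  simpa [Real.dist_eq] using S.κ_lip.dist_le_mul x y

theorem hasFDerivAt (S : LagSetup V κ r u lo hi L K₀ Z C₁ C₂) (p : ℝ × ℝ) :
    HasFDerivAt (Function.uncurry V)
      (d1 V p.1 p.2 • ContinuousLinearMap.fst ℝ ℝ ℝ + d2 V p.1 p.2 • ContinuousLinearMap.snd ℝ ℝ ℝ)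
      p := by
  have hd : DifferentiableAt ℝ (Function.uncurry V) p :=
    S.contDiff.contDiffAt.differentiableAt (by norm_num)
  have h1 : HasDerivAt (fun s => V s p.2) (fderiv ℝ (Function.uncurry V) p (1, 0)) p.1 :=
    HasFDerivAt.comp_hasDerivAt (l := Function.uncurry V) (f := fun s => (s, p.2)) p.1
      hd.hasFDerivAt ((hasDerivAt_id p.1).prodMk (hasDerivAt_const p.1 p.2))
  have h2 : HasDerivAt (fun s => V p.1 s) (fderiv ℝ (Function.uncurry V) p (0, 1)) p.2 :=
    HasFDerivAt.comp_hasDerivAt (l := Function.uncurry V) (f := fun s => (p.1, s)) p.2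
      hd.hasFDerivAt ((hasDerivAt_const p.2 p.1).prodMk (hasDerivAt_id p.2))
  convert! hd.hasFDerivAt using 1
  ext
  · simp [d1, h1.deriv]
  · simp [d2, h2.deriv]

/-- The mean value formula on the rectangle. -/
theorem exists_mvt (S : LagSetup V κ r u lo hi L K₀ Z C₁ C₂) {ξ ξ' w w' : ℝ}
    (hξ : ξ ∈ Icc (0 : ℝ) 1) (hξ' : ξ' ∈ Icc (0 : ℝ) 1) (hw : w ∈ Icc lo hi)
    (hw' : w' ∈ Icc lo hi) : ∃ ζ ∈ Icc (0 : ℝ) 1, ∃ ν ∈ Icc lo hi,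
      V ξ' w' - V ξ w = d1 V ζ ν * (ξ' - ξ) + d2 V ζ ν * (w' - w) := by
  obtain ⟨p, hp, h⟩ := domain_mvt (f := Function.uncurry V) (s := Icc (0 : ℝ) 1 ×ˢ Icc lo hi)
    (x := (ξ, w)) (y := (ξ', w')) (fun p _ => (S.hasFDerivAt p).hasFDerivWithinAt)
    ((convex_Icc _ _).prod (convex_Icc _ _)) ⟨hξ, hw⟩ ⟨hξ', hw'⟩
  have hp' := ((convex_Icc (0 : ℝ) 1).prod (convex_Icc lo hi)).segment_subset
    (x := (ξ, w)) (y := (ξ', w')) ⟨hξ, hw⟩ ⟨hξ', hw'⟩ hp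
  exact ⟨p.1, hp'.1, p.2, hp'.2, by simpa [Function.uncurry] using h⟩

theorem clamp_mem (ξ : ℝ) : max 0 (min ξ 1) ∈ Icc (0 : ℝ) 1 :=
  ⟨le_max_left _ _, max_le zero_le_one (min_le_right _ _)⟩

theorem clampVel_eq {ξ : ℝ} (h : ξ ∈ Icc (0 : ℝ) 1) (w : ℝ) : clampVel V ξ w = V ξ w := by
  rw [clampVel, min_eq_left h.2, max_eq_right h.1]

theorem clampVel_nonneg (S : LagSetup V κ r u lo hi L K₀ Z C₁ C₂) (ξ : ℝ) {w : ℝ}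
    (hw : w ∈ Icc lo hi) : 0 ≤ clampVel V ξ w :=
  S.nonneg _ (clamp_mem ξ) w hw

theorem clampVel_eq_zero (S : LagSetup V κ r u lo hi L K₀ Z C₁ C₂) {ξ : ℝ} (h : 1 ≤ ξ) {w : ℝ}
    (hw : w ∈ Icc lo hi) : clampVel V ξ w = 0 := by
  rw [clampVel, min_eq_right h, max_eq_right zero_le_one]
  exact S.one_eq_zero w hw

theorem clampVel_sub_le (S : LagSetup V κ r u lo hi L K₀ Z C₁ C₂) (ξ ξ' : ℝ) {w w' : ℝ}
    (hw : w ∈ Icc lo hi) (hw' : w' ∈ Icc lo hi) :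
    |clampVel V ξ' w' - clampVel V ξ w| ≤ C₁ * |ξ' - ξ| + C₂ * |w' - w| := by
  obtain ⟨ζ, hζ, ν, hν, h⟩ := S.exists_mvt (clamp_mem ξ) (clamp_mem ξ') hw hw'
  rw [clampVel, clampVel, h]
  refine (abs_add_le _ _).trans ?_
  rw [abs_mul, abs_mul]
  have h1 : |max 0 (min ξ' 1) - max 0 (min ξ 1)| ≤ |ξ' - ξ| := by
    refine (abs_max_sub_max_le_max _ _ _ _).trans ?_
    rw [sub_self, abs_zero, max_eq_right (abs_nonneg _)]
    refine (abs_min_sub_min_le_max _ _ _ _).trans ?_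
    rw [sub_self, abs_zero, max_eq_left (abs_nonneg _)]
  gcongr
  · exact S.C₁_nonneg
  · exact S.d1_le _ hζ _ hν
  · exact S.d2_le _ hζ _ hν

/-- Since `V` vanishes at density `1`, its size is its variation over a density interval of length
at most `1`. Thus `C₁` bounds the speed as well as the derivative. -/
theorem clampVel_le (S : LagSetup V κ r u lo hi L K₀ Z C₁ C₂) (ξ : ℝ) {w : ℝ}
    (hw : w ∈ Icc lo hi) : clampVel V ξ w ≤ C₁ := by
  have h1 := S.clampVel_sub_le 1 (max 0 (min ξ 1)) hw hw
  rw [S.clampVel_eq_zero le_rfl hw, clampVel_eq (clamp_mem ξ)] at h1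
  have h2 : |max 0 (min ξ 1) - 1| ≤ 1 := by
    have := clamp_mem ξ
    rw [abs_le]; constructor <;> linarith [this.1, this.2]
  have h3 := mul_le_mul_of_nonneg_left h2 S.C₁_nonneg
  simp only [sub_self, abs_zero, mul_zero, add_zero, sub_zero] at h1
  rw [clampVel]
  linarith [le_abs_self (V (max 0 (min ξ 1)) w)]

end LagSetup

/-! ### Existence of the Lagrangian flow -/

namespace LagSetup

variable {V : ℝ → ℝ → ℝ} {κ r u : ℝ → ℝ} {lo hi : ℝ} {L K₀ : NNReal} {Z C₁ C₂ : ℝ}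

theorem integrable_kernel_mul (S : LagSetup V κ r u lo hi L K₀ Z C₁ C₂) {f : ℝ → ℝ}
    (hf : Measurable f) : Integrable fun b => κ (f b) * r b := by
  refine (S.r_int.const_mul (κ 0)).mono' ?_ (ae_of_all _ fun b => ?_)
  · exact ((S.κ_lip.continuous.measurable.comp hf).mul S.r_meas).aestronglyMeasurable
  · rw [Real.norm_eq_abs, abs_of_nonneg (mul_nonneg (S.κ_nonneg _) (S.r_mem b).1)]
    exact mul_le_mul_of_nonneg_right (S.κ_le _) (S.r_mem b).1

theorem integrable_kernel_sub (S : LagSetup V κ r u lo hi L K₀ Z C₁ C₂) {f : ℝ → ℝ}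
    (hf : Measurable f) (x : ℝ) : Integrable fun b => κ (x - f b) * r b :=
  S.integrable_kernel_mul (measurable_const.sub hf)

theorem lagMean_nonneg (S : LagSetup V κ r u lo hi L K₀ Z C₁ C₂) (X : ℝ → ℝ) (a : ℝ) :
    0 ≤ lagMean κ r X a :=
  integral_nonneg fun b => mul_nonneg (S.κ_nonneg _) (S.r_mem b).1

theorem abs_setIntegral_kernel_sub_le (S : LagSetup V κ r u lo hi L K₀ Z C₁ C₂) {f g : ℝ → ℝ}
    (hf : Measurable f) (hg : Measurable g) {δ : ℝ} (h : ∀ b, |f b - g b| ≤ δ) (s : Set ℝ) :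
    |(∫ b in s, κ (f b) * r b) - ∫ b in s, κ (g b) * r b| ≤ L * δ * ∫ x, r x := by
  have hδ : 0 ≤ δ := (abs_nonneg _).trans (h 0)
  rw [← integral_sub (S.integrable_kernel_mul hf).integrableOn
    (S.integrable_kernel_mul hg).integrableOn]
  refine (abs_integral_le_integral_abs).trans ?_
  calc ∫ b in s, |κ (f b) * r b - κ (g b) * r b| ≤ ∫ b in s, L * δ * r b := by
        refine integral_mono ((S.integrable_kernel_mul hf).sub
          (S.integrable_kernel_mul hg)).abs.integrableOn (S.r_int.const_mul _).integrableOn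
          fun b => ?_
        simp only [← sub_mul, abs_mul, abs_of_nonneg (S.r_mem b).1]
        refine mul_le_mul_of_nonneg_right ?_ (S.r_mem b).1
        exact (S.abs_κ_sub _ _).trans (mul_le_mul_of_nonneg_left (h b) L.coe_nonneg)
    _ ≤ ∫ b, L * δ * r b := setIntegral_le_integral (S.r_int.const_mul _)
        (ae_of_all _ fun b => mul_nonneg (mul_nonneg L.coe_nonneg hδ) (S.r_mem b).1)
    _ = _ := integral_const_mul _ _

theorem abs_lagMean_sub_le (S : LagSetup V κ r u lo hi L K₀ Z C₁ C₂) {X X' : ℝ → ℝ}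
    (hX : Measurable X) (hX' : Measurable X') {δ : ℝ} (h : ∀ b, |X b - X' b| ≤ δ) (a : ℝ) :
    |lagMean κ r X a - lagMean κ r X' a| ≤ L * (2 * δ) * ∫ x, r x := by
  refine S.abs_setIntegral_kernel_sub_le (measurable_const.sub hX) (measurable_const.sub hX')
    (fun b => ?_) _
  have : X a - X b - (X' a - X' b) = (X a - X' a) - (X b - X' b) := by ring
  change |X a - X b - (X' a - X' b)| ≤ _
  rw [this]
  linarith [abs_sub (X a - X' a) (X b - X' b), h a, h b]

theorem continuous_lagMean (S : LagSetup V κ r u lo hi L K₀ Z C₁ C₂) {X : ℝ → ℝ}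
    (hX : Continuous X) : Continuous (lagMean κ r X) := by
  rw [continuous_iff_continuousAt]
  intro a₀
  have heq : lagMean κ r X = fun a => ∫ b, (Ioi a).indicator (fun b => κ (X a - X b) * r b) b := by
    funext a; rw [lagMean, integral_indicator measurableSet_Ioi]
  rw [heq]
  refine continuousAt_of_dominated (bound := fun b => κ 0 * r b) ?_ ?_ (S.r_int.const_mul _) ?_
  · refine Eventually.of_forall fun a => ?_
    exact ((S.integrable_kernel_mul (measurable_const.sub hX.measurable)).indicator
      measurableSet_Ioi).aestronglyMeasurable
  · refine Eventually.of_forall fun a => ae_of_all _ fun b => ?_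
    have h0 : 0 ≤ κ (X a - X b) * r b := mul_nonneg (S.κ_nonneg _) (S.r_mem b).1
    refine (norm_indicator_le_norm_self _ _).trans ?_
    rw [Real.norm_eq_abs, abs_of_nonneg h0]
    exact mul_le_mul_of_nonneg_right (S.κ_le _) (S.r_mem b).1
  -- The domain of integration moves with `a`, but for fixed `b ≠ a₀` the indicator of `b ∈ Ioi a`
  -- is constant for `a` near `a₀`.
  · filter_upwards [compl_mem_ae_iff.2 (measure_singleton a₀)] with b hb
    have hb' : b ≠ a₀ := hb
    have hc : ContinuousAt (fun a => κ (X a - X b) * r b) a₀ :=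
      ((S.κ_lip.continuous.comp (hX.sub continuous_const)).mul continuous_const).continuousAt
    rcases lt_or_gt_of_ne hb' with h | h
    · refine (continuousAt_const (y := (0 : ℝ))).congr ?_
      filter_upwards [lt_mem_nhds h] with a ha
      exact (indicator_of_notMem (s := Ioi a) (f := fun b => κ (X a - X b) * r b) (not_lt.2 ha.le)).symm
    · refine hc.congr ?_
      filter_upwards [gt_mem_nhds h] with a ha
      exact (indicator_of_mem (s := Ioi a) (show b ∈ Ioi a from ha) (fun b => κ (X a - X b) * r b)).symm

theorem continuous_clampVel (S : LagSetup V κ r u lo hi L K₀ Z C₁ C₂) {ξ w : ℝ → ℝ}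
    (hξ : Continuous ξ) (hw : Continuous w) : Continuous fun a => clampVel V (ξ a) (w a) := by
  have : Continuous (Function.uncurry V) := S.contDiff.continuous
  exact this.comp ((continuous_const.max (hξ.min continuous_const)).prodMk hw)

/-- The right-hand side of the Lagrangian equation, on displacements. -/
def lagField (S : LagSetup V κ r u lo hi L K₀ Z C₁ C₂) (Y : BoundedContinuousFunction ℝ ℝ) :
    BoundedContinuousFunction ℝ ℝ :=
  BoundedContinuousFunction.ofNormedAddCommGroup
    (fun a => clampVel V (lagMean κ r (fun b => b + Y b) a) (u a))
    (S.continuous_clampVel (S.continuous_lagMean (continuous_id.add Y.continuous))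
      S.u_lip.continuous) C₁
    (fun a => by
      rw [Real.norm_eq_abs, abs_of_nonneg (S.clampVel_nonneg _ (S.u_mem a))]
      exact S.clampVel_le _ (S.u_mem a))

/-- The set of labels over which one averages does not depend on the configuration; only the
argument of the Lipschitz kernel does. The factor `2` counts the displacements of both `a` and `b`.
-/
theorem lagField_lipschitz (S : LagSetup V κ r u lo hi L K₀ Z C₁ C₂) :
    LipschitzWith (Real.toNNReal (C₁ * (L * 2 * ∫ x, r x))) S.lagField := by
  have h0 : 0 ≤ C₁ * (L * 2 * ∫ x, r x) :=
    mul_nonneg S.C₁_nonneg (mul_nonneg (mul_nonneg L.coe_nonneg zero_le_two) S.mass_nonneg)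
  refine LipschitzWith.of_dist_le_mul fun Y Y' => ?_
  rw [Real.coe_toNNReal _ h0, BoundedContinuousFunction.dist_le (mul_nonneg h0 dist_nonneg)]
  intro a
  rw [Real.dist_eq]
  refine (S.clampVel_sub_le _ _ (S.u_mem a) (S.u_mem a)).trans ?_
  rw [sub_self, abs_zero, mul_zero, add_zero, mul_assoc]
  refine mul_le_mul_of_nonneg_left ?_ S.C₁_nonneg
  refine (S.abs_lagMean_sub_le (δ := dist Y Y') (measurable_id.add Y.continuous.measurable)
    (measurable_id.add Y'.continuous.measurable) (fun b => ?_) a).trans (le_of_eq (by ring))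
  have : b + Y b - (b + Y' b) = Y b - Y' b := by ring
  change |b + Y b - (b + Y' b)| ≤ _
  rw [this, ← Real.dist_eq]
  exact BoundedContinuousFunction.dist_coe_le_dist b

/-- The unknown of the differential equation is the displacement `X t a - a`, which is a bounded
function of `a`, unlike `X t` itself. -/
theorem exists_lagFlow (S : LagSetup V κ r u lo hi L K₀ Z C₁ C₂) :
    ∃ X : ℝ → ℝ → ℝ, (∀ a, X 0 a = a) ∧ (∀ t, Continuous (X t)) ∧
      ∀ t a, HasDerivAt (fun s => X s a) (clampVel V (lagMean κ r (X t) a) (u a)) t := by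
  obtain ⟨Y, hY0, hY⟩ := exists_global_integralCurve S.lagField _ (Real.toNNReal C₁)
    S.lagField_lipschitz (fun Y => by
      rw [Real.coe_toNNReal _ S.C₁_nonneg]
      exact BoundedContinuousFunction.norm_ofNormedAddCommGroup_le _ S.C₁_nonneg _) 0
  refine ⟨fun t a => a + Y t a, fun a => by simp [hY0], fun t => continuous_id.add (Y t).continuous,
    fun t a => ?_⟩
  have h1 := ((BoundedContinuousFunction.evalCLM ℝ a).hasFDerivAt.comp_hasDerivAt t (hY t)).const_add a
  exact h1

end LagSetup

/-! ### The averaged density stays below one, and particles stay ordered -/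

/-- Solutions of the Lagrangian equation. -/
structure IsLagFlow (V : ℝ → ℝ → ℝ) (κ r u : ℝ → ℝ) (X : ℝ → ℝ → ℝ) : Prop where
  zero : ∀ a, X 0 a = a
  cont : ∀ t, Continuous (X t)
  hasDerivAt : ∀ t a, HasDerivAt (fun s => X s a) (clampVel V (lagMean κ r (X t) a) (u a)) t

namespace LagSetup

variable {V : ℝ → ℝ → ℝ} {κ r u : ℝ → ℝ} {lo hi : ℝ} {L K₀ : NNReal} {Z C₁ C₂ : ℝ}
  {X : ℝ → ℝ → ℝ}

theorem flow_mono (S : LagSetup V κ r u lo hi L K₀ Z C₁ C₂) (hX : IsLagFlow V κ r u X) (a : ℝ) :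
    Monotone fun t => X t a :=
  monotone_of_deriv_nonneg (fun t => (hX.hasDerivAt t a).differentiableAt) fun t => by
    rw [(hX.hasDerivAt t a).deriv]; exact S.clampVel_nonneg _ (S.u_mem a)

theorem flow_lip_time (S : LagSetup V κ r u lo hi L K₀ Z C₁ C₂) (hX : IsLagFlow V κ r u X)
    (s t a : ℝ) : |X t a - X s a| ≤ C₁ * |t - s| := by
  have := convex_univ.norm_image_sub_le_of_norm_hasDerivWithin_le (f := fun t => X t a) (C := C₁)
    (fun t _ => (hX.hasDerivAt t a).hasDerivWithinAt) (fun t _ => by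
      rw [Real.norm_eq_abs, abs_of_nonneg (S.clampVel_nonneg _ (S.u_mem a))]
      exact S.clampVel_le _ (S.u_mem a)) (mem_univ s) (mem_univ t)
  simpa [Real.norm_eq_abs] using this

theorem lagMean_lip_time (S : LagSetup V κ r u lo hi L K₀ Z C₁ C₂) (hX : IsLagFlow V κ r u X)
    (s t a : ℝ) :
    |lagMean κ r (X t) a - lagMean κ r (X s) a| ≤ (L * (2 * C₁) * ∫ x, r x) * |t - s| :=
  (S.abs_lagMean_sub_le (hX.cont t).measurable (hX.cont s).measurable
    (fun b => S.flow_lip_time hX s t b) a).trans (le_of_eq (by ring))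

theorem continuous_lagMean_time (S : LagSetup V κ r u lo hi L K₀ Z C₁ C₂)
    (hX : IsLagFlow V κ r u X) (a : ℝ) : Continuous fun t => lagMean κ r (X t) a := by
  have h0 : 0 ≤ L * (2 * C₁) * ∫ x, r x :=
    mul_nonneg (mul_nonneg L.coe_nonneg (mul_nonneg zero_le_two S.C₁_nonneg)) S.mass_nonneg
  refine (LipschitzWith.of_dist_le_mul (K := ⟨_, h0⟩) fun t s => ?_).continuous
  exact S.lagMean_lip_time hX s t a

/-- The averaged density never exceeds `1`: where it is at least `1` the velocity vanishes, while
the vehicles ahead do not move backwards. -/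
theorem lagMean_le_one (S : LagSetup V κ r u lo hi L K₀ Z C₁ C₂) (hX : IsLagFlow V κ r u X)
    {t : ℝ} (ht : 0 ≤ t) (a : ℝ) : lagMean κ r (X t) a ≤ 1 := by
  by_contra! hcon
  have hcomp : IsCompact (Icc 0 t ∩ {s | lagMean κ r (X s) a ≤ 1}) :=
    isCompact_Icc.inter_right (isClosed_le (S.continuous_lagMean_time hX a) continuous_const)
  have hne : (Icc 0 t ∩ {s | lagMean κ r (X s) a ≤ 1}).Nonempty := by
    refine ⟨0, ⟨le_rfl, ht⟩, ?_⟩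
    have : X 0 = id := funext hX.zero
    simpa [this] using S.mass a
  -- Here `s` is the last time in `[0, t]` with mean at most `1`; between `s` and `t` the velocity
  -- of the particle `a` is therefore zero.
  obtain ⟨s, ⟨hs, hs1⟩, hmax⟩ := hcomp.exists_isGreatest hne
  have hgt : ∀ s' ∈ Ioo s t, 1 ≤ lagMean κ r (X s') a := by
    intro s' hs'
    by_contra! h
    exact absurd (hmax ⟨⟨hs.1.trans hs'.1.le, hs'.2.le⟩, h.le⟩) (not_le.2 hs'.1)
  have hrest : X t a ≤ X s a := by
    refine antitoneOn_of_deriv_nonpos (convex_Icc s t) (f := fun t => X t a) ?_ ?_ ?_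
      (left_mem_Icc.2 hs.2) (right_mem_Icc.2 hs.2) hs.2
    · exact fun t _ => (hX.hasDerivAt t a).continuousAt.continuousWithinAt
    · exact fun t _ => (hX.hasDerivAt t a).differentiableAt.differentiableWithinAt
    · intro s' hs'
      rw [interior_Icc] at hs'
      rw [(hX.hasDerivAt s' a).deriv, S.clampVel_eq_zero (hgt s' hs') (S.u_mem a)]
  have : lagMean κ r (X t) a ≤ lagMean κ r (X s) a := by
    refine integral_mono
      (S.integrable_kernel_sub (hX.cont t).measurable _).integrableOn
      (S.integrable_kernel_sub (hX.cont s).measurable _).integrableOn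
      fun b => mul_le_mul_of_nonneg_right (S.κ_mono ?_) (S.r_mem b).1
    exact sub_le_sub hrest (S.flow_mono hX b hs.2)
  exact absurd (this.trans hs1) (not_le.2 hcon)

theorem lagMean_mem (S : LagSetup V κ r u lo hi L K₀ Z C₁ C₂) (hX : IsLagFlow V κ r u X)
    {t : ℝ} (ht : 0 ≤ t) (a : ℝ) : lagMean κ r (X t) a ∈ Icc (0 : ℝ) 1 :=
  ⟨S.lagMean_nonneg _ a, S.lagMean_le_one hX ht a⟩

theorem flow_hasDerivAt (S : LagSetup V κ r u lo hi L K₀ Z C₁ C₂) (hX : IsLagFlow V κ r u X)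
    {t : ℝ} (ht : 0 ≤ t) (a : ℝ) :
    HasDerivAt (fun s => X s a) (V (lagMean κ r (X t) a) (u a)) t := by
  simpa [clampVel_eq (S.lagMean_mem hX ht a)] using hX.hasDerivAt t a

theorem setIntegral_r_le (S : LagSetup V κ r u lo hi L K₀ Z C₁ C₂) {a b : ℝ} (hab : a ≤ b) :
    ∫ c in Ioc a b, r c ≤ b - a := by
  calc ∫ c in Ioc a b, r c ≤ ∫ c in Ioc a b, (1 : ℝ) :=
        setIntegral_mono S.r_int.integrableOn (by simp) fun c => (S.r_mem c).2
    _ = b - a := by simp [hab]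

/-- Passing from `a` to `b` drops the labels in `Ioc a b`, which contribute at most `κ 0 * (b - a)`
since `r ≤ 1`. On the labels beyond `b` only the argument of the kernel is shifted. -/
theorem abs_lagMean_sub_le_label (S : LagSetup V κ r u lo hi L K₀ Z C₁ C₂) {f : ℝ → ℝ}
    (hf : Measurable f) {a b : ℝ} (hab : a ≤ b) :
    |lagMean κ r f b - lagMean κ r f a| ≤ L * |f b - f a| * (∫ x, r x) + κ 0 * (b - a) := by
  have hsplit : lagMean κ r f a
      = (∫ c in Ioc a b, κ (f a - f c) * r c) + ∫ c in Ioi b, κ (f a - f c) * r c := by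
    rw [lagMean, ← Ioc_union_Ioi_eq_Ioi hab, setIntegral_union (Ioc_disjoint_Ioi le_rfl)
      measurableSet_Ioi (S.integrable_kernel_sub hf _).integrableOn
      (S.integrable_kernel_sub hf _).integrableOn]
  have h1 := S.abs_setIntegral_kernel_sub_le (f := fun c => f b - f c) (g := fun c => f a - f c)
    (measurable_const.sub hf) (measurable_const.sub hf) (δ := |f b - f a|)
    (fun c => by rw [sub_sub_sub_cancel_right]) (Ioi b)
  have h2 : 0 ≤ ∫ c in Ioc a b, κ (f a - f c) * r c :=
    integral_nonneg fun c => mul_nonneg (S.κ_nonneg _) (S.r_mem c).1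
  have h3 : ∫ c in Ioc a b, κ (f a - f c) * r c ≤ κ 0 * (b - a) := by
    calc ∫ c in Ioc a b, κ (f a - f c) * r c ≤ ∫ c in Ioc a b, κ 0 * r c :=
          setIntegral_mono (S.integrable_kernel_sub hf _).integrableOn
            (S.r_int.const_mul _).integrableOn
            fun c => mul_le_mul_of_nonneg_right (S.κ_le _) (S.r_mem c).1
      _ = κ 0 * ∫ c in Ioc a b, r c := integral_const_mul _ _
      _ ≤ _ := mul_le_mul_of_nonneg_left (S.setIntegral_r_le hab) (S.κ_nonneg 0)
  rw [hsplit]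
  rw [abs_le] at h1 ⊢
  rw [lagMean]
  constructor <;> linarith [h1.1, h1.2, h2, h3]

/-- A Lipschitz constant of the Lagrangian flow with respect to the labels. -/
def flowLip (κ r : ℝ → ℝ) (L K₀ : NNReal) (C₁ C₂ t : ℝ) : ℝ :=
  gronwallBound 1 (C₁ * (L * ∫ x, r x)) (C₁ * κ 0 + C₂ * K₀) t

theorem flowLip_mono (S : LagSetup V κ r u lo hi L K₀ Z C₁ C₂) :
    Monotone (flowLip κ r L K₀ C₁ C₂) :=
  gronwallBound_mono zero_le_one
    (add_nonneg (mul_nonneg S.C₁_nonneg (S.κ_nonneg 0)) (mul_nonneg S.C₂_nonneg K₀.coe_nonneg))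
    (mul_nonneg S.C₁_nonneg (mul_nonneg L.coe_nonneg S.mass_nonneg))

/-- A crude Grönwall estimate, which uses neither the order of the particles nor the slope
condition. In the proof of order it serves to make the error terms quadratic in `b - a`. -/
theorem flow_lip_label (S : LagSetup V κ r u lo hi L K₀ Z C₁ C₂) (hX : IsLagFlow V κ r u X)
    {t : ℝ} (ht : 0 ≤ t) {a b : ℝ} (hab : a ≤ b) :
    |X t b - X t a| ≤ flowLip κ r L K₀ C₁ C₂ t * (b - a) := by
  have hd : ∀ s, HasDerivAt (fun s => X s b - X s a) (clampVel V (lagMean κ r (X s) b) (u b)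
      - clampVel V (lagMean κ r (X s) a) (u a)) s :=
    fun s => (hX.hasDerivAt s b).sub (hX.hasDerivAt s a)
  have := norm_le_gronwallBound_of_norm_deriv_right_le (f := fun s => X s b - X s a)
    (δ := 1 * (b - a)) (K := C₁ * (L * ∫ x, r x)) (ε := (C₁ * κ 0 + C₂ * K₀) * (b - a))
    (a := 0) (b := t) (fun s _ => (hd s).continuousAt.continuousWithinAt)
    (fun s _ => (hd s).hasDerivWithinAt) (by simp [hX.zero, abs_of_nonneg (sub_nonneg.2 hab)])
    (fun s _ => by
      rw [Real.norm_eq_abs, Real.norm_eq_abs]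
      refine (S.clampVel_sub_le _ _ (S.u_mem a) (S.u_mem b)).trans ?_
      have h1 := mul_le_mul_of_nonneg_left
        (S.abs_lagMean_sub_le_label (hX.cont s).measurable hab) S.C₁_nonneg
      have h2 : |u b - u a| ≤ K₀ * (b - a) := by
        have := S.u_lip.dist_le_mul b a
        rwa [Real.dist_eq, Real.dist_eq, abs_of_nonneg (sub_nonneg.2 hab)] at this
      have h3 := mul_le_mul_of_nonneg_left h2 S.C₂_nonneg
      linarith) t (right_mem_Icc.2 ht)
  rw [Real.norm_eq_abs] at this
  refine this.trans (le_of_eq ?_)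
  simp only [flowLip, gronwallBound, sub_zero]
  split_ifs <;> ring

/-- Monotonicity makes the Lipschitz bound one-sided. In the velocity estimate below, a pair that
has exchanged its order therefore costs nothing. -/
theorem κ_le_add (S : LagSetup V κ r u lo hi L K₀ Z C₁ C₂) (x y : ℝ) :
    κ x ≤ κ y + L * max (x - y) 0 := by
  rcases le_total x y with h | h
  · have := S.κ_mono h
    have h2 : 0 ≤ (L : ℝ) * max (x - y) 0 := mul_nonneg L.coe_nonneg (le_max_right _ _)
    linarith
  · rw [max_eq_left (sub_nonneg.2 h)]
    have := S.abs_κ_sub x y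
    rw [abs_of_nonneg (sub_nonneg.2 h)] at this
    linarith [le_abs_self (κ x - κ y)]

/-- One-sided bound on velocity differences, up to a quadratic error. -/
theorem velocity_sub_ge (S : LagSetup V κ r u lo hi L K₀ Z C₁ C₂) (hX : IsLagFlow V κ r u X)
    {t : ℝ} (ht : 0 ≤ t) {a b G : ℝ} (hab : a ≤ b)
    (hG : ∀ c ∈ Ioc a b, |X t c - X t a| ≤ G * (b - a)) (hG0 : 0 ≤ G) :
    -(C₁ * (L * ∫ x, r x)) * max (X t b - X t a) 0 - C₁ * L * G * (b - a) ^ 2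
      ≤ V (lagMean κ r (X t) b) (u b) - V (lagMean κ r (X t) a) (u a) := by
  have hm := (hX.cont t).measurable
  set m := ∫ c in Ioc a b, r c with hmdef
  have hm0 : 0 ≤ m := integral_nonneg fun c => (S.r_mem c).1
  have hm1 : m ≤ b - a := S.setIntegral_r_le hab
  set P := max (X t b - X t a) 0 with hP
  have hP0 : 0 ≤ P := le_max_right _ _
  obtain ⟨ζ, hζ, ν, hν, hmv⟩ := S.exists_mvt (S.lagMean_mem hX ht a) (S.lagMean_mem hX ht b)
    (S.u_mem a) (S.u_mem b)
  have hsplit : lagMean κ r (X t) a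
      = (∫ c in Ioc a b, κ (X t a - X t c) * r c) + ∫ c in Ioi b, κ (X t a - X t c) * r c := by
    rw [lagMean, ← Ioc_union_Ioi_eq_Ioi hab, setIntegral_union (Ioc_disjoint_Ioi le_rfl)
      measurableSet_Ioi (S.integrable_kernel_sub hm _).integrableOn
      (S.integrable_kernel_sub hm _).integrableOn]
  have h1 : lagMean κ r (X t) b
      ≤ (∫ c in Ioi b, κ (X t a - X t c) * r c) + L * P * ∫ x, r x := by
    have e1 : lagMean κ r (X t) b ≤ ∫ c in Ioi b, (κ (X t a - X t c) * r c + L * P * r c) := by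
      refine integral_mono (S.integrable_kernel_sub hm _).integrableOn
        ((S.integrable_kernel_sub hm _).add
          (S.r_int.const_mul _)).integrableOn fun c => ?_
      have := S.κ_le_add (X t b - X t c) (X t a - X t c)
      rw [sub_sub_sub_cancel_right] at this
      simp only
      rw [← add_mul]
      exact mul_le_mul_of_nonneg_right this (S.r_mem c).1
    rw [integral_add (S.integrable_kernel_sub hm _).integrableOn
      (S.r_int.const_mul _).integrableOn, integral_const_mul] at e1
    have e2 : ∫ c in Ioi b, r c ≤ ∫ c, r c :=
      setIntegral_le_integral S.r_int (ae_of_all _ fun c => (S.r_mem c).1)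
    have e3 := mul_le_mul_of_nonneg_left e2 (mul_nonneg L.coe_nonneg hP0)
    exact e1.trans (by linarith)
  -- On the dropped labels the kernel equals `κ 0` up to the spread of the flow over `Ioc a b`. This
  -- gives the gain `κ 0 * m`, and the error of second order.
  have h2 : (κ 0 - L * (G * (b - a))) * m ≤ ∫ c in Ioc a b, κ (X t a - X t c) * r c := by
    rw [hmdef, ← integral_const_mul]
    refine setIntegral_mono_on (S.r_int.const_mul _).integrableOn
      (S.integrable_kernel_sub hm _).integrableOn measurableSet_Ioc
      fun c hc => mul_le_mul_of_nonneg_right ?_ (S.r_mem c).1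
    have := S.abs_κ_sub 0 (X t a - X t c)
    rw [zero_sub, neg_sub] at this
    have h3 := mul_le_mul_of_nonneg_left (hG c hc) L.coe_nonneg
    have h4 := le_abs_self (κ 0 - κ (X t a - X t c))
    linarith
  have hΞ : lagMean κ r (X t) b - lagMean κ r (X t) a
      ≤ L * P * (∫ x, r x) - κ 0 * m + L * (G * (b - a)) * m := by
    rw [hsplit]; linarith
  have hu : -(Z * m) ≤ u b - u a := by
    have := S.u_incr a b hab
    rw [intervalIntegral.integral_of_le hab] at this
    exact (abs_le.1 this).1
  have hd1 := S.d1_nonpos ζ hζ ν hν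
  have hd1' : -d1 V ζ ν ≤ C₁ := by rw [← abs_of_nonpos hd1]; exact S.d1_le ζ hζ ν hν
  have hd2 := S.d2_nonneg ζ hζ ν hν
  have hsl := S.slope ζ hζ ν hν
  have f1 := mul_le_mul_of_nonpos_left hΞ hd1
  have f2 := mul_le_mul_of_nonneg_left hu hd2
  have f3 : 0 ≤ (C₁ + d1 V ζ ν) * (L * P * ∫ x, r x) :=
    mul_nonneg (by linarith) (mul_nonneg (mul_nonneg L.coe_nonneg hP0) S.mass_nonneg)
  have hGm : G * (b - a) * m ≤ G * (b - a) ^ 2 := by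
    rw [pow_two, ← mul_assoc]
    exact mul_le_mul_of_nonneg_left hm1 (mul_nonneg hG0 (sub_nonneg.2 hab))
  have hGm0 : 0 ≤ G * (b - a) * m := mul_nonneg (mul_nonneg hG0 (sub_nonneg.2 hab)) hm0
  have f4 : 0 ≤ (C₁ + d1 V ζ ν) * (L * (G * (b - a) * m)) :=
    mul_nonneg (by linarith) (mul_nonneg L.coe_nonneg hGm0)
  have f5 := mul_le_mul_of_nonneg_left (mul_le_mul_of_nonneg_left hGm L.coe_nonneg) S.C₁_nonneg
  -- The terms of first order add up to `-(d1 V ζ ν * κ 0 + Z * d2 V ζ ν) * m`, which is nonnegative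
  -- by the slope condition.
  have f6 := mul_le_mul_of_nonneg_right hsl hm0
  rw [hmv]
  linarith

/-- Comparison with the barrier on the left. At a time of contact the gap is at most its exponential
part, so the one-sided velocity estimate applies; the `+ 1` in the coefficient makes the
differential inequality strict there when `a < b`. -/
theorem flow_sub_ge_quadratic (S : LagSetup V κ r u lo hi L K₀ Z C₁ C₂)
    (hX : IsLagFlow V κ r u X) {t : ℝ} (ht : 0 ≤ t) {a b : ℝ} (hab : a ≤ b) :
    Real.exp (-(C₁ * (L * ∫ x, r x)) * t) * (b - a)
      - (C₁ * L * flowLip κ r L K₀ C₁ C₂ t + 1) * t * (b - a) ^ 2 ≤ X t b - X t a := by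
  rcases hab.eq_or_lt with rfl | hlt
  · simp
  set c := C₁ * (L * ∫ x, r x) with hc
  set G := flowLip κ r L K₀ C₁ C₂ t with hG
  have hc0 : 0 ≤ c := mul_nonneg S.C₁_nonneg (mul_nonneg L.coe_nonneg S.mass_nonneg)
  have hG0 : 0 ≤ G := by
    have := S.flow_lip_label hX ht (zero_le_one (α := ℝ))
    linarith [abs_nonneg (X t 1 - X t 0)]
  have hd : ∀ s ∈ Ico 0 t, HasDerivWithinAt (fun s => -(X s b - X s a))
      (-(V (lagMean κ r (X s) b) (u b) - V (lagMean κ r (X s) a) (u a))) (Ici s) s :=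
    fun s hs => ((S.flow_hasDerivAt hX hs.1 b).sub
      (S.flow_hasDerivAt hX hs.1 a)).neg.hasDerivWithinAt
  have hcont : ContinuousOn (fun s => -(X s b - X s a)) (Icc 0 t) := fun s hs =>
    ((S.flow_hasDerivAt hX hs.1 b).sub
      (S.flow_hasDerivAt hX hs.1 a)).neg.continuousAt.continuousWithinAt
  have hQ : ∀ s, HasDerivAt (fun s => -(Real.exp (-c * s) * (b - a))
      + (C₁ * L * G + 1) * (b - a) ^ 2 * s)
      (-(Real.exp (-c * s) * (-c) * (b - a)) + (C₁ * L * G + 1) * (b - a) ^ 2) s := by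
    intro s
    have e1 : HasDerivAt (fun s => -c * s) (-c) s := by
      simpa using (hasDerivAt_id s).const_mul (-c)
    have e2 := (hasDerivAt_id s).const_mul ((C₁ * L * G + 1) * (b - a) ^ 2)
    rw [mul_one] at e2
    exact ((e1.exp.mul_const (b - a)).neg).add e2
  have key := image_le_of_deriv_right_lt_deriv_boundary hcont hd
    (B := fun s => -(Real.exp (-c * s) * (b - a)) + (C₁ * L * G + 1) * (b - a) ^ 2 * s)
    (by simp [hX.zero]) hQ ?_ (right_mem_Icc.2 ht)
  · linarith
  · intro s hs heq
    have hlip : ∀ x ∈ Ioc a b, |X s x - X s a| ≤ G * (b - a) := by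
      intro x hx
      refine (S.flow_lip_label hX hs.1 hx.1.le).trans ?_
      refine mul_le_mul (S.flowLip_mono hs.2.le) (by linarith [hx.2]) (by linarith [hx.1]) hG0
    have h1 := S.velocity_sub_ge hX hs.1 hab hlip hG0
    rw [← hc] at h1
    have hpos : 0 < (b - a) ^ 2 := pow_pos (sub_pos.2 hlt) 2
    have hcoef : 0 ≤ (C₁ * L * G + 1) * (b - a) ^ 2 * s :=
      mul_nonneg (mul_nonneg (add_nonneg (mul_nonneg (mul_nonneg S.C₁_nonneg L.coe_nonneg) hG0) zero_le_one)
        hpos.le) hs.1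
    have hmax : max (X s b - X s a) 0 ≤ Real.exp (-c * s) * (b - a) := by
      refine max_le (by linarith) (mul_nonneg (Real.exp_pos _).le (sub_nonneg.2 hab))
    have h2 := mul_le_mul_of_nonneg_left hmax hc0
    linarith

/-- Vehicles stay ordered, with a quantitative lower bound on their distance. -/
theorem flow_sub_ge (S : LagSetup V κ r u lo hi L K₀ Z C₁ C₂)
    (hX : IsLagFlow V κ r u X) {t : ℝ} (ht : 0 ≤ t) {a b : ℝ} (hab : a ≤ b) :
    Real.exp (-(C₁ * (L * ∫ x, r x)) * t) * (b - a) ≤ X t b - X t a := by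
  set e := Real.exp (-(C₁ * (L * ∫ x, r x)) * t)
  set Q := (C₁ * L * flowLip κ r L K₀ C₁ C₂ t + 1) * t
  -- Cutting `[a, b]` into `n + 1` equal pieces leaves the sum of the linear terms unchanged and
  -- divides the quadratic error by `n + 1`.
  have hn : ∀ n : ℕ, e * (b - a) - Q * (b - a) ^ 2 * (1 / ((n : ℝ) + 1)) ≤ X t b - X t a := by
    intro n
    have hn0 : (0 : ℝ) < n + 1 := by positivity
    set p : ℕ → ℝ := fun k => a + k * ((b - a) / (n + 1)) with hp
    have hstep : ∀ k, p (k + 1) - p k = (b - a) / (n + 1) := by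
      intro k; simp only [hp]; push_cast; ring
    have hsum := Finset.sum_range_sub (fun k => X t (p k)) (n + 1)
    have hp0 : p 0 = a := by simp [hp]
    have hp1 : p (n + 1) = b := by simp only [hp]; push_cast; field_simp; ring
    simp only [hp0, hp1] at hsum
    rw [← hsum]
    have hle : ∀ k ∈ Finset.range (n + 1),
        e * ((b - a) / (n + 1)) - Q * ((b - a) / (n + 1)) ^ 2 ≤ X t (p (k + 1)) - X t (p k) := by
      intro k _
      have := S.flow_sub_ge_quadratic hX ht (a := p k) (b := p (k + 1)) (by
        have := hstep k
        have h2 : 0 ≤ (b - a) / (n + 1) := div_nonneg (sub_nonneg.2 hab) hn0.le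
        linarith)
      rwa [hstep k] at this
    refine le_trans (le_of_eq ?_) (Finset.sum_le_sum hle)
    rw [Finset.sum_const, Finset.card_range, nsmul_eq_mul]
    push_cast
    field_simp
  have hlim : Tendsto (fun n : ℕ => e * (b - a) - Q * (b - a) ^ 2 * (1 / ((n : ℝ) + 1))) atTop
      (𝓝 (e * (b - a) - Q * (b - a) ^ 2 * 0)) :=
    tendsto_const_nhds.sub (tendsto_one_div_add_atTop_nhds_zero_nat.const_mul _)
  rw [mul_zero, sub_zero] at hlim
  exact le_of_tendsto' hlim hn

end LagSetup

/-! ### Labels as functions of positions, and the Eulerian density -/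

theorem LipschitzWith.volume_image_eq_zero {K : NNReal} {f : ℝ → ℝ} (hf : LipschitzWith K f)
    {N : Set ℝ} (hN : volume N = 0) : volume (f '' N) = 0 := by
  rw [← hausdorffMeasure_real] at hN ⊢
  have := hf.hausdorffMeasure_image_le (zero_le_one (α := ℝ)) N
  rw [hN, mul_zero] at this
  exact le_antisymm this (zero_le)

/-- The flow, frozen at its initial position for negative times. -/
def posFlow (X : ℝ → ℝ → ℝ) (t a : ℝ) : ℝ := X (max t 0) a

/-- The label of the particle that is in `x` at time `t`. -/
def label (X : ℝ → ℝ → ℝ) (t : ℝ) : ℝ → ℝ := Function.invFun (posFlow X t)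

/-- The growth rate of the Lipschitz constant of the labels. -/
def rate (r : ℝ → ℝ) (L : NNReal) (C₁ : ℝ) : ℝ := C₁ * (L * ∫ x, r x)

/-- A Lipschitz constant of the labels with respect to the positions. -/
def labelLip (r : ℝ → ℝ) (L : NNReal) (C₁ t : ℝ) : ℝ := Real.exp (rate r L C₁ * max t 0)

/-- The Eulerian density transported by the flow. -/
def eulDensity (r : ℝ → ℝ) (X : ℝ → ℝ → ℝ) (t x : ℝ) : ℝ := r (label X t x) * deriv (label X t) x

theorem labelLip_pos (r : ℝ → ℝ) (L : NNReal) (C₁ t : ℝ) : 0 < labelLip r L C₁ t :=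
  Real.exp_pos _

namespace LagSetup

variable {V : ℝ → ℝ → ℝ} {κ r u : ℝ → ℝ} {lo hi : ℝ} {L K₀ : NNReal} {Z C₁ C₂ : ℝ}
  {X : ℝ → ℝ → ℝ}

theorem rate_nonneg (S : LagSetup V κ r u lo hi L K₀ Z C₁ C₂) : 0 ≤ rate r L C₁ :=
  mul_nonneg S.C₁_nonneg (mul_nonneg L.coe_nonneg S.mass_nonneg)

theorem labelLip_mono (S : LagSetup V κ r u lo hi L K₀ Z C₁ C₂) : Monotone (labelLip r L C₁) :=
  fun _ _ h => Real.exp_le_exp.2 (mul_le_mul_of_nonneg_left (max_le_max_right 0 h) S.rate_nonneg)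

theorem posFlow_of_nonpos (hX : IsLagFlow V κ r u X) {t : ℝ} (ht : t ≤ 0) (a : ℝ) :
    posFlow X t a = a := by rw [posFlow, max_eq_right ht, hX.zero]

theorem continuous_posFlow (hX : IsLagFlow V κ r u X) (t : ℝ) : Continuous (posFlow X t) :=
  hX.cont _

theorem posFlow_lip_time (S : LagSetup V κ r u lo hi L K₀ Z C₁ C₂) (hX : IsLagFlow V κ r u X)
    (s t a : ℝ) : |posFlow X t a - posFlow X s a| ≤ C₁ * |t - s| := by
  refine (S.flow_lip_time hX _ _ a).trans (mul_le_mul_of_nonneg_left ?_ S.C₁_nonneg)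
  refine (abs_max_sub_max_le_max _ _ _ _).trans ?_
  rw [sub_self, abs_zero, max_eq_left (abs_nonneg _)]

theorem posFlow_sub_ge (S : LagSetup V κ r u lo hi L K₀ Z C₁ C₂)
    (hX : IsLagFlow V κ r u X) (t : ℝ) {a b : ℝ} (hab : a ≤ b) :
    b - a ≤ labelLip r L C₁ t * (posFlow X t b - posFlow X t a) := by
  have h := S.flow_sub_ge hX (le_max_right t 0) hab
  have h2 := mul_le_mul_of_nonneg_left h (labelLip_pos r L C₁ t).le
  rw [← mul_assoc] at h2
  have h3 : labelLip r L C₁ t * Real.exp (-(C₁ * (L * ∫ x, r x)) * max t 0) = 1 := by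
    rw [labelLip, rate, ← Real.exp_add]; simp
  rw [h3, one_mul] at h2
  exact h2

theorem strictMono_posFlow (S : LagSetup V κ r u lo hi L K₀ Z C₁ C₂)
    (hX : IsLagFlow V κ r u X) (t : ℝ) : StrictMono (posFlow X t) := by
  intro a b hab
  have := S.posFlow_sub_ge hX t hab.le
  have h2 : 0 < labelLip r L C₁ t * (posFlow X t b - posFlow X t a) :=
    (sub_pos.2 hab).trans_le this
  exact sub_pos.1 (pos_of_mul_pos_right h2 (labelLip_pos r L C₁ t).le)

theorem abs_posFlow_sub_le (S : LagSetup V κ r u lo hi L K₀ Z C₁ C₂)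
    (hX : IsLagFlow V κ r u X) (t a : ℝ) : |posFlow X t a - a| ≤ C₁ * |t| := by
  have := S.posFlow_lip_time hX 0 t a
  rwa [posFlow_of_nonpos hX le_rfl, sub_zero] at this

theorem surjective_posFlow (S : LagSetup V κ r u lo hi L K₀ Z C₁ C₂)
    (hX : IsLagFlow V κ r u X) (t : ℝ) : Function.Surjective (posFlow X t) := by
  refine (continuous_posFlow hX t).surjective ?_ ?_
  · refine tendsto_atTop_mono (f := fun a => a - C₁ * |t|) (fun a => ?_)
      (tendsto_atTop_add_const_right _ _ tendsto_id)
    linarith [(abs_le.1 (S.abs_posFlow_sub_le hX t a)).1]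
  · refine tendsto_atBot_mono (f := fun a => a + C₁ * |t|) (fun a => ?_)
      (tendsto_atBot_add_const_right _ _ tendsto_id)
    linarith [(abs_le.1 (S.abs_posFlow_sub_le hX t a)).2]

theorem label_posFlow (S : LagSetup V κ r u lo hi L K₀ Z C₁ C₂)
    (hX : IsLagFlow V κ r u X) (t a : ℝ) : label X t (posFlow X t a) = a :=
  Function.leftInverse_invFun (S.strictMono_posFlow hX t).injective a

theorem posFlow_label (S : LagSetup V κ r u lo hi L K₀ Z C₁ C₂)
    (hX : IsLagFlow V κ r u X) (t x : ℝ) : posFlow X t (label X t x) = x :=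
  Function.rightInverse_invFun (S.surjective_posFlow hX t) x

theorem label_of_nonpos (S : LagSetup V κ r u lo hi L K₀ Z C₁ C₂) (hX : IsLagFlow V κ r u X)
    {t : ℝ} (ht : t ≤ 0) (x : ℝ) : label X t x = x := by
  have := S.posFlow_label hX t x
  rwa [posFlow_of_nonpos hX ht] at this

theorem strictMono_label (S : LagSetup V κ r u lo hi L K₀ Z C₁ C₂)
    (hX : IsLagFlow V κ r u X) (t : ℝ) : StrictMono (label X t) := by
  intro x y hxy
  rw [← (S.strictMono_posFlow hX t).lt_iff_lt, S.posFlow_label hX, S.posFlow_label hX]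
  exact hxy

theorem label_lip (S : LagSetup V κ r u lo hi L K₀ Z C₁ C₂)
    (hX : IsLagFlow V κ r u X) (t x y : ℝ) :
    |label X t x - label X t y| ≤ labelLip r L C₁ t * |x - y| := by
  wlog h : y ≤ x generalizing x y
  · rw [abs_sub_comm, abs_sub_comm x]; exact this y x (le_of_not_ge h)
  rw [abs_of_nonneg (sub_nonneg.2 h),
    abs_of_nonneg (sub_nonneg.2 ((S.strictMono_label hX t).monotone h))]
  have := S.posFlow_sub_ge hX t ((S.strictMono_label hX t).monotone h)
  rwa [S.posFlow_label hX, S.posFlow_label hX] at this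

/-- The particle that is in `x` at time `s` is within `C₁ * |t - s|` of `x` at time `t`, and the
space estimate at time `t` converts this distance into labels. -/
theorem label_lip_time (S : LagSetup V κ r u lo hi L K₀ Z C₁ C₂)
    (hX : IsLagFlow V κ r u X) (s t x : ℝ) :
    |label X t x - label X s x| ≤ labelLip r L C₁ t * (C₁ * |t - s|) := by
  have h1 := S.label_lip hX t x (posFlow X t (label X s x))
  rw [S.label_posFlow hX] at h1
  refine h1.trans (mul_le_mul_of_nonneg_left ?_ (labelLip_pos r L C₁ t).le)
  have := S.posFlow_lip_time hX s t (label X s x)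
  rwa [S.posFlow_label hX, abs_sub_comm] at this

theorem label_lip_joint (S : LagSetup V κ r u lo hi L K₀ Z C₁ C₂)
    (hX : IsLagFlow V κ r u X) (s t x y : ℝ) :
    |label X t x - label X s y| ≤ labelLip r L C₁ t * (C₁ * |t - s| + |x - y|) := by
  have h1 := S.label_lip hX t x y
  have h2 := S.label_lip_time hX s t y
  have h3 := abs_sub_le (label X t x) (label X t y) (label X s y)
  rw [mul_add]; linarith

theorem lipschitz_label (S : LagSetup V κ r u lo hi L K₀ Z C₁ C₂)
    (hX : IsLagFlow V κ r u X) (t : ℝ) :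
    LipschitzWith ⟨labelLip r L C₁ t, (labelLip_pos r L C₁ t).le⟩ (label X t) :=
  LipschitzWith.of_dist_le_mul fun x y => S.label_lip hX t x y

theorem continuous_label (S : LagSetup V κ r u lo hi L K₀ Z C₁ C₂)
    (hX : IsLagFlow V κ r u X) : Continuous (Function.uncurry (label X)) := by
  rw [continuous_iff_continuousAt]
  rintro ⟨t, x⟩
  rw [ContinuousAt, tendsto_iff_dist_tendsto_zero]
  refine squeeze_zero (g := fun p : ℝ × ℝ => labelLip r L C₁ t * (C₁ * |t - p.1| + |x - p.2|))
    (fun _ => dist_nonneg) (fun p => ?_) ?_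
  · rw [dist_comm]; exact S.label_lip_joint hX p.1 t x p.2
  · have : Continuous fun p : ℝ × ℝ => labelLip r L C₁ t * (C₁ * |t - p.1| + |x - p.2|) := by
      fun_prop
    simpa using this.tendsto (t, x)

theorem posFlow_lip_label (S : LagSetup V κ r u lo hi L K₀ Z C₁ C₂)
    (hX : IsLagFlow V κ r u X) (t a b : ℝ) :
    |posFlow X t a - posFlow X t b| ≤ flowLip κ r L K₀ C₁ C₂ (max t 0) * |a - b| := by
  wlog h : b ≤ a generalizing a b
  · rw [abs_sub_comm, abs_sub_comm a]; exact this b a (le_of_not_ge h)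
  rw [abs_of_nonneg (sub_nonneg.2 h)]
  exact S.flow_lip_label hX (le_max_right t 0) h

theorem flowLip_nonneg (S : LagSetup V κ r u lo hi L K₀ Z C₁ C₂) {t : ℝ} (ht : 0 ≤ t) :
    0 ≤ flowLip κ r L K₀ C₁ C₂ t := by
  refine le_trans ?_ (S.flowLip_mono ht)
  rw [flowLip, gronwallBound_x0]; exact zero_le_one

theorem lipschitz_posFlow (S : LagSetup V κ r u lo hi L K₀ Z C₁ C₂)
    (hX : IsLagFlow V κ r u X) (t : ℝ) :
    LipschitzWith ⟨_, S.flowLip_nonneg (le_max_right t 0)⟩ (posFlow X t) :=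
  LipschitzWith.of_dist_le_mul fun a b => S.posFlow_lip_label hX t a b

theorem continuous_uncurry_posFlow (S : LagSetup V κ r u lo hi L K₀ Z C₁ C₂)
    (hX : IsLagFlow V κ r u X) : Continuous (Function.uncurry (posFlow X)) := by
  rw [continuous_iff_continuousAt]
  rintro ⟨t, x⟩
  rw [ContinuousAt, tendsto_iff_dist_tendsto_zero]
  refine squeeze_zero (g := fun p : ℝ × ℝ =>
    flowLip κ r L K₀ C₁ C₂ (max t 0) * |p.2 - x| + C₁ * |p.1 - t|)
    (fun _ => dist_nonneg) (fun p => ?_) ?_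
  · have h1 := S.posFlow_lip_label hX t p.2 x
    have h2 := S.posFlow_lip_time hX t p.1 p.2
    have h3 := abs_sub_le (posFlow X p.1 p.2) (posFlow X t p.2) (posFlow X t x)
    rw [Real.dist_eq]
    simp only [Function.uncurry]
    linarith
  · have : Continuous fun p : ℝ × ℝ =>
      flowLip κ r L K₀ C₁ C₂ (max t 0) * |p.2 - x| + C₁ * |p.1 - t| := by fun_prop
    simpa using this.tendsto (t, x)

theorem preimage_label (S : LagSetup V κ r u lo hi L K₀ Z C₁ C₂)
    (hX : IsLagFlow V κ r u X) (t : ℝ) (N : Set ℝ) : label X t ⁻¹' N = posFlow X t '' N := by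
  ext x
  constructor
  · intro hx; exact ⟨label X t x, hx, S.posFlow_label hX t x⟩
  · rintro ⟨a, ha, rfl⟩; simpa [S.label_posFlow hX] using ha

theorem preimage_posFlow (S : LagSetup V κ r u lo hi L K₀ Z C₁ C₂)
    (hX : IsLagFlow V κ r u X) (t : ℝ) (N : Set ℝ) : posFlow X t ⁻¹' N = label X t '' N := by
  ext x
  constructor
  · intro hx; exact ⟨posFlow X t x, hx, S.label_posFlow hX t x⟩
  · rintro ⟨a, ha, rfl⟩; simpa [S.posFlow_label hX] using ha

/-- The positions whose label is exceptional are the image of a null set under the Lipschitz flow.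
The next lemma is the mirror statement, with the Lipschitz labels. -/
theorem ae_label (S : LagSetup V κ r u lo hi L K₀ Z C₁ C₂)
    (hX : IsLagFlow V κ r u X) (t : ℝ) {p : ℝ → Prop} (h : ∀ᵐ a, p a) : ∀ᵐ x, p (label X t x) := by
  rw [ae_iff] at h ⊢
  have := LipschitzWith.volume_image_eq_zero (S.lipschitz_posFlow hX t) h
  rwa [← S.preimage_label hX] at this

theorem ae_posFlow (S : LagSetup V κ r u lo hi L K₀ Z C₁ C₂)
    (hX : IsLagFlow V κ r u X) (t : ℝ) {p : ℝ → Prop} (h : ∀ᵐ x, p x) :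
    ∀ᵐ a, p (posFlow X t a) := by
  rw [ae_iff] at h ⊢
  have := LipschitzWith.volume_image_eq_zero (S.lipschitz_label hX t) h
  rwa [← S.preimage_posFlow hX] at this

theorem deriv_label_mem (S : LagSetup V κ r u lo hi L K₀ Z C₁ C₂)
    (hX : IsLagFlow V κ r u X) (t x : ℝ) :
    deriv (label X t) x ∈ Icc 0 (labelLip r L C₁ t) := by
  refine ⟨(S.strictMono_label hX t).monotone.deriv_nonneg, ?_⟩
  exact (le_abs_self _).trans (norm_deriv_le_of_lipschitz (S.lipschitz_label hX t))

/-- This is the exponential bound of the theorem: `r ≤ 1`, and the space derivative of the label is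
at most its Lipschitz constant. -/
theorem eulDensity_mem (S : LagSetup V κ r u lo hi L K₀ Z C₁ C₂)
    (hX : IsLagFlow V κ r u X) (t x : ℝ) : eulDensity r X t x ∈ Icc 0 (labelLip r L C₁ t) := by
  have h1 := S.r_mem (label X t x)
  have h2 := S.deriv_label_mem hX t x
  exact ⟨mul_nonneg h1.1 h2.1, (mul_le_of_le_one_left h2.1 h1.2).trans h2.2⟩

theorem measurable_eulDensity (S : LagSetup V κ r u lo hi L K₀ Z C₁ C₂)
    (hX : IsLagFlow V κ r u X) : Measurable (Function.uncurry (eulDensity r X)) :=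
  (S.r_meas.comp (S.continuous_label hX).measurable).mul
    (measurable_deriv_with_param (S.continuous_label hX))

theorem ae_differentiableAt_label (S : LagSetup V κ r u lo hi L K₀ Z C₁ C₂)
    (hX : IsLagFlow V κ r u X) (t : ℝ) : ∀ᵐ x, DifferentiableAt ℝ (label X t) x :=
  (S.lipschitz_label hX t).ae_differentiableAt_real

/-- Change of variables from labels to positions. -/
theorem integral_mul_eulDensity (S : LagSetup V κ r u lo hi L K₀ Z C₁ C₂)
    (hX : IsLagFlow V κ r u X) (t : ℝ) (g : ℝ → ℝ) :
    ∫ x, g x * eulDensity r X t x = ∫ a, g (posFlow X t a) * r a := by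
  -- The change of variables takes place on the differentiability points of the label. They have
  -- full measure by Rademacher's theorem, and so does their image, since the flow pulls null sets
  -- back to null sets.
  set s : Set ℝ := {x | DifferentiableAt ℝ (label X t) x}
  have hs : MeasurableSet s := measurableSet_of_differentiableAt ℝ (label X t)
  have hae : ∀ᵐ x, x ∈ s := S.ae_differentiableAt_label hX t
  have hae' : ∀ᵐ a, a ∈ label X t '' s := by
    filter_upwards [S.ae_posFlow hX t hae] with a ha
    exact ⟨_, ha, S.label_posFlow hX t a⟩
  have key := integral_image_eq_integral_abs_deriv_smul hs
    (fun x hx => (DifferentiableAt.hasDerivAt hx).hasDerivWithinAt)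
    (S.strictMono_label hX t).injective.injOn (fun a => g (posFlow X t a) * r a)
  rw [Measure.restrict_eq_self_of_ae_mem hae, Measure.restrict_eq_self_of_ae_mem hae'] at key
  rw [key]
  refine integral_congr_ae (ae_of_all _ fun x => ?_)
  simp only [S.posFlow_label hX, smul_eq_mul, abs_of_nonneg (S.deriv_label_mem hX t x).1,
    eulDensity]
  ring

/-- As the flow preserves the order, the positions ahead of `x` are those of the labels ahead of the
label of `x`. Only nonpositive arguments of the kernel occur, where `η` and `κ` agree. -/
theorem conv_eulDensity (S : LagSetup V κ r u lo hi L K₀ Z C₁ C₂)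
    (hX : IsLagFlow V κ r u X) {η : ℝ → ℝ} (hη : ∀ x ≤ 0, η x = κ x) (t x : ℝ) :
    conv η (eulDensity r X) t x = lagMean κ r (posFlow X t) (label X t x) := by
  rw [conv, ← integral_indicator measurableSet_Ioi, lagMean, ← integral_indicator measurableSet_Ioi]
  have h1 : (Ioi x).indicator (fun y => eulDensity r X t y * η (x - y))
      = fun y => (Ioi x).indicator (fun y => η (x - y)) y * eulDensity r X t y := by
    funext y
    by_cases hy : y ∈ Ioi x
    · rw [indicator_of_mem hy, indicator_of_mem hy, mul_comm]
    · rw [indicator_of_notMem hy, indicator_of_notMem hy, zero_mul]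
  rw [h1, S.integral_mul_eulDensity hX]
  refine integral_congr_ae (ae_of_all _ fun b => ?_)
  have hiff : posFlow X t b ∈ Ioi x ↔ b ∈ Ioi (label X t x) := by
    rw [mem_Ioi, mem_Ioi, ← (S.strictMono_posFlow hX t).lt_iff_lt (a := label X t x),
      S.posFlow_label hX]
  simp only
  by_cases hb : b ∈ Ioi (label X t x)
  · rw [indicator_of_mem hb, indicator_of_mem (hiff.2 hb), S.posFlow_label hX,
      hη _ (sub_nonpos.2 (le_of_lt (hiff.2 hb)))]
  · rw [indicator_of_notMem hb, indicator_of_notMem (fun h => hb (hiff.1 h)), zero_mul]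

end LagSetup

/-! ### Strips and test functions -/

theorem strip_top : strip ⊤ = Ioi (0 : ℝ) ×ˢ (univ : Set ℝ) := by
  ext p; simp [strip, EReal.coe_lt_top]

theorem strip_coe (τ : ℝ) : strip (τ : EReal) = Ioo 0 τ ×ˢ (univ : Set ℝ) := by
  ext p; simp [strip, EReal.coe_lt_coe_iff]

theorem measurableSet_strip (T : EReal) : MeasurableSet (strip T) := by
  have h1 : IsOpen {p : ℝ × ℝ | 0 < p.1} := isOpen_lt continuous_const continuous_fst
  have h2 : IsOpen {p : ℝ × ℝ | (p.1 : EReal) < T} :=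
    isOpen_lt (continuous_coe_real_ereal.comp continuous_fst) continuous_const
  exact (h1.inter h2).measurableSet

/-- Time derivative of a test function. -/
def dt (φ : ℝ × ℝ → ℝ) (p : ℝ × ℝ) : ℝ := fderiv ℝ φ p (1, 0)

/-- Space derivative of a test function. -/
def dx (φ : ℝ × ℝ → ℝ) (p : ℝ × ℝ) : ℝ := fderiv ℝ φ p (0, 1)

section TestFunctions

variable {φ : ℝ × ℝ → ℝ}

theorem fderiv_prod_apply (φ : ℝ × ℝ → ℝ) (p : ℝ × ℝ) (a b : ℝ) :
    fderiv ℝ φ p (a, b) = a * dt φ p + b * dx φ p := by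
  have : ((a, b) : ℝ × ℝ) = a • (1, 0) + b • (0, 1) := by simp
  rw [this, map_add, map_smul, map_smul]; rfl

theorem contDiff_dt (h : ContDiff ℝ ∞ φ) : ContDiff ℝ ∞ (dt φ) :=
  (h.fderiv_right (m := ∞) (by norm_num)).clm_apply contDiff_const

theorem contDiff_dx (h : ContDiff ℝ ∞ φ) : ContDiff ℝ ∞ (dx φ) :=
  (h.fderiv_right (m := ∞) (by norm_num)).clm_apply contDiff_const

theorem hasCompactSupport_dt (h : HasCompactSupport φ) : HasCompactSupport (dt φ) :=
  h.fderiv_apply (𝕜 := ℝ) (1, 0)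

theorem hasCompactSupport_dx (h : HasCompactSupport φ) : HasCompactSupport (dx φ) :=
  h.fderiv_apply (𝕜 := ℝ) (0, 1)

theorem hasDerivAt_comp_curve (h : ContDiff ℝ ∞ φ) {γ : ℝ → ℝ} {γ' t : ℝ}
    (hγ : HasDerivAt γ γ' t) :
    HasDerivAt (fun s => φ (s, γ s)) (dt φ (t, γ t) + γ' * dx φ (t, γ t)) t := by
  have hd : DifferentiableAt ℝ φ (t, γ t) := h.differentiable (by norm_num) _
  have := HasFDerivAt.comp_hasDerivAt (l := φ) (f := fun s => (s, γ s)) t hd.hasFDerivAt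
    ((hasDerivAt_id t).prodMk hγ)
  rw [fderiv_prod_apply, one_mul] at this
  exact this

theorem hasDerivAt_snd (h : ContDiff ℝ ∞ φ) (t x : ℝ) :
    HasDerivAt (fun y => φ (t, y)) (dx φ (t, x)) x := by
  have hd : DifferentiableAt ℝ φ (t, x) := h.differentiable (by norm_num) _
  exact HasFDerivAt.comp_hasDerivAt (l := φ) (f := fun y => (t, y)) x hd.hasFDerivAt
    ((hasDerivAt_const x t).prodMk (hasDerivAt_id x))

theorem hasDerivAt_fst (h : ContDiff ℝ ∞ φ) (t x : ℝ) :
    HasDerivAt (fun s => φ (s, x)) (dt φ (t, x)) t := by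
  have := hasDerivAt_comp_curve h (hasDerivAt_const t x)
  simpa using this

theorem exists_support_bound (h : HasCompactSupport φ) :
    ∃ N : ℝ, 0 < N ∧ ∀ t x, (N < |t| ∨ N < |x|) → φ (t, x) = 0 := by
  obtain ⟨R, hR⟩ := h.isCompact.isBounded.subset_closedBall 0
  refine ⟨max R 1, lt_max_of_lt_right one_pos, fun t x htx => ?_⟩
  by_contra hne
  have := hR (subset_tsupport φ hne)
  rw [mem_closedBall_zero_iff, Prod.norm_def, Real.norm_eq_abs, Real.norm_eq_abs] at this
  have h1 := (le_max_left _ _).trans this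
  have h2 := (le_max_right _ _).trans this
  rcases htx with h | h
  · exact absurd ((le_max_left _ _).trans_lt h) (not_lt.2 h1)
  · exact absurd ((le_max_left _ _).trans_lt h) (not_lt.2 h2)

end TestFunctions

/-! ### The transported pair solves both equations -/

namespace LagSetup

variable {V : ℝ → ℝ → ℝ} {κ r u η : ℝ → ℝ} {lo hi : ℝ} {L K₀ : NNReal} {Z C₁ C₂ : ℝ}
  {X : ℝ → ℝ → ℝ}

/-- The Eulerian velocity of the flow. -/
def eulVel (V : ℝ → ℝ → ℝ) (κ r u : ℝ → ℝ) (X : ℝ → ℝ → ℝ) (t x : ℝ) : ℝ :=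
  clampVel V (lagMean κ r (posFlow X t) (label X t x)) (u (label X t x))

/-- The Eulerian marker transported by the flow. -/
def eulMarker (u : ℝ → ℝ) (X : ℝ → ℝ → ℝ) (t x : ℝ) : ℝ := u (label X t x)

theorem posMean_mem (S : LagSetup V κ r u lo hi L K₀ Z C₁ C₂) (hX : IsLagFlow V κ r u X)
    (t a : ℝ) : lagMean κ r (posFlow X t) a ∈ Icc (0 : ℝ) 1 :=
  S.lagMean_mem hX (le_max_right t 0) a

/-- The clamp in the velocity of the flow is inactive, because the averaged density lies in `[0,
1]`. -/
theorem speed_eq (S : LagSetup V κ r u lo hi L K₀ Z C₁ C₂) (hX : IsLagFlow V κ r u X)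
    (hη : ∀ x ≤ 0, η x = κ x) (t x : ℝ) :
    speed V η (eulDensity r X) (eulMarker u X) t x = eulVel V κ r u X t x := by
  rw [speed, S.conv_eulDensity hX hη, eulVel, clampVel_eq (S.posMean_mem hX t _)]; rfl

theorem eulVel_mem (S : LagSetup V κ r u lo hi L K₀ Z C₁ C₂) (t x : ℝ) :
    eulVel V κ r u X t x ∈ Icc 0 C₁ :=
  ⟨S.clampVel_nonneg _ (S.u_mem _), S.clampVel_le _ (S.u_mem _)⟩

theorem hasDerivAt_posFlow (S : LagSetup V κ r u lo hi L K₀ Z C₁ C₂) (hX : IsLagFlow V κ r u X)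
    {t : ℝ} (ht : 0 < t) (a : ℝ) :
    HasDerivAt (fun s => posFlow X s a) (eulVel V κ r u X t (posFlow X t a)) t := by
  have h := hX.hasDerivAt t a
  have heq : posFlow X t = X t := by funext b; rw [posFlow, max_eq_left ht.le]
  rw [eulVel, S.label_posFlow hX, heq]
  refine h.congr_of_eventuallyEq ?_
  filter_upwards [lt_mem_nhds ht] with s hs
  rw [posFlow, max_eq_left hs.le]

/-- The labels are Lipschitz in time and position, the mean in time and label, and `V` on its
rectangle. The constants grow with time, hence the cap `τ`; since the flow is frozen before time
`0`, no lower bound on the times is needed. -/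
theorem exists_eulVel_lip (S : LagSetup V κ r u lo hi L K₀ Z C₁ C₂) (hX : IsLagFlow V κ r u X)
    (τ : ℝ) : ∃ M : ℝ, 0 ≤ M ∧ ∀ s t x y, s ≤ τ → t ≤ τ →
      |eulVel V κ r u X t x - eulVel V κ r u X s y| ≤ M * (|t - s| + |x - y|) := by
  set m := ∫ x, r x
  have hm : 0 ≤ m := S.mass_nonneg
  set G := flowLip κ r L K₀ C₁ C₂ (max τ 0)
  have hG : 0 ≤ G := S.flowLip_nonneg (le_max_right _ _)
  set A := L * (2 * C₁) * m
  have hA : 0 ≤ A := mul_nonneg (mul_nonneg L.coe_nonneg (mul_nonneg zero_le_two S.C₁_nonneg)) hm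
  set B := L * G * m + κ 0
  have hB : 0 ≤ B := add_nonneg (mul_nonneg (mul_nonneg L.coe_nonneg hG) hm) (S.κ_nonneg 0)
  set Λ := labelLip r L C₁ τ
  have hΛ : 0 ≤ Λ := (labelLip_pos _ _ _ _).le
  set D := C₁ * B + C₂ * K₀
  have hD : 0 ≤ D := add_nonneg (mul_nonneg S.C₁_nonneg hB) (mul_nonneg S.C₂_nonneg K₀.coe_nonneg)
  refine ⟨C₁ * A + D * (Λ * (C₁ + 1)), ?_, ?_⟩
  · exact add_nonneg (mul_nonneg S.C₁_nonneg hA)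
      (mul_nonneg hD (mul_nonneg hΛ (add_nonneg S.C₁_nonneg zero_le_one)))
  intro s t x y hs ht
  have hlab : |label X t x - label X s y| ≤ Λ * (C₁ * |t - s| + |x - y|) :=
    (S.label_lip_joint hX s t x y).trans (mul_le_mul_of_nonneg_right (S.labelLip_mono ht)
      (add_nonneg (mul_nonneg S.C₁_nonneg (abs_nonneg _)) (abs_nonneg _)))
  have hΞt : ∀ a, |lagMean κ r (posFlow X t) a - lagMean κ r (posFlow X s) a| ≤ A * |t - s| :=
    fun a => (S.abs_lagMean_sub_le (hX.cont _).measurable (hX.cont _).measurable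
      (fun b => S.posFlow_lip_time hX s t b) a).trans (le_of_eq (by ring))
  have hΞa : ∀ a b, |lagMean κ r (posFlow X s) a - lagMean κ r (posFlow X s) b| ≤ B * |a - b| := by
    intro a b
    wlog h : b ≤ a generalizing a b
    · rw [abs_sub_comm, abs_sub_comm a]; exact this b a (le_of_not_ge h)
    have h1 := S.abs_lagMean_sub_le_label (continuous_posFlow hX s).measurable h
    have h2 := S.posFlow_lip_label hX s a b
    have h3 : flowLip κ r L K₀ C₁ C₂ (max s 0) * |a - b| ≤ G * |a - b| :=
      mul_le_mul_of_nonneg_right (S.flowLip_mono (max_le_max_right 0 hs)) (abs_nonneg _)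
    have h4 := mul_le_mul_of_nonneg_right
      (mul_le_mul_of_nonneg_left (h2.trans h3) L.coe_nonneg) hm
    rw [abs_of_nonneg (sub_nonneg.2 h)] at h4 ⊢
    simp only [B]
    linarith
  have hu : |u (label X t x) - u (label X s y)| ≤ K₀ * |label X t x - label X s y| := by
    simpa [Real.dist_eq] using S.u_lip.dist_le_mul (label X t x) (label X s y)
  have h1 := S.clampVel_sub_le (lagMean κ r (posFlow X s) (label X s y))
    (lagMean κ r (posFlow X t) (label X t x)) (S.u_mem (label X s y)) (S.u_mem (label X t x))
  have h2 := abs_sub_le (lagMean κ r (posFlow X t) (label X t x))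
    (lagMean κ r (posFlow X s) (label X t x)) (lagMean κ r (posFlow X s) (label X s y))
  have h3 := mul_le_mul_of_nonneg_left (h2.trans (add_le_add (hΞt _) (hΞa _ _))) S.C₁_nonneg
  have h4 := mul_le_mul_of_nonneg_left hu S.C₂_nonneg
  have h5 := mul_le_mul_of_nonneg_left hlab hD
  have h6 : 0 ≤ D * Λ * |t - s| := mul_nonneg (mul_nonneg hD hΛ) (abs_nonneg _)
  have h7 : 0 ≤ D * Λ * (C₁ * |x - y|) :=
    mul_nonneg (mul_nonneg hD hΛ) (mul_nonneg S.C₁_nonneg (abs_nonneg _))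
  have h8 : 0 ≤ C₁ * A * |x - y| := mul_nonneg (mul_nonneg S.C₁_nonneg hA) (abs_nonneg _)
  have h9 : D * |label X t x - label X s y| = C₁ * (B * |label X t x - label X s y|)
      + C₂ * (K₀ * |label X t x - label X s y|) := by simp only [D]; ring
  rw [eulVel, eulVel]
  linarith

theorem continuous_eulVel (S : LagSetup V κ r u lo hi L K₀ Z C₁ C₂) (hX : IsLagFlow V κ r u X) :
    Continuous (Function.uncurry (eulVel V κ r u X)) := by
  rw [continuous_iff_continuousAt]
  rintro ⟨t, x⟩
  obtain ⟨M, hM, h⟩ := S.exists_eulVel_lip hX (t + 1)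
  rw [ContinuousAt, tendsto_iff_dist_tendsto_zero]
  refine squeeze_zero' (g := fun p : ℝ × ℝ => M * (|p.1 - t| + |p.2 - x|))
    (Eventually.of_forall fun _ => dist_nonneg) ?_ ?_
  · have : ∀ᶠ p : ℝ × ℝ in 𝓝 (t, x), p.1 < t + 1 :=
      continuous_fst.continuousAt.eventually (gt_mem_nhds (by simp))
    filter_upwards [this] with p hp
    exact h t p.1 p.2 x (by linarith) hp.le
  · have : Continuous fun p : ℝ × ℝ => M * (|p.1 - t| + |p.2 - x|) := by fun_prop
    simpa using this.tendsto (t, x)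

/-- The transported density solves the continuity equation, with its initial datum. -/
theorem eulDensity_weak (S : LagSetup V κ r u lo hi L K₀ Z C₁ C₂) (hX : IsLagFlow V κ r u X)
    {φ : ℝ × ℝ → ℝ} (hφ : ContDiff ℝ ∞ φ) (hc : HasCompactSupport φ) :
    (∫ p in strip ⊤, (eulDensity r X p.1 p.2 * dt φ p
        + eulVel V κ r u X p.1 p.2 * eulDensity r X p.1 p.2 * dx φ p))
      + ∫ x, r x * φ (0, x) = 0 := by
  -- The function `h` is the derivative of the test function along the flow, and `k` below is its
  -- pullback to labels. Both are continuous with compact support, as displacements are at most `C₁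
  -- * |t|`; this provides all the integrability.
  set h : ℝ × ℝ → ℝ := fun p => dt φ p + eulVel V κ r u X p.1 p.2 * dx φ p with hh
  have hhc : Continuous h :=
    (contDiff_dt hφ).continuous.add ((S.continuous_eulVel hX).mul (contDiff_dx hφ).continuous)
  have hhs : HasCompactSupport h :=
    (hasCompactSupport_dt hc).add ((hasCompactSupport_dx hc).mul_left)
  obtain ⟨N, hN, hsupp⟩ := exists_support_bound hhs
  have hint : IntegrableOn (fun p : ℝ × ℝ => h p * eulDensity r X p.1 p.2)
      (Ioi (0 : ℝ) ×ˢ (univ : Set ℝ)) := by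
    refine Integrable.integrableOn ?_
    refine ((hhc.integrable_of_hasCompactSupport hhs).norm.mul_const (labelLip r L C₁ N)).mono'
      (hhc.measurable.mul (S.measurable_eulDensity hX)).aestronglyMeasurable
      (ae_of_all _ fun p => ?_)
    have hmem := S.eulDensity_mem hX p.1 p.2
    rw [norm_mul, Real.norm_eq_abs (eulDensity r X p.1 p.2), abs_of_nonneg hmem.1]
    rcases le_or_gt p.1 N with hp | hp
    · exact mul_le_mul_of_nonneg_left (hmem.2.trans (S.labelLip_mono hp)) (norm_nonneg _)
    · have : h p = 0 := hsupp p.1 p.2 (Or.inl (hp.trans_le (le_abs_self _)))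
      simp [this]
  have hΦ := S.continuous_uncurry_posFlow hX
  set k : ℝ × ℝ → ℝ := fun p => h (p.1, posFlow X p.1 p.2)
  have hkc : Continuous k := hhc.comp (continuous_fst.prodMk hΦ)
  have hks : HasCompactSupport k := by
    refine HasCompactSupport.of_support_subset_isCompact
      (isCompact_Icc (a := ((-N, -(N + C₁ * N)) : ℝ × ℝ)) (b := (N, N + C₁ * N))) fun p hp => ?_
    have h1 : |p.1| ≤ N := by
      by_contra! hlt; exact hp (hsupp _ _ (Or.inl hlt))
    have h2 : |posFlow X p.1 p.2| ≤ N := by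
      by_contra! hlt; exact hp (hsupp _ _ (Or.inr hlt))
    have h3 := S.abs_posFlow_sub_le hX p.1 p.2
    have h4 := mul_le_mul_of_nonneg_left h1 S.C₁_nonneg
    rw [abs_le] at h1 h2 h3
    exact ⟨⟨h1.1, by simp only; linarith⟩, ⟨h1.2, by simp only; linarith⟩⟩
  have hint2 : Integrable (fun p : ℝ × ℝ => k p * r p.2)
      ((volume.restrict (Ioi (0 : ℝ))).prod volume) := by
    have : Integrable (fun p : ℝ × ℝ => k p * r p.2) := by
      refine (hkc.integrable_of_hasCompactSupport hks).norm.mono'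
        (hkc.measurable.mul (S.r_meas.comp measurable_snd)).aestronglyMeasurable
        (ae_of_all _ fun p => ?_)
      rw [norm_mul, Real.norm_eq_abs (r p.2), abs_of_nonneg (S.r_mem _).1]
      exact mul_le_of_le_one_right (norm_nonneg _) (S.r_mem _).2
    have h2 := this.integrableOn (s := Ioi (0 : ℝ) ×ˢ (univ : Set ℝ))
    rwa [IntegrableOn, Measure.volume_eq_prod, ← Measure.prod_restrict, Measure.restrict_univ]
      at h2
  -- Along a trajectory the integrand is an exact derivative in time, and only the value at time `0`
  -- survives.
  have hinner : ∀ a, ∫ t in Ioi (0 : ℝ), k (t, a) = -φ (0, a) := by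
    intro a
    have hd : ∀ t ∈ Ioi (0 : ℝ), HasDerivAt (fun t => φ (t, posFlow X t a)) (k (t, a)) t :=
      fun t ht => hasDerivAt_comp_curve hφ (S.hasDerivAt_posFlow hX ht a)
    obtain ⟨N', hN', hsupp'⟩ := exists_support_bound hc
    have hk1 : Integrable fun t => k (t, a) := by
      refine (hkc.comp (continuous_id.prodMk continuous_const)).integrable_of_hasCompactSupport ?_
      refine HasCompactSupport.of_support_subset_isCompact (isCompact_Icc (a := -N) (b := N))
        fun t ht => ?_
      have h1 : |t| ≤ N := by
        by_contra! hlt; exact ht (hsupp _ _ (Or.inl hlt))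
      exact abs_le.1 h1
    have := integral_Ioi_of_hasDerivAt_of_tendsto (m := 0)
      ((hφ.continuous.comp (continuous_id.prodMk
        (hΦ.comp (continuous_id.prodMk continuous_const)))).continuousWithinAt) hd
      hk1.integrableOn ?_
    · rw [this, zero_sub]
      simp [Function.uncurry, posFlow_of_nonpos hX le_rfl]
    · refine tendsto_const_nhds.congr' ?_
      filter_upwards [eventually_gt_atTop N'] with t ht
      exact (hsupp' _ _ (Or.inl (ht.trans_le (le_abs_self _)))).symm
  have e1 : ∫ p in strip ⊤, (eulDensity r X p.1 p.2 * dt φ p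
        + eulVel V κ r u X p.1 p.2 * eulDensity r X p.1 p.2 * dx φ p)
      = ∫ t in Ioi (0 : ℝ), ∫ x, h (t, x) * eulDensity r X t x := by
    rw [strip_top]
    have := setIntegral_prod (μ := (volume : Measure ℝ)) (ν := (volume : Measure ℝ)) _ hint
    rw [Measure.restrict_univ] at this
    rw [Measure.volume_eq_prod, ← this]
    refine integral_congr_ae (ae_of_all _ fun p => ?_)
    simp only [hh]; ring
  have e2 : ∫ t in Ioi (0 : ℝ), ∫ x, h (t, x) * eulDensity r X t x
      = ∫ t in Ioi (0 : ℝ), ∫ a, k (t, a) * r a := by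
    congr 1
    funext t
    exact S.integral_mul_eulDensity hX t fun x => h (t, x)
  have e3 := integral_integral_swap (f := fun t a => k (t, a) * r a) hint2
  rw [e1, e2, e3]
  simp_rw [integral_mul_const, hinner]
  rw [← integral_add]
  · refine (integral_congr_ae (ae_of_all _ fun a => ?_)).trans (integral_zero _ _)
    ring
  · have := hint2.integral_prod_right
    simpa only [integral_mul_const, hinner] using this
  · have := hint2.integral_prod_right
    simp only [integral_mul_const, hinner] at this
    refine this.neg.congr (ae_of_all _ fun a => ?_)
    simp only [Pi.neg_apply]; ring

end LagSetup

theorem isOpen_strip (T : EReal) : IsOpen (strip T) := by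
  have h1 : IsOpen {p : ℝ × ℝ | 0 < p.1} := isOpen_lt continuous_const continuous_fst
  have h2 : IsOpen {p : ℝ × ℝ | (p.1 : EReal) < T} :=
    isOpen_lt (continuous_coe_real_ereal.comp continuous_fst) continuous_const
  exact h1.inter h2

theorem ae_fst_ne (c : ℝ) : ∀ᵐ p : ℝ × ℝ, p.1 ≠ c := by
  have hm : MeasurableSet {p : ℝ × ℝ | p.1 ≠ c} :=
    (measurableSet_eq_fun measurable_fst measurable_const).compl
  rw [Measure.volume_eq_prod, Measure.ae_prod_iff_ae_ae hm]
  filter_upwards [compl_mem_ae_iff.2 (measure_singleton c)] with t ht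
  exact ae_of_all _ fun _ => ht

namespace LagSetup

variable {V : ℝ → ℝ → ℝ} {κ r u η : ℝ → ℝ} {lo hi : ℝ} {L K₀ : NNReal} {Z C₁ C₂ : ℝ}
  {X : ℝ → ℝ → ℝ}

theorem ae_label_prod (S : LagSetup V κ r u lo hi L K₀ Z C₁ C₂) (hX : IsLagFlow V κ r u X)
    {p : ℝ → Prop} (h : ∀ᵐ a, p a) : ∀ᵐ q : ℝ × ℝ, p (label X q.1 q.2) := by
  -- A Borel null set containing the exceptional labels is needed to apply Fubini's theorem.
  obtain ⟨N, hN, hNm, hN0⟩ := exists_measurable_superset_of_null (ae_iff.1 h)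
  have h1 : ∀ᵐ q : ℝ × ℝ, label X q.1 q.2 ∉ N := by
    have hm : MeasurableSet {q : ℝ × ℝ | label X q.1 q.2 ∉ N} :=
      ((S.continuous_label hX).measurable hNm).compl
    rw [Measure.volume_eq_prod, Measure.ae_prod_iff_ae_ae hm]
    exact ae_of_all _ fun t => S.ae_label hX t (measure_eq_zero_iff_ae_notMem.1 hN0)
  filter_upwards [h1] with q hq
  by_contra hcon
  exact hq (hN hcon)

theorem ae_differentiableAt_label_prod (S : LagSetup V κ r u lo hi L K₀ Z C₁ C₂)
    (hX : IsLagFlow V κ r u X) : ∀ᵐ q : ℝ × ℝ, DifferentiableAt ℝ (label X q.1) q.2 := by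
  rw [Measure.volume_eq_prod, Measure.ae_prod_iff_ae_ae
    (measurableSet_of_differentiableAt_with_param ℝ (S.continuous_label hX))]
  exact ae_of_all _ fun t => S.ae_differentiableAt_label hX t

/-- The chain rule gives `z(label) r(label) ∂ₓ label`, and the last two factors form the density.
This is the relation `∂ₓ u = ρ z`. -/
theorem ae_hasDerivAt_eulMarker (S : LagSetup V κ r u lo hi L K₀ Z C₁ C₂)
    (hX : IsLagFlow V κ r u X) {z : ℝ → ℝ} (hz : ∀ᵐ a, HasDerivAt u (z a * r a) a) :
    ∀ᵐ q : ℝ × ℝ,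
      HasDerivAt (eulMarker u X q.1) (eulDensity r X q.1 q.2 * z (label X q.1 q.2)) q.2 := by
  filter_upwards [S.ae_label_prod hX hz, S.ae_differentiableAt_label_prod hX] with q h1 h2
  have := h1.comp q.2 h2.hasDerivAt
  convert! this using 1
  rw [eulDensity]; ring

theorem abs_u_sub_le (S : LagSetup V κ r u lo hi L K₀ Z C₁ C₂) (a b : ℝ) :
    |u a - u b| ≤ K₀ * |a - b| := by
  simpa [Real.dist_eq] using S.u_lip.dist_le_mul a b

theorem eulMarker_lip_joint (S : LagSetup V κ r u lo hi L K₀ Z C₁ C₂) (hX : IsLagFlow V κ r u X)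
    (s t x y : ℝ) : |eulMarker u X t x - eulMarker u X s y|
      ≤ K₀ * (labelLip r L C₁ t * (C₁ * |t - s| + |x - y|)) :=
  (S.abs_u_sub_le _ _).trans
    (mul_le_mul_of_nonneg_left (S.label_lip_joint hX s t x y) K₀.coe_nonneg)

theorem continuous_eulMarker (S : LagSetup V κ r u lo hi L K₀ Z C₁ C₂) (hX : IsLagFlow V κ r u X) :
    Continuous (Function.uncurry (eulMarker u X)) :=
  S.u_lip.continuous.comp (S.continuous_label hX)

theorem eulMarker_posFlow (S : LagSetup V κ r u lo hi L K₀ Z C₁ C₂) (hX : IsLagFlow V κ r u X)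
    (t a : ℝ) : eulMarker u X t (posFlow X t a) = u a := by
  rw [eulMarker, S.label_posFlow hX]

theorem eulMarker_of_nonpos (S : LagSetup V κ r u lo hi L K₀ Z C₁ C₂) (hX : IsLagFlow V κ r u X)
    {t : ℝ} (ht : t ≤ 0) (x : ℝ) : eulMarker u X t x = u x := by
  rw [eulMarker, S.label_of_nonpos hX ht]

/-- The marker, frozen after the time `N`. -/
def cutMarker (u : ℝ → ℝ) (X : ℝ → ℝ → ℝ) (N : ℝ) (p : ℝ × ℝ) : ℝ := eulMarker u X (min p.1 N) p.2

/-- The Lipschitz constant of the marker grows with time; freezing it after `N` gives a function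
that is Lipschitz on the whole plane, to which Rademacher's theorem and integration by parts apply.
-/
theorem exists_lipschitz_cutMarker (S : LagSetup V κ r u lo hi L K₀ Z C₁ C₂)
    (hX : IsLagFlow V κ r u X) (N : ℝ) : ∃ M : NNReal, LipschitzWith M (cutMarker u X N) := by
  have hΛ : 0 ≤ labelLip r L C₁ N := (labelLip_pos _ _ _ _).le
  have h0 : 0 ≤ K₀ * (labelLip r L C₁ N * (C₁ + 1)) :=
    mul_nonneg K₀.coe_nonneg (mul_nonneg hΛ (add_nonneg S.C₁_nonneg zero_le_one))
  refine ⟨⟨_, h0⟩, LipschitzWith.of_dist_le_mul fun p q => ?_⟩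
  change |eulMarker u X (min p.1 N) p.2 - eulMarker u X (min q.1 N) q.2|
    ≤ K₀ * (labelLip r L C₁ N * (C₁ + 1)) * dist p q
  refine (S.eulMarker_lip_joint hX _ _ _ _).trans ?_
  rw [mul_assoc, mul_assoc]
  refine mul_le_mul_of_nonneg_left ?_ K₀.coe_nonneg
  have h1 : |min p.1 N - min q.1 N| ≤ dist p q := by
    refine (abs_min_sub_min_le_max _ _ _ _).trans ?_
    rw [sub_self, abs_zero, max_eq_left (abs_nonneg _), ← Real.dist_eq]
    exact le_max_left _ _
  have h2 : |p.2 - q.2| ≤ dist p q := by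
    rw [← Real.dist_eq]; exact le_max_right _ _
  refine mul_le_mul (S.labelLip_mono (min_le_right _ _)) ?_
    (add_nonneg (mul_nonneg S.C₁_nonneg (abs_nonneg _)) (abs_nonneg _)) hΛ
  have := mul_le_mul_of_nonneg_left h1 S.C₁_nonneg
  linarith

/-- The marker is constant along trajectories. At a point of differentiability, the derivative in
the direction `(1, eulVel)` therefore vanishes. -/
theorem lineDeriv_cutMarker (S : LagSetup V κ r u lo hi L K₀ Z C₁ C₂)
    (hX : IsLagFlow V κ r u X) {N : ℝ} {p : ℝ × ℝ} (hp : 0 < p.1) (hpN : p.1 < N)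
    (hd : DifferentiableAt ℝ (cutMarker u X N) p) :
    lineDeriv ℝ (cutMarker u X N) p (1, 0)
      = -(eulVel V κ r u X p.1 p.2 * deriv (eulMarker u X p.1) p.2) := by
  rw [hd.lineDeriv_eq_fderiv]
  have hev : ∀ᶠ s in 𝓝 p.1, s < N := gt_mem_nhds hpN
  have hx : HasDerivAt (eulMarker u X p.1) (dx (cutMarker u X N) p) p.2 := by
    have := HasFDerivAt.comp_hasDerivAt (l := cutMarker u X N) (f := fun y => (p.1, y)) p.2
      hd.hasFDerivAt ((hasDerivAt_const p.2 p.1).prodMk (hasDerivAt_id p.2))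
    refine this.congr_of_eventuallyEq (Eventually.of_forall fun y => ?_)
    simp [cutMarker, min_eq_left hpN.le]
  rw [hx.deriv]
  set a := label X p.1 p.2
  have hpa : posFlow X p.1 a = p.2 := S.posFlow_label hX _ _
  have hγ := S.hasDerivAt_posFlow hX hp a
  have hcurve : HasFDerivAt (cutMarker u X N) (fderiv ℝ (cutMarker u X N) p)
      (p.1, posFlow X p.1 a) := by rw [hpa]; exact hd.hasFDerivAt
  have h1 := HasFDerivAt.comp_hasDerivAt (l := cutMarker u X N) (f := fun s => (s, posFlow X s a))
    p.1 hcurve ((hasDerivAt_id p.1).prodMk hγ)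
  have h2 : HasDerivAt (cutMarker u X N ∘ fun s => (s, posFlow X s a)) 0 p.1 := by
    refine (hasDerivAt_const p.1 (u a)).congr_of_eventuallyEq ?_
    filter_upwards [hev] with s hs
    simp [cutMarker, min_eq_left hs.le, S.eulMarker_posFlow hX]
  have h3 := h1.unique h2
  rw [fderiv_prod_apply, hpa, one_mul] at h3
  change dt (cutMarker u X N) p = _
  linarith

/-- The transported marker solves the transport equation, with its initial datum. -/
theorem eulMarker_weak (S : LagSetup V κ r u lo hi L K₀ Z C₁ C₂) (hX : IsLagFlow V κ r u X)
    {φ : ℝ × ℝ → ℝ} (hφ : ContDiff ℝ ∞ φ) (hc : HasCompactSupport φ) :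
    (∫ p in strip ⊤, (eulMarker u X p.1 p.2 * dt φ p
        - eulVel V κ r u X p.1 p.2 * deriv (eulMarker u X p.1) p.2 * φ p))
      + ∫ x, u x * φ (0, x) = 0 := by
  obtain ⟨N₁, hN₁, hs₁⟩ := exists_support_bound hc
  obtain ⟨N₂, hN₂, hs₂⟩ := exists_support_bound (hasCompactSupport_dt hc)
  set N := max N₁ N₂
  obtain ⟨M, hM⟩ := S.exists_lipschitz_cutMarker hX N
  obtain ⟨M', hM'⟩ : ∃ M', LipschitzWith M' φ :=
    ContDiff.lipschitzWith_of_hasCompactSupport hc hφ (by norm_num)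
  set f := cutMarker u X N
  -- Integration by parts in time on the whole plane. The half-plane of positive times yields the
  -- equation, and the complementary half-plane yields the initial datum.
  have hparts := hM.integral_lineDeriv_mul_eq (μ := volume) hM' hc (1, 0)
  have hld : ∀ p, lineDeriv ℝ φ p (-(1, 0)) = -dt φ p := by
    intro p
    rw [(hφ.differentiable (by norm_num) p).lineDeriv_eq_fderiv, map_neg]; rfl
  have hi1 : Integrable fun p => lineDeriv ℝ f p (1, 0) * φ p := by
    refine ((hφ.continuous.integrable_of_hasCompactSupport hc).norm.const_mul
      (M * ‖((1, 0) : ℝ × ℝ)‖)).mono'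
      ((hM.memLp_lineDeriv (μ := volume) (1, 0)).aestronglyMeasurable.mul
        hφ.continuous.aestronglyMeasurable) (ae_of_all _ fun p => ?_)
    rw [norm_mul]
    exact mul_le_mul_of_nonneg_right (norm_lineDeriv_le_of_lipschitz ℝ hM) (norm_nonneg _)
  have hi2 : Integrable fun p => f p * dt φ p :=
    (hM.continuous.mul (contDiff_dt hφ).continuous).integrable_of_hasCompactSupport
      (hasCompactSupport_dt hc).mul_left
  have htot : ∫ p, (f p * dt φ p + lineDeriv ℝ f p (1, 0) * φ p) = 0 := by
    rw [integral_add hi2 hi1, hparts, ← integral_add hi2]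
    · refine (integral_congr_ae (ae_of_all _ fun p => ?_)).trans (integral_zero _ _)
      simp only [hld]; ring
    · refine hi2.neg.congr (ae_of_all _ fun p => ?_)
      simp only [hld, Pi.neg_apply]; ring
  have hms := measurableSet_strip ⊤
  have hi12 : Integrable fun p => f p * dt φ p + lineDeriv ℝ f p (1, 0) * φ p := hi2.add hi1
  rw [← integral_add_compl hms hi12] at htot
  have hdiff := hM.ae_differentiableAt (μ := volume)
  have hpos : ∫ p in strip ⊤, (f p * dt φ p + lineDeriv ℝ f p (1, 0) * φ p)
      = ∫ p in strip ⊤, (eulMarker u X p.1 p.2 * dt φ p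
        - eulVel V κ r u X p.1 p.2 * deriv (eulMarker u X p.1) p.2 * φ p) := by
    refine setIntegral_congr_ae hms ?_
    filter_upwards [hdiff, ae_fst_ne N] with p hp hne hps
    rcases lt_or_gt_of_ne hne with hlt | hgt
    · rw [S.lineDeriv_cutMarker hX hps.1 hlt hp]
      simp only [f, cutMarker, min_eq_left hlt.le]; ring
    · have z1 : φ p = 0 := hs₁ p.1 p.2 (Or.inl (((le_max_left _ _).trans_lt hgt).trans_le
        (le_abs_self _)))
      have z2 : dt φ p = 0 := hs₂ p.1 p.2 (Or.inl (((le_max_right _ _).trans_lt hgt).trans_le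
        (le_abs_self _)))
      simp [z1, z2]
  have hcompl : (strip ⊤)ᶜ = Iic (0 : ℝ) ×ˢ (univ : Set ℝ) := by
    rw [strip_top]; ext p; simp
  -- For nonpositive times the marker is `u`, independent of time, so only the integral of `dt φ`
  -- over the negative half line remains; it equals `φ (0, x)`.
  have hneg : ∫ p in (strip ⊤)ᶜ, (f p * dt φ p + lineDeriv ℝ f p (1, 0) * φ p)
      = ∫ x, u x * φ (0, x) := by
    have hN : 0 ≤ N := hN₁.le.trans (le_max_left _ _)
    have e1 : ∫ p in (strip ⊤)ᶜ, (f p * dt φ p + lineDeriv ℝ f p (1, 0) * φ p)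
        = ∫ p in (strip ⊤)ᶜ, u p.2 * dt φ p := by
      refine setIntegral_congr_ae hms.compl ?_
      filter_upwards [ae_fst_ne 0] with p hne hps
      rw [hcompl] at hps
      have hle : p.1 ≤ 0 := hps.1
      have hlt : p.1 < 0 := lt_of_le_of_ne hle hne
      have hfp : ∀ s ≤ (0 : ℝ), ∀ x, f (s, x) = u x := fun s hs x => by
        simp only [f, cutMarker, min_eq_left (hs.trans hN), S.eulMarker_of_nonpos hX hs]
      have hl : lineDeriv ℝ f p (1, 0) = 0 := by
        rw [lineDeriv]
        have hev : ∀ᶠ s : ℝ in 𝓝 0, f (p + s • (1, 0)) = u p.2 := by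
          have : ∀ᶠ s : ℝ in 𝓝 0, s < -p.1 := gt_mem_nhds (by linarith)
          filter_upwards [this] with s hs
          have : p + s • ((1, 0) : ℝ × ℝ) = (p.1 + s, p.2) := by ext <;> simp
          rw [this]
          exact hfp _ (by linarith) _
        rw [Filter.EventuallyEq.deriv_eq hev, deriv_const]
      rw [hl, hfp p.1 hle p.2]; ring
    have hi3 : Integrable fun p : ℝ × ℝ => u p.2 * dt φ p :=
      ((S.u_lip.continuous.comp continuous_snd).mul
        (contDiff_dt hφ).continuous).integrable_of_hasCompactSupport
        (hasCompactSupport_dt hc).mul_left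
    have hi4 : Integrable (fun p : ℝ × ℝ => u p.2 * dt φ p)
        ((volume.restrict (Iic (0 : ℝ))).prod volume) := by
      have := hi3.integrableOn (s := Iic (0 : ℝ) ×ˢ (univ : Set ℝ))
      rwa [IntegrableOn, Measure.volume_eq_prod, ← Measure.prod_restrict, Measure.restrict_univ]
        at this
    rw [e1, hcompl, Measure.volume_eq_prod, ← Measure.prod_restrict, Measure.restrict_univ,
      integral_prod_symm _ hi4]
    refine integral_congr_ae (ae_of_all _ fun x => ?_)
    simp only
    rw [integral_const_mul]
    congr 1
    have := integral_Iic_of_hasDerivAt_of_tendsto (f := fun s => φ (s, x)) (m := 0)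
      ((hφ.continuous.comp (continuous_id.prodMk continuous_const)).continuousWithinAt)
      (fun s _ => hasDerivAt_fst hφ s x) ?_ ?_ (a := 0)
    · simpa using this
    · refine (((contDiff_dt hφ).continuous.comp (continuous_id.prodMk
        continuous_const)).integrable_of_hasCompactSupport ?_).integrableOn
      refine HasCompactSupport.of_support_subset_isCompact (isCompact_Icc (a := -N₂) (b := N₂))
        fun t ht => ?_
      have h1 : |t| ≤ N₂ := by
        by_contra! hlt; exact ht (hs₂ _ _ (Or.inl hlt))
      exact abs_le.1 h1
    · refine tendsto_const_nhds.congr' ?_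
      filter_upwards [eventually_lt_atBot (-N₁)] with t ht
      exact (hs₁ _ _ (Or.inl (by rw [lt_abs]; right; linarith))).symm
  rw [hpos, hneg] at htot
  exact htot

theorem integrable_mul_eulDensity (S : LagSetup V κ r u lo hi L K₀ Z C₁ C₂)
    (hX : IsLagFlow V κ r u X) (t : ℝ) {g : ℝ → ℝ} (hg : Integrable g) :
    Integrable fun x => eulDensity r X t x * g x := by
  refine (hg.norm.const_mul (labelLip r L C₁ t)).mono'
    (((S.measurable_eulDensity hX).comp measurable_prodMk_left).aestronglyMeasurable.mul
      hg.aestronglyMeasurable) (ae_of_all _ fun x => ?_)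
  have := S.eulDensity_mem hX t x
  rw [norm_mul, Real.norm_eq_abs (eulDensity r X t x), abs_of_nonneg this.1]
  exact mul_le_mul_of_nonneg_right this.2 (norm_nonneg _)

theorem memLp_eulDensity (S : LagSetup V κ r u lo hi L K₀ Z C₁ C₂)
    (hX : IsLagFlow V κ r u X) (t : ℝ) : MemLp (eulDensity r X t) ⊤ volume := by
  refine memLp_top_of_bound
    ((S.measurable_eulDensity hX).comp measurable_prodMk_left).aestronglyMeasurable
    (labelLip r L C₁ t) (ae_of_all _ fun x => ?_)
  have := S.eulDensity_mem hX t x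
  change ‖eulDensity r X t x‖ ≤ _
  rw [Real.norm_eq_abs, abs_of_nonneg this.1]
  exact this.2

/-- Against a continuous compactly supported function, the integral in labels is continuous in time
by dominated convergence. The bound on the density, uniform for times near `t₀`, extends this to all
integrable functions by approximation in `L¹`. -/
theorem weakStarContinuous_eulDensity (S : LagSetup V κ r u lo hi L K₀ Z C₁ C₂)
    (hX : IsLagFlow V κ r u X) : WeakStarContinuous (eulDensity r X) := by
  refine ⟨fun t _ => S.memLp_eulDensity hX t, fun g hg => Continuous.continuousOn ?_⟩
  have hcs : ∀ k : ℝ → ℝ, HasCompactSupport k → Continuous k →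
      Continuous fun t => ∫ x, eulDensity r X t x * k x := by
    intro k hk hkc
    have heq : (fun t => ∫ x, eulDensity r X t x * k x)
        = fun t => ∫ a, k (posFlow X t a) * r a := by
      funext t
      rw [← S.integral_mul_eulDensity hX]
      simp only [mul_comm]
    obtain ⟨B, hB⟩ := hkc.bounded_above_of_compact_support hk
    rw [heq]
    refine continuous_of_dominated (bound := fun a => B * r a) (fun t => ?_) (fun t => ?_)
      (S.r_int.const_mul B) (ae_of_all _ fun a => ?_)
    · exact ((hkc.comp (continuous_posFlow hX t)).measurable.mul S.r_meas).aestronglyMeasurable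
    · refine ae_of_all _ fun a => ?_
      rw [norm_mul, Real.norm_eq_abs (r a), abs_of_nonneg (S.r_mem a).1]
      exact mul_le_mul_of_nonneg_right (hB _) (S.r_mem a).1
    · exact (hkc.comp ((S.continuous_uncurry_posFlow hX).comp
        (continuous_id.prodMk continuous_const))).mul continuous_const
  refine continuous_of_locally_uniform_approx_of_continuousAt fun t₀ U hU => ?_
  obtain ⟨ε, hε, hεU⟩ := Metric.mem_uniformity_dist.1 hU
  have hΛ := labelLip_pos r L C₁ (t₀ + 1)
  obtain ⟨k, hk, hgk, hkc, hki⟩ := hg.exists_hasCompactSupport_integral_sub_le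
    (show 0 < ε / (2 * labelLip r L C₁ (t₀ + 1)) by positivity)
  refine ⟨Iio (t₀ + 1), Iio_mem_nhds (by linarith), _, (hcs k hk hkc).continuousAt, fun t ht => ?_⟩
  refine hεU ?_
  rw [Real.dist_eq, ← integral_sub (S.integrable_mul_eulDensity hX t hg)
    (S.integrable_mul_eulDensity hX t hki)]
  refine (abs_integral_le_integral_abs).trans_lt ?_
  calc ∫ x, |eulDensity r X t x * g x - eulDensity r X t x * k x|
      ≤ ∫ x, labelLip r L C₁ (t₀ + 1) * ‖g x - k x‖ := by
        refine integral_mono ((S.integrable_mul_eulDensity hX t hg).sub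
          (S.integrable_mul_eulDensity hX t hki)).abs ((hg.sub hki).norm.const_mul _) fun x => ?_
        have := S.eulDensity_mem hX t x
        simp only [← mul_sub, abs_mul, abs_of_nonneg this.1, Real.norm_eq_abs]
        exact mul_le_mul_of_nonneg_right (this.2.trans (S.labelLip_mono (le_of_lt ht)))
          (abs_nonneg _)
    _ = labelLip r L C₁ (t₀ + 1) * ∫ x, ‖g x - k x‖ := integral_const_mul _ _
    _ ≤ labelLip r L C₁ (t₀ + 1) * (ε / (2 * labelLip r L C₁ (t₀ + 1))) :=
        mul_le_mul_of_nonneg_left hgk hΛ.le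
    _ = ε / 2 := by field_simp
    _ < ε := by linarith

end LagSetup

/-! ### Mollification of weak derivatives -/

/-- `g` is the weak derivative of `F` in the direction `w`, on the strip `]0, τ[ × ℝ`. -/
def WeakDeriv (τ : ℝ) (F g : ℝ × ℝ → ℝ) (w : ℝ × ℝ) : Prop :=
  ∀ φ : ℝ × ℝ → ℝ, ContDiff ℝ ∞ φ → HasCompactSupport φ → tsupport φ ⊆ strip τ →
    ∫ p, F p * fderiv ℝ φ p w = -∫ p, g p * φ p

/-- A sequence of mollifiers on the plane. -/
def bump (n : ℕ) : ContDiffBump (0 : ℝ × ℝ) where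
  rIn := 1 / (n + 1) / 2
  rOut := 1 / (n + 1)
  rIn_pos := by positivity
  rIn_lt_rOut := half_lt_self (by positivity)

/-- The radius of the `n`-th mollifier. -/
def rad (n : ℕ) : ℝ := 1 / (n + 1)

theorem rad_pos (n : ℕ) : 0 < rad n := by unfold rad; positivity

theorem tendsto_rad : Tendsto rad atTop (𝓝 0) := tendsto_one_div_add_atTop_nhds_zero_nat

/-- The mollified function. -/
def moll (n : ℕ) (F : ℝ × ℝ → ℝ) : ℝ × ℝ → ℝ :=
  convolution ((bump n).normed volume) F (ContinuousLinearMap.lsmul ℝ ℝ) volume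

theorem moll_apply (n : ℕ) (F : ℝ × ℝ → ℝ) (p : ℝ × ℝ) :
    moll n F p = ∫ q, (bump n).normed volume (p - q) * F q := by
  rw [moll, convolution_eq_swap]; rfl

theorem bump_eq_zero {n : ℕ} {p q : ℝ × ℝ} (h : q ∉ Metric.ball p (rad n)) :
    (bump n).normed volume (p - q) = 0 := by
  by_contra hne
  have : p - q ∈ Function.support ((bump n).normed (volume : Measure (ℝ × ℝ))) := hne
  rw [(bump n).support_normed_eq, mem_ball_zero_iff] at this
  exact h (by rw [Metric.mem_ball, dist_comm, dist_eq_norm]; exact this)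

theorem integral_bump (n : ℕ) (p : ℝ × ℝ) : ∫ q, (bump n).normed volume (p - q) = 1 := by
  rw [integral_sub_left_eq_self (fun q => (bump n).normed volume q) volume p]
  exact (bump n).integral_normed

theorem integrable_bump (n : ℕ) (p : ℝ × ℝ) :
    Integrable fun q => (bump n).normed (volume : Measure (ℝ × ℝ)) (p - q) :=
  (bump n).integrable_normed.comp_sub_left p

theorem integrable_bump_mul {F : ℝ × ℝ → ℝ} (hF : LocallyIntegrable F) (n : ℕ) (p : ℝ × ℝ) :
    Integrable fun q => (bump n).normed volume (p - q) * F q := by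
  have := (bump n).hasCompactSupport_normed (μ := (volume : Measure (ℝ × ℝ)))
  have h := this.convolutionExists_left (L := ContinuousLinearMap.lsmul ℝ ℝ)
    (bump n).continuous_normed hF p
  have h2 := h.integrable_swap
  exact h2

theorem abs_integral_bump_mul_le {G : ℝ × ℝ → ℝ} {n : ℕ} {p : ℝ × ℝ} {B : ℝ}
    (h : ∀ᵐ q, q ∈ Metric.ball p (rad n) → |G q| ≤ B) :
    |∫ q, (bump n).normed volume (p - q) * G q| ≤ B := by
  have hle : ∀ᵐ q, ‖(bump n).normed volume (p - q) * G q‖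
      ≤ B * (bump n).normed (volume : Measure (ℝ × ℝ)) (p - q) := by
    filter_upwards [h] with q hq
    have h0 : 0 ≤ (bump n).normed (volume : Measure (ℝ × ℝ)) (p - q) := (bump n).nonneg_normed _
    rw [norm_mul, Real.norm_eq_abs, Real.norm_eq_abs, abs_of_nonneg h0, mul_comm]
    by_cases hb : q ∈ Metric.ball p (rad n)
    · exact mul_le_mul_of_nonneg_right (hq hb) h0
    · rw [bump_eq_zero hb]; simp
  have := norm_integral_le_of_norm_le ((integrable_bump n p).const_mul B) hle
  rwa [integral_const_mul, integral_bump, mul_one, Real.norm_eq_abs] at this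

theorem abs_moll_sub_le {F : ℝ × ℝ → ℝ} (hF : LocallyIntegrable F) {n : ℕ} {p : ℝ × ℝ} {B c : ℝ}
    (h : ∀ᵐ q, q ∈ Metric.ball p (rad n) → |F q - c| ≤ B) : |moll n F p - c| ≤ B := by
  have h1 := abs_integral_bump_mul_le (G := fun q => F q - c) h
  have h2 : ∫ q, (bump n).normed volume (p - q) * (F q - c) = moll n F p - c := by
    simp only [mul_sub]
    rw [integral_sub (integrable_bump_mul hF n p) ((integrable_bump n p).mul_const c),
      integral_mul_const, integral_bump, one_mul, moll_apply]
  rwa [h2] at h1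

theorem abs_moll_le {F : ℝ × ℝ → ℝ} {n : ℕ} {p : ℝ × ℝ} {B : ℝ}
    (h : ∀ᵐ q, q ∈ Metric.ball p (rad n) → |F q| ≤ B) : |moll n F p| ≤ B := by
  rw [moll_apply]; exact abs_integral_bump_mul_le h

theorem ae_tendsto_moll {F : ℝ × ℝ → ℝ} (hF : LocallyIntegrable F) :
    ∀ᵐ p, Tendsto (fun n => moll n F p) atTop (𝓝 (F p)) := by
  refine ContDiffBump.ae_convolution_tendsto_right_of_locallyIntegrable (K := 2) tendsto_rad
    (Eventually.of_forall fun n => ?_) hF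
  simp only [bump]; linarith

theorem contDiff_moll {F : ℝ × ℝ → ℝ} (hF : LocallyIntegrable F) (n : ℕ) :
    ContDiff ℝ ∞ (moll n F) :=
  ((bump n).hasCompactSupport_normed).contDiff_convolution_left (n := ⊤) _
    (bump n).contDiff_normed hF

theorem ball_subset_strip {τ ε : ℝ} {p : ℝ × ℝ} (h1 : ε < p.1) (h2 : p.1 + ε < τ) :
    Metric.closedBall p ε ⊆ strip τ := by
  intro q hq
  have : dist q.1 p.1 ≤ ε := (le_max_left _ _).trans (Metric.mem_closedBall.1 hq)
  rw [Real.dist_eq, abs_le] at this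
  exact ⟨by linarith, EReal.coe_lt_coe_iff.2 (by linarith)⟩

/-- The mollifier centred at `p` is itself an admissible test function when its ball stays in the
strip; the two signs, of the reflected argument and of the weak derivative, cancel. -/
theorem fderiv_moll {τ : ℝ} {F g : ℝ × ℝ → ℝ} {w : ℝ × ℝ} (hF : LocallyIntegrable F)
    (h : WeakDeriv τ F g w) {n : ℕ} {p : ℝ × ℝ} (h1 : rad n < p.1) (h2 : p.1 + rad n < τ) :
    fderiv ℝ (moll n F) p w = moll n g p := by
  set ψ := (bump n).normed (volume : Measure (ℝ × ℝ)) with hψ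
  have hψs : HasCompactSupport ψ := (bump n).hasCompactSupport_normed
  have hψc : ContDiff ℝ ∞ ψ := (bump n).contDiff_normed
  have hfd := hψs.hasFDerivAt_convolution_left (ContinuousLinearMap.lsmul ℝ ℝ)
    (hψc.of_le (by norm_num)) hF p
  have hex := (hψs.fderiv ℝ).convolutionExists_left
    (L := (ContinuousLinearMap.lsmul ℝ ℝ).precompL (ℝ × ℝ))
    (hψc.continuous_fderiv (by norm_num)) hF p
  have e1 : fderiv ℝ (moll n F) p w = ∫ q, F q * fderiv ℝ ψ (p - q) w := by
    rw [moll, hfd.fderiv, convolution_eq_swap, ContinuousLinearMap.integral_apply hex.integrable_swap]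
    refine integral_congr_ae (ae_of_all _ fun q => ?_)
    simp [ContinuousLinearMap.precompL_apply, mul_comm]
  have hts : tsupport (fun q => ψ (p - q)) ⊆ Metric.closedBall p (rad n) := by
    refine closure_minimal (fun q hq => ?_) Metric.isClosed_closedBall
    by_contra hcon
    exact hq (bump_eq_zero fun hb => hcon (Metric.ball_subset_closedBall hb))
  have hcomp : ContDiff ℝ ∞ fun q => ψ (p - q) := hψc.comp (contDiff_const.sub contDiff_id)
  have key := h (fun q => ψ (p - q)) hcomp
    ((isCompact_closedBall p (rad n)).of_isClosed_subset (isClosed_tsupport _) hts)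
    (hts.trans (ball_subset_strip h1 h2))
  have hfdφ : ∀ q, fderiv ℝ (fun q => ψ (p - q)) q w = -fderiv ℝ ψ (p - q) w := by
    intro q
    have hd : HasFDerivAt ψ (fderiv ℝ ψ (p - q)) (p - q) :=
      (hψc.differentiable (by norm_num) _).hasFDerivAt
    have := hd.comp q ((hasFDerivAt_const p q).sub (hasFDerivAt_id q))
    have h3 : HasFDerivAt (fun q => ψ (p - q)) _ q := this
    rw [h3.fderiv]
    simp
  simp only [hfdφ, mul_neg, integral_neg, neg_inj] at key
  rw [e1, key, moll_apply]
  simp only [mul_comm, hψ]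

theorem HasDerivAt.moll_comp {τ : ℝ} {F g₁ g₂ : ℝ × ℝ → ℝ} (hF : LocallyIntegrable F)
    (h₁ : WeakDeriv τ F g₁ (1, 0)) (h₂ : WeakDeriv τ F g₂ (0, 1)) {n : ℕ} {γ : ℝ → ℝ} {γ' t : ℝ}
    (hγ : HasDerivAt γ γ' t) (ht1 : rad n < t) (ht2 : t + rad n < τ) :
    HasDerivAt (fun s => moll n F (s, γ s)) (moll n g₁ (t, γ t) + γ' * moll n g₂ (t, γ t)) t := by
  have h := hasDerivAt_comp_curve (contDiff_moll hF n) hγ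
  rw [dt, dx, fderiv_moll hF h₁ ht1 ht2, fderiv_moll hF h₂ ht1 ht2] at h
  exact h

/-! ### Stability of transport and of the look-ahead average -/

namespace LagSetup

variable {V : ℝ → ℝ → ℝ} {κ r u η : ℝ → ℝ} {lo hi : ℝ} {L K₀ : NNReal} {Z C₁ C₂ : ℝ}
  {X : ℝ → ℝ → ℝ}

/-- A weak solution of a transport equation whose velocity is close to that of the flow is close
to the datum transported by the flow. -/
theorem transport_stability (S : LagSetup V κ r u lo hi L K₀ Z C₁ C₂) (hX : IsLagFlow V κ r u X)
    {τ K K₁ M B l : ℝ} (hK : 0 ≤ K) (hM : 0 ≤ M) (hB : 0 ≤ B) (hl : 0 < l)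
    {F g v' : ℝ × ℝ → ℝ} {W : ℝ → ℝ} (hF : LocallyIntegrable F) (hg : LocallyIntegrable g)
    (hvg : LocallyIntegrable fun q => -(v' q * g q))
    (h₁ : WeakDeriv τ F (fun q => -(v' q * g q)) (1, 0)) (h₂ : WeakDeriv τ F g (0, 1))
    (hgK : ∀ᵐ q, q ∈ strip τ → |g q| ≤ K) (hK₁ : 0 ≤ K₁)
    (hF0 : ∀ᵐ q : ℝ × ℝ, q ∈ strip τ → |F q - W q.2| ≤ K₁ * q.1)
    (hW : ∀ x y, |W x - W y| ≤ M * |x - y|)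
    (hv : ∀ᵐ q : ℝ × ℝ, q ∈ strip τ →
      |eulVel V κ r u X q.1 q.2 - v' q| ≤ B * Real.exp (l * q.1)) :
    ∀ᵐ q : ℝ × ℝ, q ∈ strip τ →
      |F q - W (label X q.1 q.2)| ≤ K * (B / l * Real.exp (l * q.1)) := by
  obtain ⟨Λ, hΛ, hlip⟩ := S.exists_eulVel_lip hX τ
  filter_upwards [ae_tendsto_moll hF] with q hq hqs
  obtain ⟨t, x⟩ := q
  have ht0 : 0 < t := hqs.1
  have htτ : t < τ := EReal.coe_lt_coe_iff.1 hqs.2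
  set a := label X t x
  have hax : posFlow X t a = x := S.posFlow_label hX t x
  have hsmall : ∀ᶠ n in atTop, 2 * rad n < t ∧ t + rad n < τ := by
    have h1 : ∀ᶠ n in atTop, rad n < t / 2 := tendsto_rad.eventually (gt_mem_nhds (by linarith))
    have h2 : ∀ᶠ n in atTop, rad n < τ - t := tendsto_rad.eventually (gt_mem_nhds (by linarith))
    filter_upwards [h1, h2] with n hn1 hn2
    constructor <;> linarith
  -- The mollified function is followed along the trajectory of `a` from time `2 * rad n`, early
  -- enough to see the datum and late enough for the mollifier to stay in positive times. The first
  -- summand comes from the evolution, the second from the start.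
  have hbound : ∀ᶠ n in atTop, |moll n F (t, x) - W a|
      ≤ K * (Λ * (2 * rad n) * t + B / l * Real.exp (l * (t + rad n)))
        + (K₁ * (3 * rad n) + M * (rad n + C₁ * (2 * rad n))) := by
    filter_upwards [hsmall] with n hn
    obtain ⟨hn1, hn2⟩ := hn
    set ε := rad n with hε
    have hε0 : 0 < ε := rad_pos n
    have hder : ∀ s ∈ Icc (2 * ε) t, HasDerivAt (fun s => moll n F (s, posFlow X s a))
        (moll n (fun q => -(v' q * g q)) (s, posFlow X s a)
          + eulVel V κ r u X s (posFlow X s a) * moll n g (s, posFlow X s a)) s := fun s hs =>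
      HasDerivAt.moll_comp hF h₁ h₂ (S.hasDerivAt_posFlow hX (by linarith [hs.1]) a)
        (by linarith [hs.1]) (by linarith [hs.2])
    have hdbound : ∀ s ∈ Icc (2 * ε) t, |moll n (fun q => -(v' q * g q)) (s, posFlow X s a)
          + eulVel V κ r u X s (posFlow X s a) * moll n g (s, posFlow X s a)|
        ≤ K * (Λ * (2 * ε) + B * Real.exp (l * (s + ε))) := by
      intro s hs
      set p : ℝ × ℝ := (s, posFlow X s a) with hp
      set vp := eulVel V κ r u X s (posFlow X s a) with hvp
      -- With the flow velocity at the centre moved inside the integral, the derivative along the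
      -- trajectory is an average of `(vp - v') * g`. Only the Lipschitz continuity of the flow
      -- velocity enters, so `v'` needs no regularity.
      have e1 : moll n (fun q => -(v' q * g q)) p + vp * moll n g p
          = ∫ q, (bump n).normed volume (p - q) * ((vp - v' q) * g q) := by
        rw [moll_apply, moll_apply, ← integral_const_mul, ← integral_add
          (integrable_bump_mul hvg n p) ((integrable_bump_mul hg n p).const_mul vp)]
        refine integral_congr_ae (ae_of_all _ fun q => ?_)
        simp only; ring
      rw [e1]
      refine abs_integral_bump_mul_le ?_
      filter_upwards [hgK, hv] with q hq1 hq2 hqb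
      have hqs' : q ∈ strip τ := ball_subset_strip (ε := ε) (p := p)
        (by simp only [hp]; linarith [hs.1]) (by simp only [hp]; linarith [hs.2])
        (Metric.ball_subset_closedBall hqb)
      have hd1 : |s - q.1| ≤ ε := by
        rw [← Real.dist_eq, dist_comm]; exact (le_max_left _ _).trans (Metric.mem_ball.1 hqb).le
      have hd2 : |posFlow X s a - q.2| ≤ ε := by
        rw [← Real.dist_eq, dist_comm]; exact (le_max_right _ _).trans (Metric.mem_ball.1 hqb).le
      have hq1τ : q.1 ≤ τ := (EReal.coe_lt_coe_iff.1 hqs'.2).le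
      have e2 := hlip q.1 s (posFlow X s a) q.2 hq1τ (by linarith [hs.2])
      have e3 := mul_le_mul_of_nonneg_left (add_le_add hd1 hd2) hΛ
      have e4 : B * Real.exp (l * q.1) ≤ B * Real.exp (l * (s + ε)) := by
        refine mul_le_mul_of_nonneg_left (Real.exp_le_exp.2 ?_) hB
        refine mul_le_mul_of_nonneg_left ?_ hl.le
        linarith [(abs_le.1 hd1).1]
      have e5 : |vp - v' q| ≤ Λ * (2 * ε) + B * Real.exp (l * (s + ε)) := by
        have := abs_sub_le vp (eulVel V κ r u X q.1 q.2) (v' q)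
        have := hq2 hqs'
        linarith
      rw [abs_mul, mul_comm]
      exact mul_le_mul (hq1 hqs') e5 (abs_nonneg _) hK
    have hmain := image_norm_le_of_norm_deriv_right_le_deriv_boundary
      (f := fun s => moll n F (s, posFlow X s a) - moll n F (2 * ε, posFlow X (2 * ε) a))
      (a := 2 * ε) (b := t)
      (B := fun s => K * (Λ * (2 * ε) * s + B / l * Real.exp (l * (s + ε))))
      (B' := fun s => K * (Λ * (2 * ε) + B * Real.exp (l * (s + ε))))
      (fun s hs => ((hder s hs).sub_const _).continuousAt.continuousWithinAt)
      (fun s hs => ((hder s ⟨hs.1, hs.2.le⟩).sub_const _).hasDerivWithinAt)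
      (by
        simp only [sub_self, norm_zero]
        refine mul_nonneg hK (add_nonneg (by positivity) (by positivity)))
      (fun s => by
        have e1 : HasDerivAt (fun s => l * (s + ε)) l s := by
          simpa using ((hasDerivAt_id s).add_const ε).const_mul l
        have e2 := (e1.exp.const_mul (B / l))
        have e3 := ((hasDerivAt_id s).const_mul (Λ * (2 * ε))).add e2
        have e4 := e3.const_mul K
        convert! e4 using 1
        field_simp)
      (fun s hs => hdbound s ⟨hs.1, hs.2.le⟩) (right_mem_Icc.2 hn1.le)
    rw [Real.norm_eq_abs, hax] at hmain
    -- The mollifier sees times up to `3 * ε`, and positions within `ε` of the particle, which has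
    -- moved by at most `C₁ * (2 * ε)` from `a`.
    have hinit : |moll n F (2 * ε, posFlow X (2 * ε) a) - W a|
        ≤ K₁ * (3 * ε) + M * (ε + C₁ * (2 * ε)) := by
      refine abs_moll_sub_le hF ?_
      filter_upwards [hF0] with q hq1 hqb
      have hqs' : q ∈ strip τ := ball_subset_strip (ε := ε) (p := (2 * ε, posFlow X (2 * ε) a))
        (by simp only; linarith) (by simp only; linarith) (Metric.ball_subset_closedBall hqb)
      have hd1 : |q.1 - 2 * ε| ≤ ε := by
        rw [← Real.dist_eq]; exact (le_max_left _ _).trans (Metric.mem_ball.1 hqb).le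
      have hd2 : |q.2 - posFlow X (2 * ε) a| ≤ ε := by
        rw [← Real.dist_eq]; exact (le_max_right _ _).trans (Metric.mem_ball.1 hqb).le
      have hd3 := S.abs_posFlow_sub_le hX (2 * ε) a
      rw [abs_of_pos (by linarith : 0 < 2 * ε)] at hd3
      have e1 := hq1 hqs'
      have e2 : K₁ * q.1 ≤ K₁ * (3 * ε) :=
        mul_le_mul_of_nonneg_left (by linarith [(abs_le.1 hd1).2]) hK₁
      have e3 : |q.2 - a| ≤ ε + C₁ * (2 * ε) := by
        have := abs_sub_le q.2 (posFlow X (2 * ε) a) a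
        linarith
      have e4 := (hW q.2 a).trans (mul_le_mul_of_nonneg_left e3 hM)
      have := abs_sub_le (F q) (W q.2) (W a)
      linarith
    have := abs_sub_le (moll n F (t, x)) (moll n F (2 * ε, posFlow X (2 * ε) a)) (W a)
    linarith
  have hlim : Tendsto (fun n => K * (Λ * (2 * rad n) * t + B / l * Real.exp (l * (t + rad n)))
        + (K₁ * (3 * rad n) + M * (rad n + C₁ * (2 * rad n)))) atTop
      (𝓝 (K * (B / l * Real.exp (l * t)))) := by
    have hc : Continuous fun ε : ℝ => K * (Λ * (2 * ε) * t + B / l * Real.exp (l * (t + ε)))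
        + (K₁ * (3 * ε) + M * (ε + C₁ * (2 * ε))) := by fun_prop
    have := (hc.tendsto 0).comp tendsto_rad
    simpa [Function.comp_def] using this
  exact le_of_tendsto_of_tendsto ((hq.sub_const _).abs) hlim hbound

end LagSetup

/-- Integrate by parts. As `y ↦ κ (x - y)` decreases, its variation over the interval is `κ 0 - κ (x
- N)`, and the boundary terms add `κ 0 + κ (x - N)`. The bound `M` on the derivative only justifies
the integration by parts. -/
theorem abs_intervalIntegral_deriv_mul_kernel_le {κ : ℝ → ℝ} {L : NNReal} (hmono : Monotone κ)
    (hlip : LipschitzWith L κ) (hnn : ∀ x, 0 ≤ κ x) {f f' : ℝ → ℝ}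
    (hf : ∀ y, HasDerivAt f (f' y) y) {M δ : ℝ} (hM : ∀ y, |f' y| ≤ M) (hδ : ∀ y, |f y| ≤ δ)
    {x N : ℝ} (hxN : x ≤ N) :
    |∫ y in x..N, f' y * κ (x - y)| ≤ 2 * κ 0 * δ := by
  have hδ0 : 0 ≤ δ := (abs_nonneg _).trans (hδ 0)
  have hM0 : 0 ≤ M := (abs_nonneg _).trans (hM 0)
  set k : ℝ → ℝ := fun y => κ (x - y)
  have hklip : LipschitzWith L k := LipschitzWith.of_dist_le_mul fun y z => by
    have := hlip.dist_le_mul (x - y) (x - z)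
    rwa [dist_sub_left] at this
  have hflip : LipschitzWith ⟨M, hM0⟩ f :=
    lipschitzWith_of_nnnorm_deriv_le (fun y => (hf y).differentiableAt) fun y => by
      rw [(hf y).deriv]; exact hM y
  have hkac : AbsolutelyContinuousOnInterval k x N :=
    hklip.lipschitzOnWith.absolutelyContinuousOnInterval
  have hfac : AbsolutelyContinuousOnInterval f x N :=
    hflip.lipschitzOnWith.absolutelyContinuousOnInterval
  have hanti : Antitone k := fun y z h => hmono (by linarith)
  have hdk : ∀ y, deriv k y ≤ 0 := fun y => by
    have : Monotone (-k) := hanti.neg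
    have h := this.deriv_nonneg (x := y)
    rw [deriv.neg] at h
    linarith
  have hparts := hkac.integral_mul_deriv_eq_deriv_mul hfac
  have e1 : ∫ y in x..N, f' y * κ (x - y) = ∫ y in x..N, k y * deriv f y := by
    refine intervalIntegral.integral_congr fun y _ => ?_
    simp only [(hf y).deriv, k]; ring
  have e2 : |∫ y in x..N, deriv k y * f y| ≤ (k x - k N) * δ := by
    have h1 := intervalIntegral.norm_integral_le_of_norm_le (f := fun y => deriv k y * f y)
      (g := fun y => -deriv k y * δ) hxN (ae_of_all _ fun y _ => by
        rw [norm_mul, Real.norm_eq_abs, Real.norm_eq_abs, abs_of_nonpos (hdk y)]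
        exact mul_le_mul_of_nonneg_left (hδ y) (by linarith [hdk y]))
      ((hkac.intervalIntegrable_deriv.neg).mul_const δ)
    rw [intervalIntegral.integral_mul_const, intervalIntegral.integral_neg,
      hkac.integral_deriv_eq_sub, neg_sub, Real.norm_eq_abs] at h1
    exact h1
  have hkN : 0 ≤ k N := hnn _
  have hkx : k x = κ 0 := by simp [k]
  have e3 : |k N * f N| ≤ k N * δ := by
    rw [abs_mul, abs_of_nonneg hkN]; exact mul_le_mul_of_nonneg_left (hδ N) hkN
  have e4 : |k x * f x| ≤ k x * δ := by
    rw [abs_mul, abs_of_nonneg (hnn _)]; exact mul_le_mul_of_nonneg_left (hδ x) (hnn _)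
  rw [e1, hparts]
  rw [hkx] at e2 e4 ⊢
  rw [abs_le] at e2 e3 e4 ⊢
  constructor <;> linarith [e2.1, e2.2, e3.1, e3.2, e4.1, e4.2]

theorem abs_integral_Ioi_deriv_mul_kernel_le {κ : ℝ → ℝ} {L : NNReal} (hmono : Monotone κ)
    (hlip : LipschitzWith L κ) (hnn : ∀ x, 0 ≤ κ x) {f f' : ℝ → ℝ} (hf'c : Continuous f')
    (hf : ∀ y, HasDerivAt f (f' y) y) {M δ : ℝ} (hM : ∀ y, |f' y| ≤ M) (hδ : ∀ y, |f y| ≤ δ)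
    {x : ℝ} (hint : IntegrableOn (fun y => κ (x - y)) (Ioi x)) :
    |∫ y in Ioi x, f' y * κ (x - y)| ≤ 2 * κ 0 * δ := by
  have hi : IntegrableOn (fun y => f' y * κ (x - y)) (Ioi x) :=
    Integrable.bdd_mul (c := M) hint hf'c.aestronglyMeasurable (ae_of_all _ hM)
  have hlim := intervalIntegral_tendsto_integral_Ioi x hi tendsto_id
  refine le_of_tendsto hlim.abs ?_
  filter_upwards [eventually_ge_atTop x] with N hN
  exact abs_intervalIntegral_deriv_mul_kernel_le hmono hlip hnn hf hM hδ hN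

/-- The look-ahead average of a weak `x`-derivative is controlled by the primitive. -/
theorem kernel_stability {κ : ℝ → ℝ} {L : NNReal} (hmono : Monotone κ)
    (hlip : LipschitzWith L κ) (hnn : ∀ x, 0 ≤ κ x)
    (hint : ∀ x, IntegrableOn (fun y => κ (x - y)) (Ioi x)) {τ M δ l : ℝ} (hδ : 0 ≤ δ)
    (hl : 0 ≤ l) {D R : ℝ × ℝ → ℝ} (hD : LocallyIntegrable D) (hR : LocallyIntegrable R)
    (h : WeakDeriv τ D R (0, 1)) (hRM : ∀ᵐ q, |R q| ≤ M)
    (hDδ : ∀ᵐ q : ℝ × ℝ, q ∈ strip τ → |D q| ≤ δ * Real.exp (l * q.1)) :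
    ∀ᵐ t : ℝ, t ∈ Ioo 0 τ → ∀ x,
      |∫ y in Ioi x, R (t, y) * κ (x - y)| ≤ 2 * κ 0 * (δ * Real.exp (l * t)) := by
  -- Fubini's theorem selects times at which the mollified densities converge for almost every `y`.
  -- At such a time, dominated convergence handles every `x` at once.
  have hae := ae_tendsto_moll hR
  rw [Measure.volume_eq_prod] at hae
  filter_upwards [Measure.ae_ae_of_ae_prod hae] with t ht htτ x
  have hsmall : ∀ᶠ n in atTop, rad n < t ∧ t + rad n < τ := by
    have h1 : ∀ᶠ n in atTop, rad n < t := tendsto_rad.eventually (gt_mem_nhds htτ.1)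
    have h2 : ∀ᶠ n in atTop, rad n < τ - t :=
      tendsto_rad.eventually (gt_mem_nhds (by linarith [htτ.2]))
    filter_upwards [h1, h2] with n hn1 hn2
    exact ⟨hn1, by linarith⟩
  have hRn : ∀ n y, |moll n R (t, y)| ≤ M := fun n y => by
    refine abs_moll_le ?_
    filter_upwards [hRM] with q hq _ using hq
  have hcont : ∀ n, Continuous fun y => moll n R (t, y) := fun n =>
    (contDiff_moll hR n).continuous.comp (continuous_const.prodMk continuous_id)
  have hlim : Tendsto (fun n => ∫ y in Ioi x, moll n R (t, y) * κ (x - y)) atTop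
      (𝓝 (∫ y in Ioi x, R (t, y) * κ (x - y))) := by
    refine tendsto_integral_of_dominated_convergence (fun y => M * κ (x - y)) (fun n => ?_)
      ((hint x).const_mul M) (fun n => ae_of_all _ fun y => ?_) ?_
    · exact ((hcont n).mul (hlip.continuous.comp
        (continuous_const.sub continuous_id))).aestronglyMeasurable
    · rw [norm_mul, Real.norm_eq_abs, Real.norm_eq_abs, abs_of_nonneg (hnn _)]
      exact mul_le_mul_of_nonneg_right (hRn n y) (hnn _)
    · filter_upwards [ae_restrict_of_ae ht] with y hy
      exact hy.mul_const _
  have hlim2 : Tendsto (fun n => 2 * κ 0 * (δ * Real.exp (l * (t + rad n)))) atTop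
      (𝓝 (2 * κ 0 * (δ * Real.exp (l * t)))) := by
    have hc : Continuous fun ε : ℝ => 2 * κ 0 * (δ * Real.exp (l * (t + ε))) := by fun_prop
    have := (hc.tendsto 0).comp tendsto_rad
    simpa [Function.comp_def] using this
  refine le_of_tendsto_of_tendsto hlim.abs hlim2 ?_
  filter_upwards [hsmall] with n hn
  refine abs_integral_Ioi_deriv_mul_kernel_le hmono hlip hnn (hcont n)
    (f := fun y => moll n D (t, y)) (fun y => ?_) (hRn n) (fun y => abs_moll_le ?_) (hint x)
  · have := hasDerivAt_snd (contDiff_moll hD n) t y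
    rwa [dx, fderiv_moll hD h hn.1 hn.2] at this
  · filter_upwards [hDδ] with q hq hqb
    have hqs : q ∈ strip τ := ball_subset_strip (p := (t, y)) hn.1 hn.2
      (Metric.ball_subset_closedBall hqb)
    refine (hq hqs).trans (mul_le_mul_of_nonneg_left (Real.exp_le_exp.2 ?_) hδ)
    have hd1 : |q.1 - t| ≤ rad n := by
      rw [← Real.dist_eq]; exact (le_max_left _ _).trans (Metric.mem_ball.1 hqb).le
    exact mul_le_mul_of_nonneg_left (by linarith [(abs_le.1 hd1).2]) hl

/-! ### Primitives in time -/

/-- The primitive in time that vanishes for large times. -/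
def timePrim (φ : ℝ × ℝ → ℝ) (p : ℝ × ℝ) : ℝ := -∫ s in Ioi p.1, φ (s, p.2)

section TimePrim

variable {φ : ℝ × ℝ → ℝ}

theorem hasCompactSupport_slice_fst (hc : HasCompactSupport φ) (x : ℝ) :
    HasCompactSupport fun t => φ (t, x) := by
  obtain ⟨N, hN, hs⟩ := exists_support_bound hc
  refine HasCompactSupport.of_support_subset_isCompact (isCompact_Icc (a := -N) (b := N))
    fun t ht => ?_
  have h1 : |t| ≤ N := by
    by_contra! hlt; exact ht (hs _ _ (Or.inl hlt))
  exact abs_le.1 h1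

theorem hasCompactSupport_slice_snd (hc : HasCompactSupport φ) (t : ℝ) :
    HasCompactSupport fun x => φ (t, x) := by
  obtain ⟨N, hN, hs⟩ := exists_support_bound hc
  refine HasCompactSupport.of_support_subset_isCompact (isCompact_Icc (a := -N) (b := N))
    fun x hx => ?_
  have h1 : |x| ≤ N := by
    by_contra! hlt; exact hx (hs _ _ (Or.inr hlt))
  exact abs_le.1 h1

theorem integrable_slice_fst (hφ : Continuous φ) (hc : HasCompactSupport φ) (x : ℝ) :
    Integrable fun t => φ (t, x) :=
  (hφ.comp (continuous_id.prodMk continuous_const)).integrable_of_hasCompactSupport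
    (hasCompactSupport_slice_fst hc x)

/-- Up to sign, the primitive is a convolution in time with the indicator of the negative half line,
the position being a parameter; smoothness passes from the compactly supported factor. -/
theorem contDiff_timePrim (hφ : ContDiff ℝ ∞ φ) (hc : HasCompactSupport φ) :
    ContDiff ℝ ∞ (timePrim φ) := by
  obtain ⟨N, hN, hs⟩ := exists_support_bound hc
  have hloc : LocallyIntegrable ((Iio (0 : ℝ)).indicator fun _ => (1 : ℝ)) :=
    (locallyIntegrable_const (1 : ℝ)).indicator measurableSet_Iio
  have h := contDiffOn_convolution_right_with_param (μ := (volume : Measure ℝ)) (n := ⊤)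
    (ContinuousLinearMap.lsmul ℝ ℝ) (g := fun x t : ℝ => φ (t, x)) (s := univ) (k := Icc (-N) N)
    isOpen_univ isCompact_Icc (fun x t _ ht => by
      refine hs t x (Or.inl ?_)
      by_contra! hle
      exact ht (abs_le.1 hle)) hloc
    (by
      refine ContDiff.contDiffOn ?_
      exact hφ.comp (contDiff_snd.prodMk contDiff_fst))
  rw [univ_prod_univ, contDiffOn_univ] at h
  have h2 := (h.comp (contDiff_snd.prodMk contDiff_fst : ContDiff ℝ ∞ fun p : ℝ × ℝ =>
    (p.2, p.1))).neg
  convert! h2 using 1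
  funext p
  simp only [timePrim, Function.comp]
  rw [convolution_eq_swap, ← integral_indicator measurableSet_Ioi]
  congr 1
  refine integral_congr_ae (ae_of_all _ fun s => ?_)
  by_cases hsp : p.1 < s
  · have h3 : p.1 - s ∈ Iio (0 : ℝ) := sub_neg.2 hsp
    simp [indicator_of_mem (show s ∈ Ioi p.1 from hsp), indicator_of_mem h3]
  · have h3 : p.1 - s ∉ Iio (0 : ℝ) := fun h => hsp (sub_neg.1 h)
    simp [indicator_of_notMem (show s ∉ Ioi p.1 from hsp), indicator_of_notMem h3]

theorem dt_timePrim (hφ : ContDiff ℝ ∞ φ) (hc : HasCompactSupport φ) (p : ℝ × ℝ) :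
    dt (timePrim φ) p = φ p := by
  have h1 := hasDerivAt_fst (contDiff_timePrim hφ hc) p.1 p.2
  have hcs : Continuous fun s => φ (s, p.2) :=
    hφ.continuous.comp (continuous_id.prodMk continuous_const)
  have hint := integrable_slice_fst hφ.continuous hc p.2
  have h2 : HasDerivAt (fun t => timePrim φ (t, p.2)) (φ (p.1, p.2)) p.1 := by
    have heq : (fun t => timePrim φ (t, p.2))
        = fun t => (∫ s in (0 : ℝ)..t, φ (s, p.2)) - ∫ s in Ioi (0 : ℝ), φ (s, p.2) := by
      funext t
      have := intervalIntegral.integral_interval_add_Ioi (a := 0) (b := t)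
        hint.integrableOn hint.integrableOn
      simp only [timePrim]; linarith
    rw [heq]
    exact (hcs.integral_hasStrictDerivAt 0 p.1).hasDerivAt.sub_const _
  exact h1.unique h2

theorem dx_timePrim (hφ : ContDiff ℝ ∞ φ) (hc : HasCompactSupport φ) (p : ℝ × ℝ) :
    dx (timePrim φ) p = timePrim (dx φ) p := by
  have h1 := hasDerivAt_snd (contDiff_timePrim hφ hc) p.1 p.2
  obtain ⟨N, hN, hs⟩ := exists_support_bound (hasCompactSupport_dx hc)
  obtain ⟨C, hC⟩ := (contDiff_dx hφ).continuous.bounded_above_of_compact_support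
    (hasCompactSupport_dx hc)
  have h2 := hasDerivAt_integral_of_dominated_loc_of_deriv_le
    (μ := volume.restrict (Ioi p.1)) (F := fun x s => φ (s, x)) (F' := fun x s => dx φ (s, x))
    (x₀ := p.2) (s := univ) (bound := (Icc (-N) N).indicator fun _ => C) univ_mem
    (Eventually.of_forall fun x =>
      (hφ.continuous.comp (continuous_id.prodMk continuous_const)).aestronglyMeasurable)
    (integrable_slice_fst hφ.continuous hc p.2).integrableOn
    (((contDiff_dx hφ).continuous.comp (continuous_id.prodMk continuous_const)).aestronglyMeasurable)
    (ae_of_all _ fun s x _ => by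
      by_cases h : s ∈ Icc (-N) N
      · rw [indicator_of_mem h]; exact hC _
      · rw [indicator_of_notMem h, hs s x (Or.inl _), norm_zero]
        by_contra! hle
        exact h (abs_le.1 hle))
    (((integrable_indicator_iff measurableSet_Icc).2 (by simp)).integrableOn)
    (ae_of_all _ fun s x _ => hasDerivAt_snd hφ s x)
  exact h1.unique h2.2.neg

theorem timePrim_eq_zero {τ' : ℝ} (h : ∀ t x, τ' < t → φ (t, x) = 0) {p : ℝ × ℝ}
    (hp : τ' ≤ p.1) : timePrim φ p = 0 := by
  have h0 : ∫ s in Ioi p.1, φ (s, p.2) = 0 :=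
    setIntegral_eq_zero_of_forall_eq_zero fun s hs => h s p.2 (hp.trans_lt hs)
  rw [timePrim, h0, neg_zero]

theorem exists_time_bound {τ : ℝ} (hτ : 0 < τ) (hc : HasCompactSupport φ)
    (hs : tsupport φ ⊆ strip τ) : ∃ τ' < τ, 0 < τ' ∧ ∀ t x, τ' < t → φ (t, x) = 0 := by
  rcases (tsupport φ).eq_empty_or_nonempty with he | hne
  · refine ⟨τ / 2, by linarith, by linarith, fun t x _ => ?_⟩
    have : φ = 0 := tsupport_eq_empty_iff.1 he
    simp [this]
  · obtain ⟨q, hq, hmax⟩ := hc.isCompact.exists_isMaxOn hne continuous_fst.continuousOn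
    refine ⟨q.1, EReal.coe_lt_coe_iff.1 (hs hq).2, (hs hq).1, fun t x ht => ?_⟩
    by_contra hcon
    exact absurd (hmax (subset_tsupport φ hcon)) (not_le.2 ht)

theorem eq_zero_of_nonpos {τ : ℝ} (hs : tsupport φ ⊆ strip τ) {t : ℝ} (ht : t ≤ 0) (x : ℝ) :
    φ (t, x) = 0 := by
  by_contra hcon
  exact absurd (hs (subset_tsupport φ hcon)).1 (not_lt.2 ht)

/-- An admissible test function which is, for nonnegative times, the primitive of a given one. -/
theorem exists_test_timePrim {τ : ℝ} (hτ : 0 < τ) (hφ : ContDiff ℝ ∞ φ) (hc : HasCompactSupport φ)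
    (hs : tsupport φ ⊆ strip τ) : ∃ θ : ℝ × ℝ → ℝ, IsTest τ θ ∧ ∀ p : ℝ × ℝ, 0 ≤ p.1 →
      θ p = timePrim φ p ∧ dt θ p = φ p ∧ dx θ p = timePrim (dx φ) p := by
  obtain ⟨τ', hτ', hτ'0, hz⟩ := exists_time_bound hτ hc hs
  obtain ⟨N, hN, hsupp⟩ := exists_support_bound hc
  -- The primitive does not vanish for very negative times. The cutoff is `0` up to time `-2` and
  -- `1` from time `-1` on, which restores compact support and leaves a neighbourhood of the
  -- nonnegative times untouched.
  set θ : ℝ × ℝ → ℝ := fun p => Real.smoothTransition (p.1 + 2) * timePrim φ p with hθ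
  have hsub : Function.support θ ⊆ Icc (-2) τ' ×ˢ Icc (-N) N := by
    intro p hp
    have hp1 : Real.smoothTransition (p.1 + 2) ≠ 0 := left_ne_zero_of_mul hp
    have hp2 : timePrim φ p ≠ 0 := right_ne_zero_of_mul hp
    refine ⟨⟨?_, ?_⟩, ?_⟩
    · by_contra! h; exact hp1 (Real.smoothTransition.zero_of_nonpos (by linarith))
    · by_contra! h; exact hp2 (timePrim_eq_zero hz h.le)
    · refine abs_le.1 ?_
      by_contra! h
      refine hp2 ?_
      rw [timePrim, setIntegral_eq_zero_of_forall_eq_zero fun s _ => hsupp s p.2 (Or.inr h),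
        neg_zero]
  have hK : IsCompact (Icc (-2) τ' ×ˢ Icc (-N) N) := isCompact_Icc.prod isCompact_Icc
  refine ⟨θ, ⟨?_, HasCompactSupport.of_support_subset_isCompact hK hsub, ?_⟩, ?_⟩
  · exact (Real.smoothTransition.contDiff.comp (contDiff_fst.add contDiff_const)).mul
      (contDiff_timePrim hφ hc)
  · intro p hp
    have := closure_minimal hsub hK.isClosed hp
    exact EReal.coe_lt_coe_iff.2 (this.1.2.trans_lt hτ')
  · intro p hp
    have hev : θ =ᶠ[𝓝 p] timePrim φ := by
      have : ∀ᶠ q : ℝ × ℝ in 𝓝 p, -1 < q.1 :=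
        continuous_fst.continuousAt.eventually (lt_mem_nhds (by linarith))
      filter_upwards [this] with q hq
      simp only [hθ]
      rw [Real.smoothTransition.one_of_one_le (by linarith), one_mul]
    refine ⟨hev.self_of_nhds, ?_, ?_⟩
    · rw [dt, hev.fderiv_eq]; exact dt_timePrim hφ hc p
    · rw [dx, hev.fderiv_eq]; exact dx_timePrim hφ hc p

end TimePrim

/-- The primitive in time of a bounded function, with a given initial datum. -/
def timeInt (w : ℝ → ℝ) (h : ℝ × ℝ → ℝ) (p : ℝ × ℝ) : ℝ := w p.2 - ∫ s in Ioc 0 p.1, h (s, p.2)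

theorem measurable_timeInt {w : ℝ → ℝ} {h : ℝ × ℝ → ℝ} (hw : Measurable w) (hh : Measurable h) :
    Measurable (timeInt w h) := by
  have hset : MeasurableSet {q : (ℝ × ℝ) × ℝ | 0 < q.2 ∧ q.2 ≤ q.1.1} :=
    (measurableSet_lt measurable_const measurable_snd).inter
      (measurableSet_le measurable_snd measurable_fst.fst)
  have h1 : StronglyMeasurable
      ({q : (ℝ × ℝ) × ℝ | 0 < q.2 ∧ q.2 ≤ q.1.1}.indicator fun q => h (q.2, q.1.2)) :=
    ((hh.comp (measurable_snd.prodMk measurable_fst.snd)).indicator hset).stronglyMeasurable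
  have h2 := h1.integral_prod_right' (ν := (volume : Measure ℝ))
  have h3 : timeInt w h = fun p => w p.2 - ∫ s, ({q : (ℝ × ℝ) × ℝ | 0 < q.2 ∧ q.2 ≤ q.1.1}.indicator
      fun q => h (q.2, q.1.2)) (p, s) := by
    funext p
    rw [timeInt, ← integral_indicator measurableSet_Ioc]
    rfl
  rw [h3]
  exact (hw.comp measurable_snd).sub h2.measurable

theorem abs_timeInt_sub_le {w : ℝ → ℝ} {h : ℝ × ℝ → ℝ} {M : ℝ} (hM : ∀ p, |h p| ≤ M)
    {p : ℝ × ℝ} (hp : 0 ≤ p.1) : |timeInt w h p - w p.2| ≤ M * p.1 := by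
  have := norm_setIntegral_le_of_norm_le_const (μ := volume) (s := Ioc 0 p.1)
    (f := fun s => h (s, p.2)) (C := M) (by simp) (fun s _ => hM _)
  rw [timeInt, sub_sub_cancel_left, abs_neg]
  simpa [hp] using this

theorem abs_timeInt_le {w : ℝ → ℝ} {h : ℝ × ℝ → ℝ} {M : ℝ} (hM : ∀ p, |h p| ≤ M)
    (p : ℝ × ℝ) : |timeInt w h p| ≤ |w p.2| + M * |p.1| := by
  have hM0 : 0 ≤ M := (abs_nonneg _).trans (hM 0)
  rcases le_total 0 p.1 with hp | hp
  · have h1 := abs_timeInt_sub_le (w := w) hM hp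
    have h2 := abs_sub_abs_le_abs_sub (timeInt w h p) (w p.2)
    rw [abs_of_nonneg hp]; linarith
  · rw [timeInt, Ioc_eq_empty (not_lt.2 hp)]
    have : 0 ≤ M * |p.1| := mul_nonneg hM0 (abs_nonneg _)
    simpa using this

theorem locallyIntegrable_timeInt {w : ℝ → ℝ} {h : ℝ × ℝ → ℝ} (hw : Continuous w)
    (hh : Measurable h) {M : ℝ} (hM : ∀ p, |h p| ≤ M) : LocallyIntegrable (timeInt w h) := by
  have hM0 : 0 ≤ M := (abs_nonneg _).trans (hM 0)
  have hc : Continuous fun p : ℝ × ℝ => |w p.2| + M * |p.1| := by fun_prop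
  refine hc.locallyIntegrable.mono (measurable_timeInt hw.measurable hh).aestronglyMeasurable
    (ae_of_all _ fun p => ?_)
  rw [Real.norm_eq_abs, Real.norm_eq_abs]
  exact (abs_timeInt_le hM p).trans (le_abs_self _)

theorem locallyIntegrable_of_abs_le {h : ℝ × ℝ → ℝ} (hh : Measurable h) {M : ℝ}
    (hM : ∀ p, |h p| ≤ M) : LocallyIntegrable h :=
  (locallyIntegrable_const M).mono hh.aestronglyMeasurable (ae_of_all _ fun p =>
    (hM p).trans (le_abs_self _))

theorem LocallyIntegrable.integrable_mul_test {F φ : ℝ × ℝ → ℝ} (hF : LocallyIntegrable F)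
    (hφ : Continuous φ) (hc : HasCompactSupport φ) : Integrable fun p => F p * φ p := by
  have := hF.integrable_smul_left_of_hasCompactSupport hφ hc
  simpa only [smul_eq_mul, mul_comm] using this

/-- Integration by parts in time. -/
theorem integral_timeInt_mul {w : ℝ → ℝ} {h : ℝ × ℝ → ℝ} (hw : Continuous w)
    (hh : Measurable h) {M : ℝ} (hM : ∀ p, |h p| ≤ M) (h0 : ∀ p : ℝ × ℝ, p.1 ≤ 0 → h p = 0)
    {φ θ : ℝ × ℝ → ℝ} (hφ : Continuous φ) (hc : HasCompactSupport φ)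
    (hφ0 : ∀ t x, t ≤ 0 → φ (t, x) = 0) (hθ : Continuous θ) (hθc : HasCompactSupport θ)
    (hθφ : ∀ p : ℝ × ℝ, 0 ≤ p.1 → θ p = timePrim φ p) :
    ∫ p, timeInt w h p * φ p = (∫ p, h p * θ p) - ∫ x, w x * θ (0, x) := by
  have hi1 : Integrable (fun p => timeInt w h p * φ p) ((volume : Measure ℝ).prod volume) :=
    LocallyIntegrable.integrable_mul_test (locallyIntegrable_timeInt hw hh hM) hφ hc
  have hi2 : Integrable (fun p => h p * θ p) ((volume : Measure ℝ).prod volume) :=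
    LocallyIntegrable.integrable_mul_test (locallyIntegrable_of_abs_le hh hM) hθ hθc
  have hi3 : Integrable fun x => w x * θ (0, x) :=
    (hw.mul (hθ.comp (continuous_const.prodMk continuous_id))).integrable_of_hasCompactSupport
      (hasCompactSupport_slice_snd hθc 0).mul_left
  obtain ⟨N, hN, hsupp⟩ := exists_support_bound hc
  rw [Measure.volume_eq_prod, integral_prod_symm _ hi1, integral_prod_symm _ hi2,
    ← integral_sub hi2.integral_prod_right hi3]
  refine integral_congr_ae (ae_of_all _ fun x => ?_)
  have hφx := integrable_slice_fst hφ hc x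
  have e0 : ∫ t, φ (t, x) = -θ (0, x) := by
    rw [hθφ (0, x) le_rfl, timePrim, neg_neg]
    refine (setIntegral_eq_integral_of_forall_compl_eq_zero fun t ht => hφ0 t x ?_).symm
    simpa using ht
  -- The double integral runs over the triangle `0 < s ≤ t`; exchanging the order produces the
  -- integral of `φ` beyond `s`, that is, `-timePrim φ`.
  set k : ℝ → ℝ → ℝ := fun t s => (Ioc 0 t).indicator (fun s => h (s, x)) s * φ (t, x) with hk
  have hkm : Measurable (Function.uncurry k) := by
    have hset : MeasurableSet {q : ℝ × ℝ | 0 < q.2 ∧ q.2 ≤ q.1} :=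
      (measurableSet_lt measurable_const measurable_snd).inter
        (measurableSet_le measurable_snd measurable_fst)
    exact ((hh.comp (measurable_snd.prodMk measurable_const)).indicator hset).mul
      (hφ.measurable.comp (measurable_fst.prodMk measurable_const))
  have hki : Integrable (Function.uncurry k) ((volume : Measure ℝ).prod volume) := by
    have hdom : Integrable (fun q : ℝ × ℝ => ‖φ (q.1, x)‖ * (Icc 0 N).indicator (fun _ => M) q.2)
        ((volume : Measure ℝ).prod volume) :=
      hφx.norm.mul_prod ((integrable_indicator_iff measurableSet_Icc).2 (by simp))
    refine hdom.mono' hkm.aestronglyMeasurable (ae_of_all _ fun q => ?_)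
    obtain ⟨t, s⟩ := q
    have hMn : 0 ≤ M := (abs_nonneg _).trans (hM 0)
    simp only [Function.uncurry, hk]
    rw [norm_mul, mul_comm]
    by_cases hφt : φ (t, x) = 0
    · simp [hφt]
    refine mul_le_mul_of_nonneg_left ?_ (norm_nonneg _)
    have htN : |t| ≤ N := by
      by_contra! hlt; exact hφt (hsupp _ _ (Or.inl hlt))
    by_cases hs : s ∈ Ioc 0 t
    · have hs' : s ∈ Icc 0 N := ⟨hs.1.le, hs.2.trans ((le_abs_self t).trans htN)⟩
      rw [indicator_of_mem hs, indicator_of_mem hs']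
      exact hM _
    · rw [indicator_of_notMem hs, norm_zero]
      exact indicator_nonneg (fun _ _ => hMn) _
  have e1 : ∫ t, (∫ s in Ioc 0 t, h (s, x)) * φ (t, x) = -∫ s, h (s, x) * θ (s, x) := by
    have a1 : ∀ t, (∫ s in Ioc 0 t, h (s, x)) * φ (t, x) = ∫ s, k t s := fun t => by
      rw [← integral_indicator measurableSet_Ioc, ← integral_mul_const]
    simp_rw [a1]
    rw [integral_integral_swap hki, ← integral_neg]
    refine integral_congr_ae (ae_of_all _ fun s => ?_)
    simp only
    rcases le_or_gt s 0 with hs | hs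
    · have : ∀ t, k t s = 0 := fun t => by
        simp only [hk]
        rw [indicator_of_notMem (fun hmem => absurd hmem.1 (not_lt.2 hs)), zero_mul]
      simp [this, h0 (s, x) hs]
    · have : ∀ t, k t s = h (s, x) * (Ici s).indicator (fun t => φ (t, x)) t := fun t => by
        simp only [hk]
        by_cases hts : s ≤ t
        · rw [indicator_of_mem (show s ∈ Ioc 0 t from ⟨hs, hts⟩),
            indicator_of_mem (show t ∈ Ici s from hts)]
        · rw [indicator_of_notMem (fun hmem => hts hmem.2),
            indicator_of_notMem (show t ∉ Ici s from hts), zero_mul, mul_zero]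
      simp_rw [this]
      rw [integral_const_mul, integral_indicator measurableSet_Ici, integral_Ici_eq_integral_Ioi,
        hθφ (s, x) hs.le, timePrim]
      ring
  have hi4 : Integrable fun t => (∫ s in Ioc 0 t, h (s, x)) * φ (t, x) := by
    have := hki.integral_prod_left
    refine this.congr (ae_of_all _ fun t => ?_)
    simp only [Function.uncurry, hk]
    rw [integral_mul_const, integral_indicator measurableSet_Ioc]
  simp only [timeInt, sub_mul]
  rw [integral_sub (hφx.const_mul _) hi4, integral_const_mul, e0, e1]
  ring

/-- The fundamental lemma of the calculus of variations on a strip. -/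
theorem ae_eq_of_forall_test {τ : ℝ} {F G : ℝ × ℝ → ℝ} (hF : LocallyIntegrable F)
    (hG : LocallyIntegrable G)
    (h : ∀ φ : ℝ × ℝ → ℝ, ContDiff ℝ ∞ φ → HasCompactSupport φ → tsupport φ ⊆ strip τ →
      ∫ p, F p * φ p = ∫ p, G p * φ p) : ∀ᵐ p, p ∈ strip τ → F p = G p := by
  have := (isOpen_strip (τ : EReal)).ae_eq_zero_of_integral_contDiff_smul_eq_zero (μ := volume)
    (f := fun p => F p - G p) ((hF.sub hG).locallyIntegrableOn _) (fun φ hφ hc hs => by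
      have h1 := LocallyIntegrable.integrable_mul_test hF hφ.continuous hc
      have h2 := LocallyIntegrable.integrable_mul_test hG hφ.continuous hc
      have h3 : ∫ p, φ p • (F p - G p) = ∫ p, (F p * φ p - G p * φ p) :=
        integral_congr_ae (ae_of_all _ fun p => by simp only [smul_eq_mul]; ring)
      rw [h3, integral_sub h1 h2, h φ hφ hc hs, sub_self])
  filter_upwards [this] with p hp hps
  exact sub_eq_zero.1 (hp hps)

/-! ### Measurable representatives and calculus on slices -/

theorem ae_ae_of_ae_strip {τ : ℝ} {P : ℝ × ℝ → Prop} (h : ∀ᵐ p, p ∈ strip τ → P p) :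
    ∀ᵐ t : ℝ, t ∈ Ioo 0 τ → ∀ᵐ x : ℝ, P (t, x) := by
  rw [Measure.volume_eq_prod] at h
  filter_upwards [Measure.ae_ae_of_ae_prod h] with t ht hts
  filter_upwards [ht] with x hx
  refine hx ?_
  rw [strip_coe]
  exact ⟨hts, mem_univ _⟩

theorem ae_strip_of_ae {τ : ℝ} {P : ℝ → Prop} (h : ∀ᵐ t : ℝ, t ∈ Ioo 0 τ → P t) :
    ∀ᵐ p : ℝ × ℝ, p ∈ strip τ → P p.1 := by
  filter_upwards [Measure.quasiMeasurePreserving_fst.ae h] with p hp hps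
  rw [strip_coe] at hps
  exact hp hps.1

theorem exists_measurable_rep {τ M : ℝ} (hM : 0 ≤ M) {h : ℝ × ℝ → ℝ}
    (hm : AEStronglyMeasurable h (volume.restrict (strip τ)))
    (hb : ∀ᵐ p ∂(volume.restrict (strip τ)), |h p| ≤ M) :
    ∃ g : ℝ × ℝ → ℝ, Measurable g ∧ (∀ p, |g p| ≤ M) ∧ (∀ p, p ∉ strip τ → g p = 0) ∧
      ∀ᵐ p, p ∈ strip τ → g p = h p := by
  have hms := measurableSet_strip τ
  refine ⟨(strip τ).indicator fun p => max (-M) (min M (hm.mk h p)), ?_, fun p => ?_,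
    fun p hp => indicator_of_notMem hp _, ?_⟩
  · exact (measurable_const.max (measurable_const.min hm.stronglyMeasurable_mk.measurable)).indicator
      hms
  · by_cases hp : p ∈ strip τ
    · rw [indicator_of_mem hp, abs_le]
      exact ⟨le_max_left _ _, max_le (by linarith) (min_le_left _ _)⟩
    · rw [indicator_of_notMem hp, abs_zero]; exact hM
  · filter_upwards [(ae_restrict_iff' hms).1 hm.ae_eq_mk, (ae_restrict_iff' hms).1 hb] with p h1 h2 hp
    rw [indicator_of_mem hp, ← h1 hp, min_eq_right (abs_le.1 (h2 hp)).2,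
      max_eq_right (abs_le.1 (h2 hp)).1]

/-- The look-ahead average with a kernel defined on the whole line. -/
def lookMean (κ : ℝ → ℝ) (R : ℝ × ℝ → ℝ) (p : ℝ × ℝ) : ℝ :=
  ∫ y in Ioi p.2, R (p.1, y) * κ (p.2 - y)

theorem measurable_lookMean {κ : ℝ → ℝ} (hκ : Measurable κ) {R : ℝ × ℝ → ℝ} (hR : Measurable R) :
    Measurable (lookMean κ R) := by
  have hset : MeasurableSet {q : (ℝ × ℝ) × ℝ | q.1.2 < q.2} :=
    measurableSet_lt measurable_fst.snd measurable_snd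
  have h1 : StronglyMeasurable ({q : (ℝ × ℝ) × ℝ | q.1.2 < q.2}.indicator
      fun q => R (q.1.1, q.2) * κ (q.1.2 - q.2)) :=
    (((hR.comp (measurable_fst.fst.prodMk measurable_snd)).mul
      (hκ.comp (measurable_fst.snd.sub measurable_snd))).indicator hset).stronglyMeasurable
  have h2 := h1.integral_prod_right' (ν := (volume : Measure ℝ))
  have h3 : lookMean κ R = fun p => ∫ s, ({q : (ℝ × ℝ) × ℝ | q.1.2 < q.2}.indicator
      fun q => R (q.1.1, q.2) * κ (q.1.2 - q.2)) (p, s) := by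
    funext p
    rw [lookMean, ← integral_indicator measurableSet_Ioi]
    rfl
  rw [h3]
  exact h2.measurable

theorem abs_lookMean_le {κ : ℝ → ℝ} (hnn : ∀ x, 0 ≤ κ x)
    (hint : ∀ x, IntegrableOn (fun y => κ (x - y)) (Ioi x))
    (hmass : ∀ x, ∫ y in Ioi x, κ (x - y) ≤ 1) {R : ℝ × ℝ → ℝ} {M : ℝ} (hM : ∀ p, |R p| ≤ M)
    (p : ℝ × ℝ) : |lookMean κ R p| ≤ M := by
  have hM0 : 0 ≤ M := (abs_nonneg _).trans (hM 0)
  have h := norm_integral_le_of_norm_le (f := fun y => R (p.1, y) * κ (p.2 - y))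
    ((hint p.2).const_mul M) (ae_of_all _ fun y => by
      rw [norm_mul, Real.norm_eq_abs, Real.norm_eq_abs, abs_of_nonneg (hnn _)]
      exact mul_le_mul_of_nonneg_right (hM _) (hnn _))
  rw [integral_const_mul] at h
  exact h.trans ((mul_le_mul_of_nonneg_left (hmass p.2) hM0).trans_eq (mul_one M))

/-- Modifying the density on a null set of the plane changes almost no time slice by more than a
null set, and on the other slices the averages agree at every position. -/
theorem ae_conv_eq_lookMean {η κ : ℝ → ℝ} (hη : ∀ x ≤ 0, η x = κ x) {ρ : ℝ → ℝ → ℝ}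
    {R : ℝ × ℝ → ℝ} {τ : ℝ} (h : ∀ᵐ p, p ∈ strip τ → R p = ρ p.1 p.2) :
    ∀ᵐ t : ℝ, t ∈ Ioo 0 τ → ∀ x, conv η ρ t x = lookMean κ R (t, x) := by
  filter_upwards [ae_ae_of_ae_strip h] with t ht hts x
  refine setIntegral_congr_ae measurableSet_Ioi ?_
  filter_upwards [ht hts] with y hy hxy
  rw [hy, hη _ (sub_nonpos.2 (le_of_lt hxy))]

/-- A one-dimensional mollifier. -/
def lineBump (n : ℕ) : ContDiffBump (0 : ℝ) where
  rIn := 1 / (n + 1) / 2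
  rOut := 1 / (n + 1)
  rIn_pos := by positivity
  rIn_lt_rOut := half_lt_self (by positivity)

/-- A function whose time slices are Lipschitz is, after restriction to a conull set of times,
jointly measurable. -/
theorem exists_measurable_slices {τ : ℝ} {u : ℝ → ℝ → ℝ} {P : (ℝ → ℝ) → Prop}
    (hm : AEStronglyMeasurable (Function.uncurry u) (volume.restrict (strip τ)))
    (hP : ∀ᵐ t ∂(volume.restrict (Ioo 0 τ)), P (u t)) (hcont : ∀ f, P f → Continuous f) :
    ∃ G : Set ℝ, MeasurableSet G ∧ G ⊆ Ioo 0 τ ∧ (∀ᵐ t : ℝ, t ∈ Ioo 0 τ → t ∈ G) ∧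
      (∀ t ∈ G, P (u t)) ∧ Measurable fun p : ℝ × ℝ => G.indicator (fun t => u t p.2) p.1 := by
  have hms := measurableSet_strip τ
  set w := hm.mk _
  have hw : Measurable w := hm.stronglyMeasurable_mk.measurable
  have hwu := ae_ae_of_ae_strip ((ae_restrict_iff' hms).1 hm.ae_eq_mk)
  have hgood : ∀ᵐ t : ℝ, t ∈ Ioo 0 τ → P (u t) ∧ ∀ᵐ x, u t x = w (t, x) := by
    filter_upwards [(ae_restrict_iff' measurableSet_Ioo).1 hP, hwu] with t h1 h2 ht
    exact ⟨h1 ht, h2 ht⟩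
  set N := toMeasurable volume {t : ℝ | ¬(t ∈ Ioo 0 τ → P (u t) ∧ ∀ᵐ x, u t x = w (t, x))}
  have hN0 : volume N = 0 := by rw [measure_toMeasurable]; exact hgood
  have hGgood : ∀ t ∈ Ioo 0 τ \ N, P (u t) ∧ ∀ᵐ x, u t x = w (t, x) := by
    intro t ht
    by_contra hcon
    exact ht.2 (subset_toMeasurable _ _ fun hh => hcon (hh ht.1))
  have hGm : MeasurableSet (Ioo 0 τ \ N) := measurableSet_Ioo.diff (measurableSet_toMeasurable _ _)
  refine ⟨Ioo 0 τ \ N, hGm, sdiff_subset, ?_, fun t ht => (hGgood t ht).1, ?_⟩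
  · have : ∀ᵐ t : ℝ, t ∉ N := measure_eq_zero_iff_ae_notMem.1 hN0
    filter_upwards [this] with t ht ht' using ⟨ht', ht⟩
  -- Mollifying a slice sees only its class almost everywhere, so it can be computed from the Borel
  -- representative `w`. As good slices are continuous, the mollifications converge at every point.
  set A : ℕ → ℝ × ℝ → ℝ := fun n p => (Ioo 0 τ \ N).indicator
    (fun t => ∫ y, (lineBump n).normed volume (p.2 - y) * w (t, y)) p.1 with hA
  refine measurable_of_tendsto_metrizable (f := A) (fun n => ?_) (tendsto_pi_nhds.2 fun p => ?_)
  · have h1 : StronglyMeasurable fun q : (ℝ × ℝ) × ℝ =>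
        (lineBump n).normed volume (q.1.2 - q.2) * w (q.1.1, q.2) :=
      (((lineBump n).continuous_normed.measurable.comp (measurable_fst.snd.sub measurable_snd)).mul
        (hw.comp (measurable_fst.fst.prodMk measurable_snd))).stronglyMeasurable
    have h2 := (h1.integral_prod_right' (ν := (volume : Measure ℝ))).measurable
    exact h2.indicator (measurable_fst hGm)
  · by_cases hp : p.1 ∈ Ioo 0 τ \ N
    · obtain ⟨hPu, hae⟩ := hGgood _ hp
      simp only [hA, indicator_of_mem hp]
      have hlim := ContDiffBump.convolution_tendsto_right_of_continuous (μ := volume)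
        (φ := lineBump) (l := atTop) tendsto_one_div_add_atTop_nhds_zero_nat (hcont _ hPu) p.2
      refine hlim.congr fun n => ?_
      rw [convolution_eq_swap]
      refine integral_congr_ae ?_
      filter_upwards [hae] with y hy
      rw [← hy]; rfl
    · simp only [hA, indicator_of_notMem hp]
      exact tendsto_const_nhds

/-- Differentiability of a continuous function can be tested on rational increments. -/
theorem hasDerivAt_iff_rat {f : ℝ → ℝ} (hf : Continuous f) {f' x : ℝ} :
    HasDerivAt f f' x ↔ ∀ n : ℕ, ∃ m : ℕ, ∀ h : ℚ, |(h : ℝ)| < 1 / (m + 1) →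
      |f (x + h) - f x - h * f'| ≤ 1 / (n + 1) * |(h : ℝ)| := by
  rw [hasDerivAt_iff_isLittleO_nhds_zero, Asymptotics.isLittleO_iff]
  constructor
  · intro h n
    obtain ⟨ε, hε, hb⟩ := Metric.eventually_nhds_iff.1 (h (c := 1 / ((n : ℝ) + 1)) (by positivity))
    obtain ⟨m, hm⟩ := exists_nat_one_div_lt hε
    refine ⟨m, fun k hk => ?_⟩
    exact hb (by rw [Real.dist_eq, sub_zero]; exact hk.trans hm)
  · intro h c hc
    obtain ⟨n, hn⟩ := exists_nat_one_div_lt hc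
    obtain ⟨m, hm⟩ := h n
    -- The inequality is closed in the increment, so it passes from rational to real increments.
    have hdense : ∀ k ∈ Metric.ball (0 : ℝ) (1 / (m + 1)),
        |f (x + k) - f x - k * f'| ≤ 1 / (n + 1) * |k| := by
      have hcl : IsClosed {k : ℝ | |f (x + k) - f x - k * f'| ≤ 1 / (n + 1) * |k|} :=
        isClosed_le (by fun_prop) (by fun_prop)
      have hsub : Metric.ball (0 : ℝ) (1 / (m + 1)) ∩ range ((↑) : ℚ → ℝ)
          ⊆ {k : ℝ | |f (x + k) - f x - k * f'| ≤ 1 / (n + 1) * |k|} := by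
        rintro _ ⟨hk, q, rfl⟩
        rw [mem_ball_zero_iff, Real.norm_eq_abs] at hk
        exact hm q hk
      intro k hk
      exact hcl.closure_subset_iff.2 hsub
        (Rat.denseRange_cast.open_subset_closure_inter Metric.isOpen_ball hk)
    filter_upwards [Metric.ball_mem_nhds (0 : ℝ) (by positivity : (0 : ℝ) < 1 / (m + 1))] with k hk
    refine (hdense k hk).trans ?_
    exact mul_le_mul_of_nonneg_right hn.le (abs_nonneg k)

/-- A measurable version of the space derivative of a function with Lipschitz slices. -/
theorem exists_measurable_deriv {U : ℝ × ℝ → ℝ} (hU : Measurable U) {C : NNReal}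
    (hlip : ∀ t, LipschitzWith C fun x => U (t, x)) :
    ∃ D : ℝ × ℝ → ℝ, Measurable D ∧ (∀ p, |D p| ≤ C) ∧
      ∀ᵐ p : ℝ × ℝ, HasDerivAt (fun x => U (p.1, x)) (D p) p.2 := by
  set q : ℕ → ℝ × ℝ → ℝ := fun n p => (n + 1) * (U (p.1, p.2 + 1 / (n + 1)) - U p) with hq
  have hqm : ∀ n, Measurable (q n) := fun n =>
    ((hU.comp (measurable_fst.prodMk (measurable_snd.add_const _))).sub hU).const_mul _
  -- This candidate is measurable without any differentiability, and equals the derivative wherever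
  -- the latter exists.
  set D : ℝ × ℝ → ℝ := fun p => limsup (fun n => q n p) atTop with hD
  have hDm : Measurable D := Measurable.limsup hqm
  set E : Set (ℝ × ℝ) := {p | HasDerivAt (fun x => U (p.1, x)) (D p) p.2} with hE
  have hEm : MeasurableSet E := by
    -- The criterion with rational increments presents `E` by countable operations. It is then
    -- measurable, and Fubini's theorem reduces to Rademacher's theorem on each slice.
    have : E = ⋂ n : ℕ, ⋃ m : ℕ, ⋂ h : ℚ, {p : ℝ × ℝ | |(h : ℝ)| < 1 / ((m : ℝ) + 1) →
        |U (p.1, p.2 + h) - U p - h * D p| ≤ 1 / ((n : ℝ) + 1) * |(h : ℝ)|} := by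
      ext p
      simp only [hE, mem_ofPred_eq, mem_iInter, mem_iUnion]
      exact hasDerivAt_iff_rat (hlip p.1).continuous
    rw [this]
    refine MeasurableSet.iInter fun n => MeasurableSet.iUnion fun m => MeasurableSet.iInter fun h => ?_
    by_cases hh : |(h : ℝ)| < 1 / ((m : ℝ) + 1)
    · simp only [hh, true_imp_iff]
      have h1 : Measurable fun p : ℝ × ℝ => U (p.1, p.2 + h) - U p - h * D p :=
        ((hU.comp (measurable_fst.prodMk (measurable_snd.add_const _))).sub hU).sub
          (hDm.const_mul _)
      exact measurableSet_le h1.norm measurable_const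
    · simp only [hh, false_imp_iff]
      exact MeasurableSet.const True
  have hEae : ∀ᵐ p : ℝ × ℝ, p ∈ E := by
    rw [Measure.volume_eq_prod]
    refine (Measure.ae_prod_iff_ae_ae hEm).2 (ae_of_all _ fun t => ?_)
    filter_upwards [(hlip t).ae_differentiableAt_real] with x hx
    have hlim : Tendsto (fun n => q n (t, x)) atTop (𝓝 (deriv (fun x => U (t, x)) x)) := by
      have h1 := hx.hasDerivAt.tendsto_slope_zero_right
      have h2 : Tendsto (fun n : ℕ => 1 / ((n : ℝ) + 1)) atTop (𝓝[>] 0) :=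
        tendsto_nhdsWithin_iff.2 ⟨tendsto_one_div_add_atTop_nhds_zero_nat,
          Eventually.of_forall fun n => by rw [mem_Ioi]; positivity⟩
      refine (h1.comp h2).congr fun n => ?_
      simp [hq]
    simp only [hD]
    rw [hlim.limsup_eq]
    exact hx.hasDerivAt
  refine ⟨E.indicator D, hDm.indicator hEm, fun p => ?_, ?_⟩
  · by_cases hp : p ∈ E
    · rw [indicator_of_mem hp, ← hp.deriv]
      exact norm_deriv_le_of_lipschitz (hlip p.1)
    · rw [indicator_of_notMem hp, abs_zero]; exact C.coe_nonneg
  · filter_upwards [hEae] with p hp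
    rw [indicator_of_mem hp]; exact hp

/-- Integration by parts in space for a function with Lipschitz slices. -/
theorem integral_mul_dx_of_lipschitz {U D : ℝ × ℝ → ℝ} (hU : LocallyIntegrable U)
    (hD : LocallyIntegrable D) {C : NNReal} (hlip : ∀ t, LipschitzWith C fun x => U (t, x))
    (hder : ∀ᵐ p : ℝ × ℝ, HasDerivAt (fun x => U (p.1, x)) (D p) p.2) {φ : ℝ × ℝ → ℝ}
    (hφ : ContDiff ℝ ∞ φ) (hc : HasCompactSupport φ) :
    ∫ p, U p * dx φ p = -∫ p, D p * φ p := by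
  have hi1 := LocallyIntegrable.integrable_mul_test hU (contDiff_dx hφ).continuous
    (hasCompactSupport_dx hc)
  have hi2 := LocallyIntegrable.integrable_mul_test hD hφ.continuous hc
  rw [Measure.volume_eq_prod] at hi1 hi2 hder ⊢
  rw [integral_prod _ hi1, integral_prod _ hi2, ← integral_neg]
  refine integral_congr_ae ?_
  filter_upwards [Measure.ae_ae_of_ae_prod hder] with t ht
  have hφt : ContDiff ℝ ∞ fun x => φ (t, x) := hφ.comp (contDiff_const.prodMk contDiff_id)
  have hct := hasCompactSupport_slice_snd hc t
  obtain ⟨M', hM'⟩ := ContDiff.lipschitzWith_of_hasCompactSupport hct hφt (by norm_num)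
  have hp := (hlip t).integral_lineDeriv_mul_eq (μ := volume) hM' hct 1
  have e1 : ∫ x, lineDeriv ℝ (fun x => U (t, x)) x 1 * φ (t, x) = ∫ x, D (t, x) * φ (t, x) := by
    refine integral_congr_ae ?_
    filter_upwards [ht] with x hx
    have : HasDerivAt (fun x => U (t, x)) (D (t, x)) x := hx
    rw [this.differentiableAt.lineDeriv_eq_fderiv, fderiv_apply_one_eq_deriv, this.deriv]
  have e2 : ∀ x, lineDeriv ℝ (fun x => φ (t, x)) x (-1) = -dx φ (t, x) := fun x => by
    have := hasDerivAt_snd hφ t x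
    rw [this.differentiableAt.lineDeriv_eq_fderiv, map_neg, fderiv_apply_one_eq_deriv, this.deriv]
  simp only [e2] at hp
  rw [e1] at hp
  rw [hp, ← integral_neg]
  refine integral_congr_ae (ae_of_all _ fun x => ?_)
  ring

/-- A weak identity on `strip T` tested with functions supported in `t < τ` only involves
representatives on `strip τ`. -/
theorem setIntegral_strip_eq {T : EReal} {τ : ℝ} (hτT : (τ : EReal) < T) {k k₀ : ℝ × ℝ → ℝ}
    (hk : ∀ᵐ p, p ∈ strip τ → k p = k₀ p) (h0 : ∀ p, p ∉ strip τ → k₀ p = 0)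
    (hz : ∀ p : ℝ × ℝ, τ ≤ p.1 → k p = 0) : ∫ p in strip T, k p = ∫ p, k₀ p := by
  rw [← integral_indicator (measurableSet_strip T)]
  refine integral_congr_ae ?_
  filter_upwards [hk] with p hp
  by_cases hps : p ∈ strip τ
  · rw [indicator_of_mem (show p ∈ strip T from ⟨hps.1, hps.2.trans hτT⟩), hp hps]
  · rw [h0 p hps]
    by_cases hpT : p ∈ strip T
    · rw [indicator_of_mem hpT]
      refine hz p ?_
      by_contra! hlt
      exact hps ⟨hpT.1, EReal.coe_lt_coe_iff.2 hlt⟩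
    · rw [indicator_of_notMem hpT]

/-! ### Good representatives of a local solution -/

/-- The primitive of the initial density. -/
def initPrim (r : ℝ → ℝ) (x : ℝ) : ℝ := ∫ y in (0 : ℝ)..x, r y

/-- Bounded measurable representatives, on a strip, of a solution of the system, together with the
weak derivatives of the marker and of the space primitive of the density. -/
structure StripPair (V : ℝ → ℝ → ℝ) (κ r u₀ : ℝ → ℝ) (τ M : ℝ) (R U D v : ℝ × ℝ → ℝ) : Prop where
  R_meas : Measurable R
  U_meas : Measurable U
  D_meas : Measurable D
  v_meas : Measurable v
  R_le : ∀ p, |R p| ≤ M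
  U_le : ∀ p, |U p| ≤ M
  D_le : ∀ p, |D p| ≤ M
  v_le : ∀ p, |v p| ≤ M
  v_eq : ∀ᵐ p, p ∈ strip τ → v p = V (lookMean κ R p) (U p)
  U_dt : WeakDeriv τ U (fun p => -(v p * D p)) (1, 0)
  U_dx : WeakDeriv τ U D (0, 1)
  U_eq : ∀ᵐ p, p ∈ strip τ → U p = timeInt u₀ (fun p => v p * D p) p
  F_dt : WeakDeriv τ (timeInt (initPrim r) fun p => v p * R p) (fun p => -(v p * R p)) (1, 0)
  F_dx : WeakDeriv τ (timeInt (initPrim r) fun p => v p * R p) R (0, 1)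

theorem initPrim_lip {r : ℝ → ℝ} (hri : Integrable r) (hr : ∀ x, r x ∈ Icc (0 : ℝ) 1) (x y : ℝ) :
    |initPrim r x - initPrim r y| ≤ |x - y| := by
  rw [initPrim, initPrim, intervalIntegral.integral_interval_sub_left
    hri.intervalIntegrable hri.intervalIntegrable]
  have := intervalIntegral.norm_integral_le_of_norm_le_const (a := y) (b := x) (f := r) (C := 1)
    fun z _ => by rw [Real.norm_eq_abs, abs_of_nonneg (hr z).1]; exact (hr z).2
  rwa [one_mul] at this

theorem continuous_initPrim {r : ℝ → ℝ} (hri : Integrable r) : Continuous (initPrim r) :=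
  intervalIntegral.continuous_primitive (fun _ _ => hri.intervalIntegrable) 0

theorem ae_hasDerivAt_initPrim {r : ℝ → ℝ} (hri : Integrable r) :
    ∀ᵐ x, HasDerivAt (initPrim r) (r x) x := by
  have := LocallyIntegrable.ae_hasDerivAt_integral hri.locallyIntegrable
  filter_upwards [this] with x hx using hx 0

/-- Integration by parts on the line against a smooth compactly supported function. -/
theorem integral_initPrim_mul {r : ℝ → ℝ} (hri : Integrable r) (hr : ∀ x, r x ∈ Icc (0 : ℝ) 1)
    {θ : ℝ × ℝ → ℝ} (hθ : ContDiff ℝ ∞ θ) (hc : HasCompactSupport θ) (t : ℝ) :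
    ∫ x, initPrim r x * dx θ (t, x) = -∫ x, r x * θ (t, x) := by
  have hlip : LipschitzWith 1 (initPrim r) := LipschitzWith.of_dist_le_mul fun x y => by
    rw [Real.dist_eq, Real.dist_eq, NNReal.coe_one, one_mul]; exact initPrim_lip hri hr x y
  have hθt : ContDiff ℝ ∞ fun x => θ (t, x) := hθ.comp (contDiff_const.prodMk contDiff_id)
  have hct := hasCompactSupport_slice_snd hc t
  obtain ⟨M', hM'⟩ := ContDiff.lipschitzWith_of_hasCompactSupport hct hθt (by norm_num)
  have hp := hlip.integral_lineDeriv_mul_eq (μ := volume) hM' hct 1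
  have e1 : ∫ x, lineDeriv ℝ (initPrim r) x 1 * θ (t, x) = ∫ x, r x * θ (t, x) := by
    refine integral_congr_ae ?_
    filter_upwards [ae_hasDerivAt_initPrim hri] with x hx
    rw [hx.differentiableAt.lineDeriv_eq_fderiv, fderiv_apply_one_eq_deriv, hx.deriv]
  have e2 : ∀ x, lineDeriv ℝ (fun x => θ (t, x)) x (-1) = -dx θ (t, x) := fun x => by
    have := hasDerivAt_snd hθ t x
    rw [this.differentiableAt.lineDeriv_eq_fderiv, map_neg, fderiv_apply_one_eq_deriv, this.deriv]
  simp only [e2] at hp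
  rw [e1] at hp
  rw [hp, ← integral_neg]
  refine integral_congr_ae (ae_of_all _ fun x => ?_)
  ring

/-- A compactly supported test function is the time primitive of its time derivative. -/
theorem timePrim_dt {φ : ℝ × ℝ → ℝ} (hφ : ContDiff ℝ ∞ φ) (hc : HasCompactSupport φ) (p : ℝ × ℝ) :
    timePrim (dt φ) p = φ p := by
  have h := integral_Ioi_of_hasDerivAt_of_tendsto (f := fun t => φ (t, p.2))
    (f' := fun t => dt φ (t, p.2)) (a := p.1) (m := 0)
    (hφ.continuous.comp (continuous_id.prodMk continuous_const)).continuousWithinAt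
    (fun t _ => hasDerivAt_fst hφ t p.2)
    (integrable_slice_fst (contDiff_dt hφ).continuous (hasCompactSupport_dt hc) p.2).integrableOn
    ?_
  · rw [timePrim, h]; simp
  · obtain ⟨N, hN, hs⟩ := exists_support_bound hc
    refine tendsto_const_nhds.congr' ?_
    filter_upwards [eventually_gt_atTop N] with t ht
    exact (hs t p.2 (Or.inl (ht.trans_le (le_abs_self t)))).symm

theorem tsupport_fderiv_apply_subset {φ : ℝ × ℝ → ℝ} (w : ℝ × ℝ) :
    Function.support (fun p => fderiv ℝ φ p w) ⊆ tsupport φ := fun p hp => by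
  refine support_fderiv_subset ℝ fun h => hp ?_
  simp only; rw [h]; rfl

theorem abs_mul_le_of_abs_le {f g : ℝ × ℝ → ℝ} {M : ℝ} (hf : ∀ p, |f p| ≤ M) (hg : ∀ p, |g p| ≤ M)
    (p : ℝ × ℝ) : |f p * g p| ≤ M * M := by
  rw [abs_mul]
  exact mul_le_mul (hf p) (hg p) (abs_nonneg _) ((abs_nonneg _).trans (hf p))

theorem ae_abs_le_of_memLp_top {α : Type*} [MeasurableSpace α] {h : α → ℝ} {μ : Measure α}
    (hh : MemLp h ⊤ μ) : ∀ᵐ p ∂μ, |h p| ≤ (eLpNorm h ⊤ μ).toReal := by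
  filter_upwards [ae_le_eLpNormEssSup (f := h) (μ := μ)] with p hp
  rw [← Real.norm_eq_abs, ← toReal_enorm]
  refine ENNReal.toReal_mono hh.2.ne ?_
  rwa [eLpNorm_exponent_top]

/-- Every local solution has good representatives on every smaller strip. -/
theorem exists_stripPair {V : ℝ → ℝ → ℝ} {κ r u₀ η ρ₀ : ℝ → ℝ} (hV : Continuous (Function.uncurry V))
    (hκ : Continuous κ) (hnn : ∀ x, 0 ≤ κ x)
    (hint : ∀ x, IntegrableOn (fun y => κ (x - y)) (Ioi x))
    (hmass : ∀ x, ∫ y in Ioi x, κ (x - y) ≤ 1) (hη : ∀ x ≤ 0, η x = κ x)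
    (hri : Integrable r) (hr : ∀ x, r x ∈ Icc (0 : ℝ) 1) (hρr : ∀ᵐ x, ρ₀ x = r x)
    (hu₀ : Continuous u₀) {T : EReal} {τ : ℝ} (hτ : 0 < τ) (hτT : (τ : EReal) < T)
    {ρ u : ℝ → ℝ → ℝ} (h : IsSolution V η ρ₀ u₀ T ρ u) :
    ∃ (M : ℝ) (R U D v : ℝ × ℝ → ℝ), StripPair V κ r u₀ τ M R U D v ∧
      ∀ᵐ p, p ∈ strip τ → R p = ρ p.1 p.2 ∧ U p = u p.1 p.2 ∧ v p = speed V η ρ u p.1 p.2 := by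
  have hms := measurableSet_strip τ
  obtain ⟨Mρ, hMρ, hρM⟩ : ∃ M : ℝ, 0 ≤ M ∧
      ∀ᵐ p ∂(volume.restrict (strip τ)), |Function.uncurry ρ p| ≤ M :=
    ⟨_, ENNReal.toReal_nonneg, ae_abs_le_of_memLp_top (h.density_class τ hτT)⟩
  obtain ⟨R, hRm, hRM, hR0, hRρ⟩ := exists_measurable_rep hMρ (h.density_class τ hτT).1 hρM
  obtain ⟨hum, C, huC⟩ := h.marker_class τ hτT
  obtain ⟨G, hGm, hGsub, hGae, hGC, hUm⟩ := exists_measurable_slices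
    (P := fun f => (∀ x, |f x| ≤ C) ∧ LipschitzWith C f) hum huC fun f hf => hf.2.continuous
  set U : ℝ × ℝ → ℝ := fun p => G.indicator (fun t => u t p.2) p.1 with hU
  have hUC : ∀ p, |U p| ≤ C := fun p => by
    by_cases hp : p.1 ∈ G
    · simp only [hU, indicator_of_mem hp]; exact (hGC _ hp).1 _
    · simp only [hU, indicator_of_notMem hp, abs_zero]; exact C.coe_nonneg
  have hUlip : ∀ t, LipschitzWith C fun x => U (t, x) := fun t => by
    by_cases ht : t ∈ G
    · simp only [hU, indicator_of_mem ht]; exact (hGC _ ht).2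
    · simp only [hU, indicator_of_notMem ht]; exact LipschitzWith.const' 0
  have hUu : ∀ᵐ p : ℝ × ℝ, p ∈ strip τ → p.1 ∈ G := ae_strip_of_ae hGae
  have hU0 : ∀ p, p ∉ strip τ → U p = 0 := fun p hp => by
    simp only [hU]
    rw [indicator_of_notMem]
    exact fun hG => hp (by rw [strip_coe]; exact ⟨hGsub hG, mem_univ _⟩)
  obtain ⟨D, hDm, hDC, hDder⟩ := exists_measurable_deriv hUm hUlip
  have hDu : ∀ᵐ p : ℝ × ℝ, p ∈ strip τ → deriv (u p.1) p.2 = D p := by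
    filter_upwards [hDder, hUu] with p hp hpG hps
    simp only [hU, indicator_of_mem (hpG hps)] at hp
    exact hp.deriv
  have hcm := measurable_lookMean hκ.measurable hRm
  have hcM := abs_lookMean_le hnn hint hmass hRM
  obtain ⟨Mv, hMv⟩ := ((isCompact_Icc (a := -Mρ) (b := Mρ)).prod
    (isCompact_Icc (a := -(C : ℝ)) (b := C))).exists_bound_of_continuousOn hV.continuousOn
  have hMv0 : 0 ≤ Mv := (norm_nonneg _).trans
    (hMv (0, 0) ⟨⟨by simpa using hMρ, hMρ⟩, ⟨by simp, C.coe_nonneg⟩⟩)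
  -- Extension by zero makes the fluxes `v * D` and `v * R` vanish at nonpositive times, as
  -- integration by parts in time requires, and lets all integrals run over the plane.
  set v : ℝ × ℝ → ℝ := (strip τ).indicator fun p => V (lookMean κ R p) (U p) with hv
  have hvm : Measurable v := (hV.measurable.comp (hcm.prodMk hUm)).indicator hms
  have hvM : ∀ p, |v p| ≤ Mv := fun p => by
    by_cases hp : p ∈ strip τ
    · rw [hv, indicator_of_mem hp]
      exact hMv (lookMean κ R p, U p) ⟨abs_le.1 (hcM p), abs_le.1 (hUC p)⟩
    · rw [hv, indicator_of_notMem hp, abs_zero]; exact hMv0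
  have hv0 : ∀ p, p ∉ strip τ → v p = 0 := fun p hp => indicator_of_notMem hp _
  have hvs : ∀ᵐ p : ℝ × ℝ, p ∈ strip τ → speed V η ρ u p.1 p.2 = v p := by
    filter_upwards [ae_strip_of_ae (ae_conv_eq_lookMean hη hRρ), hUu] with p h1 h2 hps
    rw [hv, indicator_of_mem hps, speed, h1 hps]
    simp only [hU, indicator_of_mem (h2 hps)]
  have hUu' : ∀ᵐ p : ℝ × ℝ, p ∈ strip τ → U p = u p.1 p.2 := by
    filter_upwards [hUu] with p hp hps
    simp only [hU, indicator_of_mem (hp hps)]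
  set M := max Mρ (max C Mv)
  have hM1 : Mρ ≤ M := le_max_left _ _
  have hM2 : (C : ℝ) ≤ M := (le_max_left _ _).trans (le_max_right _ _)
  have hM3 : Mv ≤ M := (le_max_right _ _).trans (le_max_right _ _)
  have hvM' : ∀ p, |v p| ≤ M := fun p => (hvM p).trans hM3
  have hvD := abs_mul_le_of_abs_le hvM' fun p => (hDC p).trans hM2
  have hvR := abs_mul_le_of_abs_le hvM' fun p => (hRM p).trans hM1
  have hvDm : Measurable fun p => v p * D p := hvm.mul hDm
  have hvRm : Measurable fun p => v p * R p := hvm.mul hRm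
  have hoff : ∀ {p : ℝ × ℝ}, p.1 ≤ 0 → p ∉ strip τ := fun hp hps => absurd hps.1 (not_lt.2 hp)
  have hUli := locallyIntegrable_of_abs_le hUm hUC
  have hDli := locallyIntegrable_of_abs_le hDm hDC
  have hRli := locallyIntegrable_of_abs_le hRm hRM
  have hvDli := locallyIntegrable_of_abs_le hvDm hvD
  have hvRli := locallyIntegrable_of_abs_le hvRm hvR
  have hzero : ∀ {θ : ℝ × ℝ → ℝ}, IsTest τ θ → ∀ (w p : ℝ × ℝ), τ ≤ p.1 →
      θ p = 0 ∧ fderiv ℝ θ p w = 0 := by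
    intro θ hθ w p hp
    have hnot : p ∉ tsupport θ := fun hmem =>
      absurd (EReal.coe_lt_coe_iff.1 (hθ.supp p hmem)) (not_lt.2 hp)
    exact ⟨image_eq_zero_of_notMem_tsupport hnot,
      by by_contra hne; exact hnot (tsupport_fderiv_apply_subset w hne)⟩
  have hTest : ∀ {θ : ℝ × ℝ → ℝ}, IsTest τ θ → IsTest T θ := fun hθ =>
    ⟨hθ.smooth, hθ.compact, fun p hp => (hθ.supp p hp).trans hτT⟩
  -- The weak equations are rewritten for the representatives, over the whole plane. Test functions
  -- may be nonzero at time `0`, so the initial datum is kept.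
  have hmark : ∀ θ : ℝ × ℝ → ℝ, IsTest τ θ →
      (∫ p, U p * dt θ p) - (∫ p, v p * D p * θ p) + ∫ x, u₀ x * θ (0, x) = 0 := by
    intro θ hθ
    have e := h.marker_eq θ (hTest hθ)
    rw [setIntegral_strip_eq hτT (k₀ := fun p => U p * dt θ p - v p * D p * θ p) ?_ ?_ ?_,
      integral_sub (LocallyIntegrable.integrable_mul_test hUli (contDiff_dt hθ.smooth).continuous
        (hasCompactSupport_dt hθ.compact))
      (LocallyIntegrable.integrable_mul_test hvDli hθ.smooth.continuous hθ.compact)] at e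
    · exact e
    · filter_upwards [hUu', hvs, hDu] with p h1 h2 h3 hps
      rw [h1 hps, h2 hps, h3 hps, dt]
    · intro p hp
      simp only [hU0 p hp, hv0 p hp]; ring
    · intro p hp
      rw [(hzero hθ (1, 0) p hp).1, (hzero hθ (1, 0) p hp).2]; ring
  have hdens : ∀ θ : ℝ × ℝ → ℝ, IsTest τ θ →
      (∫ p, R p * dt θ p) + (∫ p, v p * R p * dx θ p) + ∫ x, r x * θ (0, x) = 0 := by
    intro θ hθ
    have e := h.density_eq θ (hTest hθ)
    have e0 : ∫ x, ρ₀ x * θ (0, x) = ∫ x, r x * θ (0, x) := by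
      refine integral_congr_ae ?_
      filter_upwards [hρr] with x hx
      rw [hx]
    rw [setIntegral_strip_eq hτT (k₀ := fun p => R p * dt θ p + v p * R p * dx θ p) ?_ ?_ ?_,
      integral_add (LocallyIntegrable.integrable_mul_test hRli (contDiff_dt hθ.smooth).continuous
        (hasCompactSupport_dt hθ.compact))
      (LocallyIntegrable.integrable_mul_test hvRli (contDiff_dx hθ.smooth).continuous
        (hasCompactSupport_dx hθ.compact)), e0] at e
    · exact e
    · filter_upwards [hRρ, hvs] with p h1 h2 hps
      rw [h1 hps, h2 hps, dt, dx]; rfl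
    · intro p hp
      simp only [hR0 p hp]; ring
    · intro p hp
      rw [(hzero hθ (1, 0) p hp).2, (hzero hθ (0, 1) p hp).2]; ring
  have htest : ∀ {φ : ℝ × ℝ → ℝ}, ContDiff ℝ ∞ φ → HasCompactSupport φ → tsupport φ ⊆ strip τ →
      IsTest τ φ := fun hφ hc hs => ⟨hφ, hc, fun p hp => (hs hp).2⟩
  have hsub : ∀ {φ : ℝ × ℝ → ℝ} (w : ℝ × ℝ), tsupport φ ⊆ strip τ →
      tsupport (fun p => fderiv ℝ φ p w) ⊆ strip τ := fun w hs =>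
    (closure_minimal (tsupport_fderiv_apply_subset w) (isClosed_tsupport _)).trans hs
  refine ⟨M, R, U, D, v, ⟨hRm, hUm, hDm, hvm, fun p => (hRM p).trans hM1,
    fun p => (hUC p).trans hM2, fun p => (hDC p).trans hM2, hvM',
    ae_of_all _ fun p hp => indicator_of_mem hp _, ?_, ?_, ?_, ?_, ?_⟩, ?_⟩
  · intro φ hφ hc hs
    have e := hmark φ (htest hφ hc hs)
    have e0 : ∫ x, u₀ x * φ (0, x) = 0 := by
      simp [eq_zero_of_nonpos hs le_rfl]
    simp only [neg_mul, integral_neg, neg_neg]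
    change ∫ p, U p * dt φ p = _
    linarith
  · intro φ hφ hc hs
    exact integral_mul_dx_of_lipschitz hUli hDli hUlip hDder hφ hc
  -- Testing the marker equation with a time primitive of `φ` integrates the equation in time and
  -- recovers the initial trace. This later gives `|U - u₀| ≤ M * M * t`.
  · refine ae_eq_of_forall_test hUli (locallyIntegrable_timeInt hu₀ hvDm hvD) fun φ hφ hc hs => ?_
    obtain ⟨θ, hθ, hθφ⟩ := exists_test_timePrim hτ hφ hc hs
    rw [integral_timeInt_mul hu₀ hvDm hvD (fun p hp => by simp only [hv0 p (hoff hp), zero_mul])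
      hφ.continuous hc (fun t x ht => eq_zero_of_nonpos hs ht x) hθ.smooth.continuous hθ.compact
      fun p hp => (hθφ p hp).1]
    have e := hmark θ hθ
    -- The derivative of `θ` is `φ` only for nonnegative times, which is enough because `U` vanishes
    -- off the strip.
    have e1 : ∫ p, U p * dt θ p = ∫ p, U p * φ p := by
      refine integral_congr_ae (ae_of_all _ fun p => ?_)
      rcases le_or_gt 0 p.1 with hp | hp
      · simp only [(hθφ p hp).2.1]
      · simp only [hU0 p (hoff hp.le), zero_mul]
    linarith
  -- True by construction of the primitive in time, without the density equation.
  · intro φ hφ hc hs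
    change ∫ p, timeInt (initPrim r) (fun p => v p * R p) p * dt φ p = _
    rw [integral_timeInt_mul (continuous_initPrim hri) hvRm hvR
      (fun p hp => by simp only [hv0 p (hoff hp), zero_mul]) (contDiff_dt hφ).continuous
      (hasCompactSupport_dt hc) (fun t x ht => eq_zero_of_nonpos (hsub (1, 0) hs) ht x)
      hφ.continuous hc fun p _ => (timePrim_dt hφ hc p).symm]
    simp [eq_zero_of_nonpos hs le_rfl, integral_neg]
  -- Here the density equation enters, tested with a time primitive of `φ`: it says that the
  -- function built from the initial mass and the flux through `x` is a space primitive of the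
  -- density.
  · intro φ hφ hc hs
    obtain ⟨θ, hθ, hθφ⟩ := exists_test_timePrim hτ hφ hc hs
    change ∫ p, timeInt (initPrim r) (fun p => v p * R p) p * dx φ p = _
    rw [integral_timeInt_mul (continuous_initPrim hri) hvRm hvR
      (fun p hp => by simp only [hv0 p (hoff hp), zero_mul]) (contDiff_dx hφ).continuous
      (hasCompactSupport_dx hc) (fun t x ht => eq_zero_of_nonpos (hsub (0, 1) hs) ht x)
      (contDiff_dx hθ.smooth).continuous (hasCompactSupport_dx hθ.compact)
      (fun p hp => (hθφ p hp).2.2), integral_initPrim_mul hri hr hθ.smooth hθ.compact]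
    have e := hdens θ hθ
    have e1 : ∫ p, R p * dt θ p = ∫ p, R p * φ p := by
      refine integral_congr_ae (ae_of_all _ fun p => ?_)
      rcases le_or_gt 0 p.1 with hp | hp
      · simp only [(hθφ p hp).2.1]
      · simp only [hR0 p (hoff hp.le), zero_mul]
    linarith
  · filter_upwards [hRρ, hUu', hvs] with p h1 h2 h3 hps
    exact ⟨h1 hps, h2 hps, (h3 hps).symm⟩

/-! ### Uniqueness on a strip -/

theorem WeakDeriv.sub {τ : ℝ} {F G f g : ℝ × ℝ → ℝ} {w : ℝ × ℝ} (hF : LocallyIntegrable F)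
    (hG : LocallyIntegrable G) (hf : LocallyIntegrable f) (hg : LocallyIntegrable g)
    (h₁ : WeakDeriv τ F f w) (h₂ : WeakDeriv τ G g w) :
    WeakDeriv τ (fun p => F p - G p) (fun p => f p - g p) w := by
  intro φ hφ hc hs
  have hcw : Continuous fun p => fderiv ℝ φ p w :=
    ((hφ.fderiv_right (m := ∞) (by norm_num)).clm_apply contDiff_const).continuous
  have hsw : HasCompactSupport fun p => fderiv ℝ φ p w := hc.fderiv_apply (𝕜 := ℝ) w
  simp only [sub_mul]
  rw [integral_sub (LocallyIntegrable.integrable_mul_test hF hcw hsw)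
      (LocallyIntegrable.integrable_mul_test hG hcw hsw),
    integral_sub (LocallyIntegrable.integrable_mul_test hf hφ.continuous hc)
      (LocallyIntegrable.integrable_mul_test hg hφ.continuous hc), h₁ φ hφ hc hs, h₂ φ hφ hc hs]
  ring

section StripPair

open LagSetup (eulVel)

variable {V : ℝ → ℝ → ℝ} {κ r u η : ℝ → ℝ} {lo hi : ℝ} {L K₀ : NNReal} {Z C₁ C₂ : ℝ}
  {X : ℝ → ℝ → ℝ} {τ M M' B l : ℝ} {R U D v R' U' D' v' : ℝ × ℝ → ℝ}

theorem StripPair.M_nonneg (P : StripPair V κ r u τ M R U D v) : 0 ≤ M :=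
  (abs_nonneg _).trans (P.R_le 0)

theorem StripPair.locallyIntegrable_R (P : StripPair V κ r u τ M R U D v) : LocallyIntegrable R :=
  locallyIntegrable_of_abs_le P.R_meas P.R_le

theorem StripPair.locallyIntegrable_F (P : StripPair V κ r u τ M R U D v) (hri : Integrable r) :
    LocallyIntegrable (timeInt (initPrim r) fun p => v p * R p) :=
  locallyIntegrable_timeInt (continuous_initPrim hri) (P.v_meas.mul P.R_meas)
    (abs_mul_le_of_abs_le P.v_le P.R_le)

/-- The marker of a solution whose velocity is close to that of the flow is close to the
transported marker. -/
theorem StripPair.marker_transport (P : StripPair V κ r u τ M R U D v)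
    (S : LagSetup V κ r u lo hi L K₀ Z C₁ C₂) (hX : IsLagFlow V κ r u X) (hB : 0 ≤ B) (hl : 0 < l)
    (hv : ∀ᵐ q : ℝ × ℝ, q ∈ strip τ → |eulVel V κ r u X q.1 q.2 - v q| ≤ B * Real.exp (l * q.1)) :
    ∀ᵐ q : ℝ × ℝ, q ∈ strip τ →
      |U q - u (label X q.1 q.2)| ≤ M * (B / l * Real.exp (l * q.1)) := by
  have hvD := abs_mul_le_of_abs_le P.v_le P.D_le
  refine S.transport_stability hX (M := K₀) (K₁ := M * M) P.M_nonneg K₀.coe_nonneg hB hl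
    (locallyIntegrable_of_abs_le P.U_meas P.U_le) (locallyIntegrable_of_abs_le P.D_meas P.D_le)
    (locallyIntegrable_of_abs_le (P.v_meas.mul P.D_meas) hvD).neg P.U_dt P.U_dx
    (ae_of_all _ fun q _ => P.D_le q) (mul_self_nonneg M) ?_ (fun x y => ?_) hv
  · filter_upwards [P.U_eq] with q hq hqs
    rw [hq hqs]
    exact abs_timeInt_sub_le hvD hqs.1.le
  · have := S.u_lip.dist_le_mul x y
    rwa [Real.dist_eq, Real.dist_eq] at this

/-- The same for the space primitive of the density. -/
theorem StripPair.prim_transport (P : StripPair V κ r u τ M R U D v)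
    (S : LagSetup V κ r u lo hi L K₀ Z C₁ C₂) (hX : IsLagFlow V κ r u X) (hB : 0 ≤ B) (hl : 0 < l)
    (hv : ∀ᵐ q : ℝ × ℝ, q ∈ strip τ → |eulVel V κ r u X q.1 q.2 - v q| ≤ B * Real.exp (l * q.1)) :
    ∀ᵐ q : ℝ × ℝ, q ∈ strip τ →
      |timeInt (initPrim r) (fun p => v p * R p) q - initPrim r (label X q.1 q.2)|
        ≤ M * (B / l * Real.exp (l * q.1)) := by
  have hvR := abs_mul_le_of_abs_le P.v_le P.R_le
  refine S.transport_stability hX (M := 1) (K₁ := M * M) P.M_nonneg zero_le_one hB hl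
    (P.locallyIntegrable_F S.r_int) P.locallyIntegrable_R
    (locallyIntegrable_of_abs_le (P.v_meas.mul P.R_meas) hvR).neg P.F_dt P.F_dx
    (ae_of_all _ fun q _ => P.R_le q) (mul_self_nonneg M) ?_ (fun x y => ?_) hv
  · exact ae_of_all _ fun q hqs => abs_timeInt_sub_le hvR hqs.1.le
  · rw [one_mul]; exact initPrim_lip S.r_int S.r_mem x y

/-- Two solutions, one of which has the velocity of the flow: an estimate of the difference of
the velocities improves itself. -/
theorem StripPair.abs_velocity_sub_le (P : StripPair V κ r u τ M R U D v)
    (P' : StripPair V κ r u τ M' R' U' D' v')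
    (S : LagSetup V κ r u lo hi L K₀ Z C₁ C₂) (hX : IsLagFlow V κ r u X)
    (hint : ∀ x, IntegrableOn (fun y => κ (x - y)) (Ioi x))
    (hv' : ∀ᵐ q, q ∈ strip τ → v' q = eulVel V κ r u X q.1 q.2) {N Λ : ℝ} (hΛ : 0 ≤ Λ)
    (hN : ∀ q, (lookMean κ R q, U q) ∈ Icc (-N) N ×ˢ Icc (-N) N ∧
      (lookMean κ R' q, U' q) ∈ Icc (-N) N ×ˢ Icc (-N) N)
    (hV : ∀ p ∈ Icc (-N) N ×ˢ Icc (-N) N, ∀ q ∈ Icc (-N) N ×ˢ Icc (-N) N,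
      |V p.1 p.2 - V q.1 q.2| ≤ Λ * (|p.1 - q.1| + |p.2 - q.2|))
    (hB : 0 ≤ B) (hl : 0 < l)
    (hv : ∀ᵐ q : ℝ × ℝ, q ∈ strip τ → |eulVel V κ r u X q.1 q.2 - v q| ≤ B * Real.exp (l * q.1)) :
    ∀ᵐ q : ℝ × ℝ, q ∈ strip τ → |eulVel V κ r u X q.1 q.2 - v q|
      ≤ Λ * (2 * κ 0 + 1) * M * (B / l) * Real.exp (l * q.1) := by
  -- The second pair has exactly the velocity of the flow, so stability with constant `0` identifies
  -- its marker and its primitive with the transported data.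
  have hexact : ∀ᵐ q : ℝ × ℝ, q ∈ strip τ →
      |eulVel V κ r u X q.1 q.2 - v' q| ≤ 0 * Real.exp (l * q.1) := by
    filter_upwards [hv'] with q hq hqs
    rw [hq hqs]; simp
  have hU := P.marker_transport S hX hB hl hv
  have hU' := P'.marker_transport S hX le_rfl hl hexact
  have hF := P.prim_transport S hX hB hl hv
  have hF' := P'.prim_transport S hX le_rfl hl hexact
  have hFl := P.locallyIntegrable_F S.r_int
  have hFl' := P'.locallyIntegrable_F S.r_int
  have hB' : 0 ≤ M * (B / l) := mul_nonneg P.M_nonneg (div_nonneg hB hl.le)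
  -- The difference of the primitives has the difference of the densities as weak derivative, so its
  -- small size controls the difference of the averages.
  have hκ := kernel_stability S.κ_mono S.κ_lip S.κ_nonneg hint (τ := τ) (M := M + M') hB' hl.le
    (hFl.sub hFl') (P.locallyIntegrable_R.sub P'.locallyIntegrable_R)
    (WeakDeriv.sub hFl hFl' P.locallyIntegrable_R P'.locallyIntegrable_R P.F_dx P'.F_dx)
    (ae_of_all _ fun q => (abs_sub _ _).trans (add_le_add (P.R_le q) (P'.R_le q))) (by
      filter_upwards [hF, hF'] with q h1 h2 hqs
      have h3 := h1 hqs
      have h4 := h2 hqs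
      rw [zero_div, zero_mul, mul_zero] at h4
      rw [Pi.sub_apply, sub_eq_zero.1 (abs_nonpos_iff.1 h4), mul_assoc]
      exact h3)
  filter_upwards [ae_strip_of_ae hκ, hU, hU', P.v_eq, P'.v_eq, hv'] with q h1 h2 h3 h4 h5 h6 hqs
  have hE := Real.exp_pos (l * q.1)
  have e1 := h1 hqs q.2
  have e2 := h2 hqs
  have e3 := h3 hqs
  rw [zero_div, zero_mul, mul_zero] at e3
  rw [← sub_eq_zero.1 (abs_nonpos_iff.1 e3)] at e2
  have hi : ∀ {A : ℝ × ℝ → ℝ} {m : ℝ}, Measurable A → (∀ p, |A p| ≤ m) →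
      IntegrableOn (fun y => A (q.1, y) * κ (q.2 - y)) (Ioi q.2) := by
    intro A m hA hm
    refine ((hint q.2).const_mul m).mono' ?_ (ae_of_all _ fun y => ?_)
    · exact ((hA.comp (measurable_const.prodMk measurable_id)).mul
        (S.κ_lip.continuous.comp (continuous_const.sub continuous_id)).measurable).aestronglyMeasurable
    · rw [norm_mul, Real.norm_eq_abs, Real.norm_eq_abs, abs_of_nonneg (S.κ_nonneg _)]
      exact mul_le_mul_of_nonneg_right (hm _) (S.κ_nonneg _)
  simp only [Pi.sub_apply, sub_mul] at e1
  rw [integral_sub (hi P.R_meas P.R_le) (hi P'.R_meas P'.R_le)] at e1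
  rw [← h6 hqs, h4 hqs, h5 hqs, abs_sub_comm]
  refine (hV _ (hN q).1 _ (hN q).2).trans ?_
  have e4 : |lookMean κ R q - lookMean κ R' q| ≤ 2 * κ 0 * (M * (B / l) * Real.exp (l * q.1)) := e1
  calc Λ * (|lookMean κ R q - lookMean κ R' q| + |U q - U' q|)
      ≤ Λ * (2 * κ 0 * (M * (B / l) * Real.exp (l * q.1)) + M * (B / l * Real.exp (l * q.1))) :=
        mul_le_mul_of_nonneg_left (add_le_add e4 e2) hΛ
    _ = _ := by ring

/-- Uniqueness on a strip. -/
theorem StripPair.ae_eq (P : StripPair V κ r u τ M R U D v)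
    (P' : StripPair V κ r u τ M' R' U' D' v')
    (S : LagSetup V κ r u lo hi L K₀ Z C₁ C₂) (hX : IsLagFlow V κ r u X)
    (hint : ∀ x, IntegrableOn (fun y => κ (x - y)) (Ioi x))
    (hmass : ∀ x, ∫ y in Ioi x, κ (x - y) ≤ 1)
    (hv' : ∀ᵐ q, q ∈ strip τ → v' q = eulVel V κ r u X q.1 q.2) :
    ∀ᵐ q, q ∈ strip τ → R q = R' q ∧ U q = U' q := by
  -- The velocity is Lipschitz on compact sets only; this square contains the averages and markers
  -- of both pairs.
  set N := max M M'
  have hc : IsCompact (Icc (-N) N ×ˢ Icc (-N) N) := isCompact_Icc.prod isCompact_Icc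
  obtain ⟨Λ, hΛ⟩ := (S.contDiff.contDiffOn (s := Icc (-N) N ×ˢ Icc (-N) N)).exists_lipschitzOnWith
    (by norm_num) ((convex_Icc _ _).prod (convex_Icc _ _)) hc
  have hV : ∀ p ∈ Icc (-N) N ×ˢ Icc (-N) N, ∀ q ∈ Icc (-N) N ×ˢ Icc (-N) N,
      |V p.1 p.2 - V q.1 q.2| ≤ Λ * (|p.1 - q.1| + |p.2 - q.2|) := fun p hp q hq => by
    have := hΛ.dist_le_mul p hp q hq
    refine (this.trans (mul_le_mul_of_nonneg_left ?_ Λ.coe_nonneg))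
    rw [Prod.dist_eq, Real.dist_eq, Real.dist_eq]
    exact max_le (le_add_of_nonneg_right (abs_nonneg _)) (le_add_of_nonneg_left (abs_nonneg _))
  have hN : ∀ q, (lookMean κ R q, U q) ∈ Icc (-N) N ×ˢ Icc (-N) N ∧
      (lookMean κ R' q, U' q) ∈ Icc (-N) N ×ˢ Icc (-N) N := fun q => by
    have h1 : M ≤ N := le_max_left _ _
    have h2 : M' ≤ N := le_max_right _ _
    exact ⟨⟨abs_le.1 ((abs_lookMean_le S.κ_nonneg hint hmass P.R_le q).trans h1),
      abs_le.1 ((P.U_le q).trans h1)⟩,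
      ⟨abs_le.1 ((abs_lookMean_le S.κ_nonneg hint hmass P'.R_le q).trans h2),
      abs_le.1 ((P'.U_le q).trans h2)⟩⟩
  have hA0 : 0 ≤ Λ * (2 * κ 0 + 1) * M :=
    mul_nonneg (mul_nonneg Λ.coe_nonneg (by linarith [S.κ_nonneg 0])) P.M_nonneg
  set A : ℝ := Λ * (2 * κ 0 + 1) * M
  -- One round of the estimate multiplies the constant by `A / l`, which this choice makes at most
  -- `1 / 2`.
  set l : ℝ := 2 * A + 1
  have hl : 0 < l := by positivity
  have hB₀ : 0 ≤ C₁ + M := add_nonneg S.C₁_nonneg P.M_nonneg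
  -- Since the weight is at least `1` on positive times, the bounds on the two velocities start the
  -- induction.
  have hiter : ∀ n : ℕ, ∀ᵐ q : ℝ × ℝ, q ∈ strip τ →
      |eulVel V κ r u X q.1 q.2 - v q| ≤ (C₁ + M) * (1 / 2) ^ n * Real.exp (l * q.1) := by
    intro n
    induction n with
    | zero =>
      refine ae_of_all _ fun q hqs => ?_
      have h1 := S.eulVel_mem (X := X) q.1 q.2
      have h2 : |eulVel V κ r u X q.1 q.2| ≤ C₁ := by rw [abs_of_nonneg h1.1]; exact h1.2
      have h3 : 1 ≤ Real.exp (l * q.1) := Real.one_le_exp (mul_nonneg hl.le hqs.1.le)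
      rw [pow_zero, mul_one]
      refine ((abs_sub _ _).trans (add_le_add h2 (P.v_le q))).trans ?_
      exact le_mul_of_one_le_right hB₀ h3
    | succ n ih =>
      have hB : 0 ≤ (C₁ + M) * (1 / 2) ^ n := by positivity
      filter_upwards [P.abs_velocity_sub_le P' S hX hint hv' Λ.coe_nonneg hN hV hB hl ih]
        with q hq hqs
      refine (hq hqs).trans (mul_le_mul_of_nonneg_right ?_ (Real.exp_pos _).le)
      change A * _ ≤ _
      rw [← mul_div_assoc, div_le_iff₀ hl, pow_succ]
      have : l = 2 * A + 1 := rfl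
      rw [this]
      nlinarith
  have hzero : ∀ᵐ q : ℝ × ℝ, q ∈ strip τ →
      |eulVel V κ r u X q.1 q.2 - v q| ≤ 0 * Real.exp (l * q.1) := by
    filter_upwards [ae_all_iff.2 hiter] with q hq hqs
    have hlim : Tendsto (fun n : ℕ => (C₁ + M) * (1 / 2) ^ n * Real.exp (l * q.1)) atTop
        (𝓝 ((C₁ + M) * 0 * Real.exp (l * q.1))) :=
      ((tendsto_pow_atTop_nhds_zero_of_lt_one (by norm_num) (by norm_num)).const_mul _).mul_const _
    rw [mul_zero] at hlim
    exact ge_of_tendsto' hlim fun n => hq n hqs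
  have hexact : ∀ᵐ q : ℝ × ℝ, q ∈ strip τ →
      |eulVel V κ r u X q.1 q.2 - v' q| ≤ 0 * Real.exp (l * q.1) := by
    filter_upwards [hv'] with q hq hqs
    rw [hq hqs]; simp
  have hU := P.marker_transport S hX le_rfl hl hzero
  have hU' := P'.marker_transport S hX le_rfl hl hexact
  have hF := P.prim_transport S hX le_rfl hl hzero
  have hF' := P'.prim_transport S hX le_rfl hl hexact
  have hFF : ∀ᵐ q : ℝ × ℝ, q ∈ strip τ → timeInt (initPrim r) (fun p => v p * R p) q
      = timeInt (initPrim r) (fun p => v' p * R' p) q := by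
    filter_upwards [hF, hF'] with q h1 h2 hqs
    have h3 := h1 hqs
    have h4 := h2 hqs
    rw [zero_div, zero_mul, mul_zero] at h3 h4
    rw [sub_eq_zero.1 (abs_nonpos_iff.1 h3), sub_eq_zero.1 (abs_nonpos_iff.1 h4)]
  -- The space primitives now agree, hence so do their weak derivatives, which are the densities.
  have hR := ae_eq_of_forall_test (τ := τ) P.locallyIntegrable_R P'.locallyIntegrable_R
    fun φ hφ hc hs => by
      have h1 := P.F_dx φ hφ hc hs
      have h2 := P'.F_dx φ hφ hc hs
      rw [integral_congr_ae (g := fun p =>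
        timeInt (initPrim r) (fun p => v' p * R' p) p * fderiv ℝ φ p (0, 1)) ?_, h2] at h1
      · exact (neg_inj.1 h1).symm
      · filter_upwards [hFF] with p hp
        by_cases hps : p ∈ strip τ
        · simp only [hp hps]
        · have : fderiv ℝ φ p (0, 1) = 0 := by
            by_contra hne; exact hps (hs (tsupport_fderiv_apply_subset _ hne))
          simp only [this, mul_zero]
  filter_upwards [hR, hU, hU'] with q h1 h2 h3 hqs
  have h4 := h2 hqs
  have h5 := h3 hqs
  rw [zero_div, zero_mul, mul_zero] at h4 h5
  exact ⟨h1 hqs, by rw [sub_eq_zero.1 (abs_nonpos_iff.1 h4), sub_eq_zero.1 (abs_nonpos_iff.1 h5)]⟩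

end StripPair

/-! ### From the hypotheses to the Lagrangian setup -/

section Kernel

variable {η : ℝ → ℝ}

/-- The kernel, extended by a constant to the right half line. -/
def extKernel (η : ℝ → ℝ) (x : ℝ) : ℝ := η (min x 0)

/-- The Lipschitz constant of the kernel on the left half line. -/
def kernelLip (η : ℝ → ℝ) : NNReal := (eLpNorm (deriv η) ⊤ (volume.restrict (Iio 0))).toNNReal

theorem extKernel_of_nonpos {x : ℝ} (hx : x ≤ 0) : η x = extKernel η x := by
  rw [extKernel, min_eq_left hx]

theorem IsKernel.monotone_extKernel (h : IsKernel η) : Monotone (extKernel η) := fun _ _ hxy =>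
  h.mono (mem_Iic.2 (min_le_right _ _)) (mem_Iic.2 (min_le_right _ _)) (min_le_min_right 0 hxy)

/-- A Lipschitz function is the integral of its derivative, so the essential supremum of `η'` is a
Lipschitz constant on the left half line. The growth rate needs this constant rather than an
arbitrary `K`. -/
theorem lipschitzWith_extKernel {K : NNReal} (h : LipschitzOnWith K η (Iic 0)) :
    LipschitzWith (kernelLip η) (extKernel η) := by
  have hK : ∀ᵐ x ∂(volume.restrict (Iio (0 : ℝ))), ‖deriv η x‖ ≤ K := by
    refine (ae_restrict_iff' measurableSet_Iio).2 (ae_of_all _ fun x hx => ?_)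
    exact norm_deriv_le_of_lipschitzOn (Iic_mem_nhds hx) h
  have hmem : MemLp (deriv η) ⊤ (volume.restrict (Iio (0 : ℝ))) :=
    memLp_top_of_bound (measurable_deriv η).aestronglyMeasurable K hK
  have hL := (ae_restrict_iff' measurableSet_Iio).1 (ae_abs_le_of_memLp_top hmem)
  have key : ∀ a b : ℝ, a ≤ b → b ≤ 0 → |η b - η a| ≤ kernelLip η * (b - a) := by
    intro a b hab hb
    have hac : AbsolutelyContinuousOnInterval η a b :=
      (h.mono (by rw [uIcc_of_le hab]; exact fun x hx => hx.2.trans hb)).absolutelyContinuousOnInterval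
    rw [← hac.integral_deriv_eq_sub]
    have := intervalIntegral.norm_integral_le_of_norm_le_const_ae (a := a) (b := b) (f := deriv η)
      (C := kernelLip η) ?_
    · rwa [abs_of_nonneg (sub_nonneg.2 hab)] at this
    · have h0 : ∀ᵐ x : ℝ, x ≠ 0 := by simp [ae_iff]
      filter_upwards [hL, h0] with x hx hx0 hxab
      rw [uIoc_of_le hab] at hxab
      exact hx (lt_of_le_of_ne (hxab.2.trans hb) hx0)
  refine LipschitzWith.of_dist_le_mul fun x y => ?_
  wlog hxy : x ≤ y generalizing x y
  · rw [dist_comm, dist_comm x]; exact this y x (le_of_not_ge hxy)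
  rw [Real.dist_eq, Real.dist_eq, abs_sub_comm]
  refine (key _ _ (min_le_min_right 0 hxy) (min_le_right _ _)).trans
    (mul_le_mul_of_nonneg_left ?_ (kernelLip η).coe_nonneg)
  have h1 := abs_min_sub_min_le_max y 0 x 0
  rw [sub_self, abs_zero, max_eq_left (abs_nonneg _), abs_sub_comm y] at h1
  exact (le_abs_self _).trans h1

theorem extKernel_eqOn (x : ℝ) : EqOn (fun y => η (x - y)) (fun y => extKernel η (x - y)) (Ioi x) :=
  fun _ hy => extKernel_of_nonpos (sub_nonpos.2 (le_of_lt hy))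

theorem IsKernel.integrableOn_extKernel (h : IsKernel η) (x : ℝ) :
    IntegrableOn (fun y => extKernel η (x - y)) (Ioi x) :=
  (h.integrable.comp_sub_left x).integrableOn.congr_fun (extKernel_eqOn x) measurableSet_Ioi

theorem IsKernel.integral_extKernel_le (h : IsKernel η) (x : ℝ) :
    ∫ y in Ioi x, extKernel η (x - y) ≤ 1 := by
  rw [← setIntegral_congr_fun measurableSet_Ioi (extKernel_eqOn x)]
  refine (setIntegral_le_integral (h.integrable.comp_sub_left x)
    (ae_of_all _ fun y => h.nonneg _)).trans ?_
  rw [integral_sub_left_eq_self (fun y => η y) volume x, h.integral_eq_one]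

end Kernel

section Velocity

variable {V : ℝ → ℝ → ℝ}

theorem continuous_d1 (h : ContDiff ℝ 2 (Function.uncurry V)) :
    Continuous fun p : ℝ × ℝ => d1 V p.1 p.2 := by
  have hc : Continuous fun p => fderiv ℝ (Function.uncurry V) p (1, 0) :=
    ((h.fderiv_right (m := 1) (by norm_num)).clm_apply contDiff_const).continuous
  convert! hc using 2 with p
  have := HasFDerivAt.comp_hasDerivAt (l := Function.uncurry V) (f := fun s => (s, p.2)) p.1
    (h.contDiffAt.differentiableAt (by norm_num)).hasFDerivAt
    ((hasDerivAt_id p.1).prodMk (hasDerivAt_const p.1 p.2))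
  exact this.deriv

theorem continuous_d2 (h : ContDiff ℝ 2 (Function.uncurry V)) :
    Continuous fun p : ℝ × ℝ => d2 V p.1 p.2 := by
  have hc : Continuous fun p => fderiv ℝ (Function.uncurry V) p (0, 1) :=
    ((h.fderiv_right (m := 1) (by norm_num)).clm_apply contDiff_const).continuous
  convert! hc using 2 with p
  have := HasFDerivAt.comp_hasDerivAt (l := Function.uncurry V) (f := fun s => (p.1, s)) p.2
    (h.contDiffAt.differentiableAt (by norm_num)).hasFDerivAt
    ((hasDerivAt_const p.2 p.1).prodMk (hasDerivAt_id p.2))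
  exact this.deriv

theorem isCompact_rect (u₀ : ℝ → ℝ) : IsCompact (rect u₀) := isCompact_Icc.prod isCompact_Icc

end Velocity

section Data

variable {ρ₀ u₀ z₀ : ℝ → ℝ}

/-- A Borel representative of the initial density, with values in `[0, 1]`. -/
theorem IsInitialData.exists_rep (h : IsInitialData ρ₀ u₀ z₀) :
    ∃ r : ℝ → ℝ, Measurable r ∧ (∀ x, r x ∈ Icc (0 : ℝ) 1) ∧ ∀ᵐ x, ρ₀ x = r x := by
  have hm := h.integrable.aestronglyMeasurable
  refine ⟨fun x => max 0 (min 1 (hm.mk ρ₀ x)),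
    measurable_const.max (measurable_const.min hm.stronglyMeasurable_mk.measurable),
    fun x => ⟨le_max_left _ _, max_le zero_le_one (min_le_left _ _)⟩, ?_⟩
  filter_upwards [hm.ae_eq_mk, h.density_mem] with x h1 h2
  rw [← h1, min_eq_right h2.2, max_eq_right h2.1]

theorem IsInitialData.mem_Icc (h : IsInitialData ρ₀ u₀ z₀) (x : ℝ) :
    u₀ x ∈ Icc (⨅ y, u₀ y) (⨆ y, u₀ y) := by
  obtain ⟨C, hC⟩ := h.bounded
  exact ⟨ciInf_le ⟨0, by rintro _ ⟨y, rfl⟩; exact h.nonneg y⟩ x,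
    le_ciSup (f := u₀) ⟨C, by rintro _ ⟨y, rfl⟩; exact (le_abs_self _).trans (hC y)⟩ x⟩

/-- The relation `u₀' = z₀ ρ₀` in integrated form: the marker varies by at most `‖z₀‖` times the
mass between two labels. This is what the proof of order uses. -/
theorem IsInitialData.abs_sub_le (h : IsInitialData ρ₀ u₀ z₀) {r : ℝ → ℝ} (hri : Integrable r)
    (hr : ∀ x, r x ∈ Icc (0 : ℝ) 1) (hρr : ∀ᵐ x, ρ₀ x = r x) {a b : ℝ} (hab : a ≤ b) :
    |u₀ b - u₀ a| ≤ normInf z₀ * ∫ c in a..b, r c := by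
  obtain ⟨K, hK⟩ := h.lipschitz
  have hac : AbsolutelyContinuousOnInterval u₀ a b :=
    hK.lipschitzOnWith.absolutelyContinuousOnInterval
  rw [← hac.integral_deriv_eq_sub, ← intervalIntegral.integral_const_mul]
  refine intervalIntegral.norm_integral_le_of_norm_le (f := deriv u₀)
    (g := fun c => normInf z₀ * r c) hab ?_ (hri.intervalIntegrable.const_mul _)
  filter_upwards [h.deriv_eq, hρr, ae_abs_le_of_memLp_top h.memLp_z] with x h1 h2 h3 _
  rw [h1.deriv, h2, norm_mul, Real.norm_eq_abs, Real.norm_eq_abs, abs_of_nonneg (hr x).1]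
  exact mul_le_mul_of_nonneg_right h3 (hr x).1

end Data

/-- The hypotheses of the theorem put the Lagrangian construction to work. -/
theorem exists_lagSetup {V : ℝ → ℝ → ℝ} {η ρ₀ u₀ z₀ r : ℝ → ℝ} (hV : IsVelocity V u₀)
    (hη : IsKernel η) (hdata : IsInitialData ρ₀ u₀ z₀)
    (hLip : ∃ K : NNReal, LipschitzOnWith K η (Iic 0))
    (hneg : ∀ p ∈ rect u₀, d1 V p.1 p.2 * η 0 + normInf z₀ * d2 V p.1 p.2 ≤ 0)
    (hrm : Measurable r) (hr : ∀ x, r x ∈ Icc (0 : ℝ) 1) (hρr : ∀ᵐ x, ρ₀ x = r x) :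
    ∃ (K₀ : NNReal) (C₂ : ℝ), LagSetup V (extKernel η) r u₀ (⨅ x, u₀ x) (⨆ x, u₀ x) (kernelLip η) K₀
      (normInf z₀) (sSup ((fun p : ℝ × ℝ => |d1 V p.1 p.2|) '' rect u₀)) C₂ := by
  obtain ⟨K, hK⟩ := hLip
  obtain ⟨K₀, hK₀⟩ := hdata.lipschitz
  obtain ⟨C₂, hC₂⟩ := (isCompact_rect u₀).exists_bound_of_continuousOn
    (continuous_d2 hV.contDiff).continuousOn
  have hbdd : BddAbove ((fun p : ℝ × ℝ => |d1 V p.1 p.2|) '' rect u₀) :=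
    ((isCompact_rect u₀).image (continuous_d1 hV.contDiff).abs).bddAbove
  have hri : Integrable r := hdata.integrable.congr hρr
  have hnn : ∀ x, 0 ≤ extKernel η x := fun x => hη.nonneg _
  refine ⟨K₀, C₂, {
    contDiff := hV.contDiff
    nonneg := fun ξ hξ w hw => hV.nonneg (ξ, w) ⟨hξ, hw⟩
    d1_nonpos := fun ξ hξ w hw => hV.d1_nonpos (ξ, w) ⟨hξ, hw⟩
    d2_nonneg := fun ξ hξ w hw => hV.d2_nonneg (ξ, w) ⟨hξ, hw⟩
    d1_le := fun ξ hξ w hw => le_csSup hbdd ⟨(ξ, w), ⟨hξ, hw⟩, rfl⟩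
    d2_le := fun ξ hξ w hw => hC₂ (ξ, w) ⟨hξ, hw⟩
    one_eq_zero := hV.one_eq_zero
    κ_mono := hη.monotone_extKernel
    κ_nonneg := hnn
    κ_lip := lipschitzWith_extKernel hK
    κ_const := fun x hx => by rw [extKernel, extKernel, min_eq_right hx, min_self]
    r_meas := hrm
    r_mem := hr
    r_int := hri
    u_mem := hdata.mem_Icc
    u_lip := hK₀
    u_incr := fun a b hab => hdata.abs_sub_le hri hr hρr hab
    slope := fun ξ hξ w hw => by
      rw [← extKernel_of_nonpos le_rfl]; exact hneg (ξ, w) ⟨hξ, hw⟩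
    mass := fun a => ?_ }⟩
  -- At time `0` the averaged density is at most `1`, since `r ≤ 1` and the kernel has unit mass.
  refine le_trans ?_ (hη.integral_extKernel_le a)
  refine integral_mono_of_nonneg (ae_of_all _ fun b => mul_nonneg (hnn _) (hr b).1)
    (hη.integrableOn_extKernel a) (ae_of_all _ fun b => ?_)
  exact mul_le_of_le_one_right (hnn _) (hr b).2

theorem rate_eq_growthRate {V : ℝ → ℝ → ℝ} {η ρ₀ u₀ r : ℝ → ℝ}
    (hr : ∀ x, r x ∈ Icc (0 : ℝ) 1) (hρr : ∀ᵐ x, ρ₀ x = r x) :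
    rate r (kernelLip η) (sSup ((fun p : ℝ × ℝ => |d1 V p.1 p.2|) '' rect u₀))
      = growthRate V η ρ₀ u₀ := by
  have : ∫ x, |ρ₀ x| = ∫ x, r x := by
    refine integral_congr_ae ?_
    filter_upwards [hρr] with x hx
    rw [hx, abs_of_nonneg (hr x).1]
  rw [rate, growthRate, this, kernelLip, ENNReal.coe_toNNReal_eq_toReal, mul_assoc]

/-! ### The global solution, and comparison with local ones -/

/-- The Lagrangian solution is a solution in the sense of distributions. -/
theorem LagSetup.isSolution {V : ℝ → ℝ → ℝ} {κ r u η ρ₀ : ℝ → ℝ} {lo hi : ℝ} {L K₀ : NNReal}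
    {Z C₁ C₂ : ℝ} {X : ℝ → ℝ → ℝ} (S : LagSetup V κ r u lo hi L K₀ Z C₁ C₂)
    (hX : IsLagFlow V κ r u X) (hη : ∀ x ≤ 0, η x = κ x) (hρr : ∀ᵐ x, ρ₀ x = r x) :
    IsSolution V η ρ₀ u ⊤ (eulDensity r X) (eulMarker u X) where
  density_class τ _ := by
    refine memLp_top_of_bound (S.measurable_eulDensity hX).aestronglyMeasurable (labelLip r L C₁ τ) ?_
    refine (ae_restrict_iff' (measurableSet_strip τ)).2 (ae_of_all _ fun p hp => ?_)
    have h := S.eulDensity_mem hX p.1 p.2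
    rw [Function.uncurry, Real.norm_eq_abs, abs_of_nonneg h.1]
    exact h.2.trans (S.labelLip_mono (EReal.coe_lt_coe_iff.1 hp.2).le)
  marker_class τ _ := by
    refine ⟨(S.continuous_eulMarker hX).aestronglyMeasurable, ?_⟩
    have hl := labelLip_pos r L C₁ τ
    refine ⟨max (max (-lo) hi).toNNReal (K₀ * (labelLip r L C₁ τ).toNNReal), ?_⟩
    refine (ae_restrict_iff' measurableSet_Ioo).2 (ae_of_all _ fun t ht => ⟨fun x => ?_, ?_⟩)
    · rw [NNReal.coe_max]
      refine le_trans ?_ (le_max_left _ _)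
      refine le_trans ?_ (Real.le_coe_toNNReal _)
      have h := S.u_mem (label X t x)
      rw [abs_le']
      exact ⟨h.2.trans (le_max_right _ _), (neg_le_neg h.1).trans (le_max_left _ _)⟩
    · refine LipschitzWith.of_dist_le_mul fun x y => ?_
      rw [Real.dist_eq, Real.dist_eq]
      have h := S.eulMarker_lip_joint hX t t x y
      rw [sub_self, abs_zero, mul_zero, zero_add] at h
      refine h.trans ?_
      rw [← mul_assoc]
      refine mul_le_mul_of_nonneg_right ?_ (abs_nonneg _)
      rw [NNReal.coe_max, NNReal.coe_mul, Real.coe_toNNReal _ hl.le]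
      refine le_trans ?_ (le_max_right _ _)
      exact mul_le_mul_of_nonneg_left (S.labelLip_mono ht.2.le) K₀.coe_nonneg
  density_eq φ hφ := by
    have h := S.eulDensity_weak hX hφ.smooth hφ.compact
    simp only [S.speed_eq hX hη]
    rw [integral_congr_ae (g := fun x => r x * φ (0, x)) ?_]
    · exact h
    · filter_upwards [hρr] with x hx
      rw [hx]
  marker_eq φ hφ := by
    simp only [S.speed_eq hX hη]
    exact S.eulMarker_weak hX hφ.smooth hφ.compact

/-- Every local solution coincides with the Lagrangian solution. -/
theorem LagSetup.ae_eq_of_isSolution {V : ℝ → ℝ → ℝ} {κ r u η ρ₀ : ℝ → ℝ} {lo hi : ℝ} {L K₀ : NNReal}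
    {Z C₁ C₂ : ℝ} {X : ℝ → ℝ → ℝ} (S : LagSetup V κ r u lo hi L K₀ Z C₁ C₂)
    (hX : IsLagFlow V κ r u X) (hη : ∀ x ≤ 0, η x = κ x) (hρr : ∀ᵐ x, ρ₀ x = r x)
    (hint : ∀ x, IntegrableOn (fun y => κ (x - y)) (Ioi x))
    (hmass : ∀ x, ∫ y in Ioi x, κ (x - y) ≤ 1) {T : EReal} {ρ' u' : ℝ → ℝ → ℝ}
    (h : IsSolution V η ρ₀ u T ρ' u') :
    ∀ᵐ p ∂(volume.restrict (strip T)),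
      ρ' p.1 p.2 = eulDensity r X p.1 p.2 ∧ u' p.1 p.2 = eulMarker u X p.1 p.2 := by
  have hV : Continuous (Function.uncurry V) := S.contDiff.continuous
  -- Countably many strips of rational height exhaust `strip T`, so the exceptional sets can be
  -- united.
  have key : ∀ τ : ℚ, 0 < (τ : ℝ) → ((τ : ℝ) : EReal) < T → ∀ᵐ p, p ∈ strip (τ : ℝ) →
      ρ' p.1 p.2 = eulDensity r X p.1 p.2 ∧ u' p.1 p.2 = eulMarker u X p.1 p.2 := by
    intro τ hτ hτT
    obtain ⟨M, R, U, D, v, P, hP⟩ := exists_stripPair hV S.κ_lip.continuous S.κ_nonneg hint hmass hη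
      S.r_int S.r_mem hρr S.u_lip.continuous hτ hτT h
    -- The Lagrangian solution goes through the same reduction as the given one, so that both have
    -- the form required for the comparison.
    obtain ⟨M', R', U', D', v', P', hP'⟩ := exists_stripPair hV S.κ_lip.continuous S.κ_nonneg hint
      hmass hη S.r_int S.r_mem hρr S.u_lip.continuous hτ (EReal.coe_lt_top _)
      (S.isSolution hX hη hρr)
    have hv' : ∀ᵐ q : ℝ × ℝ, q ∈ strip (τ : ℝ) → v' q = LagSetup.eulVel V κ r u X q.1 q.2 := by
      filter_upwards [hP'] with q hq hqs
      rw [(hq hqs).2.2, S.speed_eq hX hη]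
    filter_upwards [hP, hP', P.ae_eq P' S hX hint hmass hv'] with q h1 h2 h3 hqs
    rw [← (h1 hqs).1, ← (h1 hqs).2.1, ← (h2 hqs).1, ← (h2 hqs).2.1]
    exact h3 hqs
  have hall : ∀ᵐ p : ℝ × ℝ, ∀ τ : ℚ, 0 < (τ : ℝ) → ((τ : ℝ) : EReal) < T → p ∈ strip (τ : ℝ) →
      ρ' p.1 p.2 = eulDensity r X p.1 p.2 ∧ u' p.1 p.2 = eulMarker u X p.1 p.2 := by
    refine ae_all_iff.2 fun τ => ?_
    by_cases hτ : 0 < (τ : ℝ)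
    · by_cases hτT : ((τ : ℝ) : EReal) < T
      · filter_upwards [key τ hτ hτT] with p hp _ _ using hp
      · exact ae_of_all _ fun p _ hcon => absurd hcon hτT
    · exact ae_of_all _ fun p hcon => absurd hcon hτ
  refine (ae_restrict_iff' (measurableSet_strip T)).2 ?_
  filter_upwards [hall] with p hp hps
  obtain ⟨τ, h1, h2⟩ := EReal.exists_rat_btwn_of_lt hps.2
  exact hp τ (hps.1.trans (EReal.coe_lt_coe_iff.1 h1)) h2 ⟨hps.1, h1⟩

end GARZ
end

theorem lemma2p3 (V : ℝ → ℝ → ℝ) (η ρ₀ u₀ z₀ : ℝ → ℝ)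
    (hV : GARZ.IsVelocity V u₀) (hη : GARZ.IsKernel η) (hdata : GARZ.IsInitialData ρ₀ u₀ z₀)
    (hLip : ∃ K : NNReal, LipschitzOnWith K η (Iic 0))
    (hneg : ∀ p ∈ GARZ.rect u₀,
      GARZ.d1 V p.1 p.2 * η 0 + GARZ.normInf z₀ * GARZ.d2 V p.1 p.2 ≤ 0) :
    ∃ ρ u : ℝ → ℝ → ℝ,
      -- a global solution, with the weak-star continuous density and the continuous marker
      GARZ.IsSolution V η ρ₀ u₀ ⊤ ρ u ∧
      GARZ.WeakStarContinuous ρ ∧ ρ 0 =ᵐ[volume] ρ₀ ∧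
      ContinuousOn (Function.uncurry u) (Ici 0 ×ˢ univ) ∧ u 0 = u₀ ∧
      -- the exponential bound, at every time
      (∀ t, 0 ≤ t → ∀ᵐ x, 0 ≤ ρ t x) ∧
      (∀ t, 0 ≤ t →
        eLpNorm (ρ t) ⊤ volume ≤
          ENNReal.ofReal (Real.exp (GARZ.growthRate V η ρ₀ u₀ * t))) ∧
      -- the other bounds that the local solution satisfies
      (∀ t x, 0 ≤ t → GARZ.conv η ρ t x ∈ Icc (0 : ℝ) 1) ∧
      (∀ t x, 0 ≤ t → u t x ∈ Icc (⨅ y, u₀ y) (⨆ y, u₀ y)) ∧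
      (∃ z : ℝ → ℝ → ℝ,
        AEStronglyMeasurable (Function.uncurry z) (volume.restrict (GARZ.strip ⊤)) ∧
        eLpNorm (Function.uncurry z) ⊤ (volume.restrict (GARZ.strip ⊤)) ≤ eLpNorm z₀ ⊤ volume ∧
        ∀ᵐ p ∂(volume.restrict (GARZ.strip ⊤)),
          HasDerivAt (u p.1) (ρ p.1 p.2 * z p.1 p.2) p.2) ∧
      -- it extends every solution on a time interval `[0, T[`
      (∀ (T : EReal) (ρ' u' : ℝ → ℝ → ℝ), 0 < T → GARZ.IsSolution V η ρ₀ u₀ T ρ' u' →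
        ∀ᵐ p ∂(volume.restrict (GARZ.strip T)),
          ρ' p.1 p.2 = ρ p.1 p.2 ∧ u' p.1 p.2 = u p.1 p.2) := by
  obtain ⟨r, hrm, hr, hρr⟩ := hdata.exists_rep
  obtain ⟨K₀, C₂, S⟩ := GARZ.exists_lagSetup hV hη hdata hLip hneg hrm hr hρr
  obtain ⟨X, hX0, hXc, hXd⟩ := S.exists_lagFlow
  have hX : GARZ.IsLagFlow V (GARZ.extKernel η) r u₀ X := ⟨hX0, hXc, hXd⟩
  have hκ : ∀ x ≤ 0, η x = GARZ.extKernel η x := fun x hx => GARZ.extKernel_of_nonpos hx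
  refine ⟨GARZ.eulDensity r X, GARZ.LagSetup.eulMarker u₀ X, S.isSolution hX hκ hρr,
    S.weakStarContinuous_eulDensity hX, ?_, (S.continuous_eulMarker hX).continuousOn, ?_,
    fun t _ => ae_of_all _ fun x => (S.eulDensity_mem hX t x).1, fun t ht => ?_, fun t x _ => ?_,
    fun t x _ => hdata.mem_Icc _, ?_, fun T ρ' u' _ h =>
      S.ae_eq_of_isSolution hX hκ hρr hη.integrableOn_extKernel hη.integral_extKernel_le h⟩
  · have hlab : GARZ.label X 0 = id := funext fun x => S.label_of_nonpos hX le_rfl x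
    filter_upwards [hρr] with x hx
    rw [hx, GARZ.eulDensity, hlab, deriv_id, mul_one, id]
  · exact funext fun x => S.eulMarker_of_nonpos hX le_rfl x
  · rw [eLpNorm_exponent_top, ← GARZ.rate_eq_growthRate hr hρr]
    refine eLpNormEssSup_le_of_ae_bound (ae_of_all _ fun x => ?_)
    have h := S.eulDensity_mem hX t x
    rw [GARZ.labelLip, max_eq_left ht] at h
    rw [Real.norm_eq_abs, abs_of_nonneg h.1]
    exact h.2
  · rw [S.conv_eulDensity hX hκ]
    exact S.posMean_mem hX t _
  · have hz := hdata.memLp_z.1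
    -- A Borel representative of `z₀` keeps the composition with the continuous label measurable; as
    -- labels pull null sets back to null sets, neither the bound nor the derivative relation is
    -- affected.
    refine ⟨fun t x => hz.mk z₀ (GARZ.label X t x),
      (hz.stronglyMeasurable_mk.measurable.comp
        (S.continuous_label hX).measurable).aestronglyMeasurable, ?_, ?_⟩
    · rw [eLpNorm_exponent_top, eLpNorm_exponent_top]
      refine eLpNormEssSup_le_of_ae_enorm_bound (ae_restrict_of_ae ?_)
      have h : ∀ᵐ a, ‖hz.mk z₀ a‖ₑ ≤ eLpNormEssSup z₀ volume := by
        filter_upwards [hz.ae_eq_mk, ae_le_eLpNormEssSup (f := z₀) (μ := volume)] with a h1 h2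
        rwa [← h1]
      exact S.ae_label_prod hX h
    · refine ae_restrict_of_ae (S.ae_hasDerivAt_eulMarker hX ?_)
      filter_upwards [hdata.deriv_eq, hz.ae_eq_mk, hρr] with a h1 h2 h3
      rwa [← h2, ← h3]
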